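/- Let $B=\operatorname{diag}(b_1,\dots,b_n)$ be a nonsingular diagonal complex matrix, let $Q=(q_{jk})_{j,k=1}^n\in L^1([0,1];\mathbb C^{n\times n})$, and let $C,D\in\mathbb C^{n\times n}$ with $\operatorname{rank}\,(C\ \ D)=n$. Let $L_{C,D}(Q)$ be the operator in $L^2([0,1];\mathbb C^n)$ given by $Ly=-iB^{-1}y'+Q(x)y$ on the domain of all absolutely continuous $y:[0,1]\to\mathbb C^n$ with $Ly\in L^2([0,1];\mathbb C^n)$ and $Cy(0)+Dy(1)=0$. Call $z\in\mathbb C$ admissible if $\operatorname{Re}(ib_jz)\neq0$ for all $j\in\{1,\dots,n\}$. For admissible $z$ let $T_{izB}$ be the $n\times n$ matrix whose $k$th column is the $k$th column $c_k$ of $C$ if $\operatorname{Re}(ib_kz)<0$ and the $k$th column $d_k$ of $D$ if $\operatorname{Re}(ib_kz)>0$. Let $T_{izB}^{c_j\to c_k}$ be $T_{izB}$ with its $j$th column replaced by $c_k$, and $T_{izB}^{d_k\to d_j}$ be $T_{izB}$ with its $k$th column replaced by $d_j$. Put $$\omega_0(z)=\det T_{izB},\qquad \omega_1(z)=\sum_{\substack{j,k:\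 \operatorname{Re}(ib_jz)<0,\\ \operatorname{Re}(ib_kz)>0}} \frac{\det T_{izB}^{c_j\to c_k}\,b_k\,q_{kj}(0)-\det T_{izB}^{d_k\to d_j}\,b_j\,q_{jk}(1)}{b_k-b_j}.$$ Assume that $q_{jk}$ is continuous at the points $0$ and $1$ (as a function on $[0,1]$) whenever $b_j\neq b_k$, and that there are three admissible numbers $z_1,z_2,z_3$ such that (a) the origin is an interior point of the triangle with vertices $z_1,z_2,z_3$; (b) $|\omega_0(z_m)|+|\omega_1(z_m)|\neq0$ for $m\in\{1,2,3\}$. Then the system of root functions of $L_{C,D}(Q)$ is complete and minimal in $L^2([0,1];\mathbb C^n)$. Here a system of root functions is a union of bases of the root subspaces $\bigcup_{k\ge1}\ker(L_{C,D}(Q)-\mu)^k$, $\mu\in\mathbb C$; it is complete if its closed linear span is the whole space, and minimal if none of its members lies in the closed linear span of the others. The assertion holds for every such system. -/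

import Mathlib

open MeasureTheory Set Filter Topology
open scoped Matrix

noncomputable section

namespace BVP

/-! ### Root vectors of unbounded operators; completeness and minimality -/

section Abstract

/-- The subspace `ker (A - μ) ^ k` of an unbounded operator `A` in `H`, where
`dom ((A - μ) ^ (k + 1)) = {x ∈ dom A | (A - μ) x ∈ dom ((A - μ) ^ k)}`. -/
def kerPow {H : Type*} [AddCommGroup H] [Module ℂ H] (A : H →ₗ.[ℂ] H) (μ : ℂ) :
    ℕ → Submodule ℂ H
  | 0 => ⊥
  | k + 1 => ((kerPow A μ k).comap (A.toFun - μ • A.domain.subtype)).map A.domain.subtype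

/-- The root subspace of `A` at `μ`: the (increasing) union over `k` of `ker (A - μ) ^ k`.
It is nonzero exactly when `μ` is an eigenvalue of `A`. -/
def rootSubspace {H : Type*} [AddCommGroup H] [Module ℂ H] (A : H →ₗ.[ℂ] H) (μ : ℂ) :
    Submodule ℂ H :=
  ⨆ k, kerPow A μ k

/-- `e` is a system of root vectors of `A`: its members are labelled by complex numbers `ev i`
in such a way that, for every `μ`, those labelled by `μ` form a basis of the root
subspace of `A` at `μ`. -/
structure IsRootSystem {H : Type*} [AddCommGroup H] [Module ℂ H] (A : H →ₗ.[ℂ] H)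
    {ι : Type*} (ev : ι → ℂ) (e : ι → H) : Prop where
  linearIndependent : ∀ μ : ℂ, LinearIndependent ℂ (fun i : {i // ev i = μ} => e i)
  span_eq : ∀ μ : ℂ, Submodule.span ℂ (e '' {i | ev i = μ}) = rootSubspace A μ

/-- The closed linear span of the system is the whole space. -/
def IsCompleteSystem {H : Type*} [NormedAddCommGroup H] [NormedSpace ℂ H]
    {ι : Type*} (e : ι → H) : Prop :=
  (Submodule.span ℂ (range e)).topologicalClosure = ⊤

/-- No member of the system lies in the closed linear span of the other members. -/
def IsMinimalSystem {H : Type*} [NormedAddCommGroup H] [NormedSpace ℂ H]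
    {ι : Type*} (e : ι → H) : Prop :=
  ∀ i, e i ∉ (Submodule.span ℂ (e '' {j | j ≠ i})).topologicalClosure

end Abstract

/-! ### The operator `L_{C,D}(Q)` -/

/-- The Hilbert space `L²([0,1]; ℂⁿ)`. -/
abbrev L2 (n : ℕ) : Type :=
  Lp (EuclideanSpace ℂ (Fin n)) 2 (volume.restrict (Icc (0 : ℝ) 1))

/-- The differential expression `(L y)(x) = -i B⁻¹ y'(x) + Q(x) y(x)`, `B = diag(b)`. -/
def diffExpr {n : ℕ} (b : Fin n → ℂ) (Q : ℝ → Matrix (Fin n) (Fin n) ℂ)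
    (y : ℝ → EuclideanSpace ℂ (Fin n)) (x : ℝ) : EuclideanSpace ℂ (Fin n) :=
  WithLp.toLp 2 fun j => -Complex.I * (b j)⁻¹ * (deriv y x) j + (Q x *ᵥ ⇑(y x)) j

/-- An absolutely continuous function on `[0,1]` is differentiable almost everywhere. -/
theorem ae_differentiableAt {n : ℕ} {y : ℝ → EuclideanSpace ℂ (Fin n)}
    (hy : AbsolutelyContinuousOnInterval y 0 1) :
    ∀ᵐ x ∂(volume.restrict (Icc (0 : ℝ) 1)), DifferentiableAt ℝ y x := by
  have h := hy.boundedVariationOn.locallyBoundedVariationOn.ae_differentiableWithinAt_of_mem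
  rw [uIcc_of_le zero_le_one] at h
  have h0 : ∀ᵐ x : ℝ ∂volume, x ≠ 0 := by simp [ae_iff]
  have h1 : ∀ᵐ x : ℝ ∂volume, x ≠ 1 := by simp [ae_iff]
  rw [ae_restrict_iff' measurableSet_Icc]
  filter_upwards [h, h0, h1] with x hx hx0 hx1 hmem
  exact (hx hmem).differentiableAt
    (Icc_mem_nhds (lt_of_le_of_ne hmem.1 (Ne.symm hx0)) (lt_of_le_of_ne hmem.2 hx1))

theorem diffExpr_add {n : ℕ} (b : Fin n → ℂ) (Q : ℝ → Matrix (Fin n) (Fin n) ℂ)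
    {y z : ℝ → EuclideanSpace ℂ (Fin n)} {x : ℝ}
    (hy : DifferentiableAt ℝ y x) (hz : DifferentiableAt ℝ z x) :
    diffExpr b Q (y + z) x = diffExpr b Q y x + diffExpr b Q z x := by
  ext j
  simp only [diffExpr, deriv_add hy hz, Pi.add_apply, PiLp.add_apply, WithLp.ofLp_add,
    Matrix.mulVec_add]
  ring

theorem diffExpr_smul {n : ℕ} (b : Fin n → ℂ) (Q : ℝ → Matrix (Fin n) (Fin n) ℂ)
    {y : ℝ → EuclideanSpace ℂ (Fin n)} {x : ℝ} (c : ℂ) (hy : DifferentiableAt ℝ y x) :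
    diffExpr b Q (c • y) x = c • diffExpr b Q y x := by
  ext j
  simp only [diffExpr, deriv_const_smul c hy, Pi.smul_apply, PiLp.smul_apply, WithLp.ofLp_smul,
    Matrix.mulVec_smul, smul_eq_mul]
  ring

/-- The graph of `L_{C,D}(Q)`: the pairs `(f, g)` in `L² × L²` such that `f` is represented by an
absolutely continuous `y` with `C y(0) + D y(1) = 0`, and `g = L y` almost everywhere on `[0,1]`
(so that `L y ∈ L²`). -/
def bvpGraph {n : ℕ} (b : Fin n → ℂ) (Q : ℝ → Matrix (Fin n) (Fin n) ℂ)
    (C D : Matrix (Fin n) (Fin n) ℂ) : Submodule ℂ (L2 n × L2 n) where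
  carrier := {p | ∃ y : ℝ → EuclideanSpace ℂ (Fin n),
    AbsolutelyContinuousOnInterval y 0 1 ∧
    C *ᵥ ⇑(y 0) + D *ᵥ ⇑(y 1) = 0 ∧
    p.1 =ᵐ[volume.restrict (Icc (0 : ℝ) 1)] y ∧
    p.2 =ᵐ[volume.restrict (Icc (0 : ℝ) 1)] diffExpr b Q y}
  zero_mem' := by
    refine ⟨0, ?_, ?_, Lp.coeFn_zero _ _ _, ?_⟩
    · exact (contDiff_const (c := (0 : EuclideanSpace ℂ (Fin n)))).contDiffOn
        |>.absolutelyContinuousOnInterval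
    · simp
    · refine (Lp.coeFn_zero _ _ _).trans (Eventually.of_forall fun x => ?_)
      ext j
      simp [diffExpr]
  add_mem' := by
    rintro ⟨f₁, g₁⟩ ⟨f₂, g₂⟩ ⟨y₁, hy₁, hb₁, hf₁, hg₁⟩ ⟨y₂, hy₂, hb₂, hf₂, hg₂⟩
    refine ⟨y₁ + y₂, hy₁.add hy₂, ?_, ?_, ?_⟩
    · simp only [Pi.add_apply, WithLp.ofLp_add, Matrix.mulVec_add]
      rw [add_add_add_comm, hb₁, hb₂, add_zero]
    · exact (Lp.coeFn_add _ _).trans (hf₁.add hf₂)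
    · refine (Lp.coeFn_add _ _).trans ?_
      filter_upwards [hg₁, hg₂, ae_differentiableAt hy₁, ae_differentiableAt hy₂] with x h1 h2 d1 d2
      rw [Pi.add_apply, h1, h2, diffExpr_add b Q d1 d2]
  smul_mem' := by
    rintro c ⟨f, g⟩ ⟨y, hy, hb, hf, hg⟩
    refine ⟨c • y, hy.const_smul c, ?_, ?_, ?_⟩
    · simp only [Pi.smul_apply, WithLp.ofLp_smul, Matrix.mulVec_smul]
      rw [← smul_add, hb, smul_zero]
    · exact (Lp.coeFn_smul _ _).trans (hf.const_smul c)
    · refine (Lp.coeFn_smul _ _).trans ?_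
      filter_upwards [hg, ae_differentiableAt hy] with x h1 d1
      rw [Pi.smul_apply, h1, diffExpr_smul b Q c d1]

/-- The relation `bvpGraph` is single-valued. -/
theorem bvpGraph_snd_eq_zero {n : ℕ} (b : Fin n → ℂ) (Q : ℝ → Matrix (Fin n) (Fin n) ℂ)
    (C D : Matrix (Fin n) (Fin n) ℂ) (p : L2 n × L2 n) (hp : p ∈ bvpGraph b Q C D)
    (h0 : p.1 = 0) : p.2 = 0 := by
  obtain ⟨f, g⟩ := p
  obtain ⟨y, hy, -, hf, hg⟩ := hp
  simp only at h0 hf hg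
  subst h0
  have hc : ContinuousOn y (Icc (0 : ℝ) 1) := by
    have h := hy.continuousOn
    rwa [uIcc_of_le zero_le_one] at h
  have hy0 : y =ᵐ[volume.restrict (Icc (0 : ℝ) 1)] 0 := hf.symm.trans (Lp.coeFn_zero _ _ _)
  have hyz : EqOn y 0 (Icc (0 : ℝ) 1) :=
    Measure.eqOn_Icc_of_ae_eq volume zero_ne_one hy0 hc continuousOn_const
  have hz : ∀ᵐ x : ℝ ∂volume, x ≠ 0 := by simp [ae_iff]
  have ho : ∀ᵐ x : ℝ ∂volume, x ≠ 1 := by simp [ae_iff]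
  apply Lp.ext
  refine hg.trans (EventuallyEq.trans ?_ (Lp.coeFn_zero _ _ _).symm)
  rw [EventuallyEq, ae_restrict_iff' measurableSet_Icc]
  filter_upwards [hz, ho] with x hx0 hx1 hmem
  have hev : y =ᶠ[𝓝 x] 0 := by
    filter_upwards [Icc_mem_nhds (lt_of_le_of_ne hmem.1 (Ne.symm hx0))
      (lt_of_le_of_ne hmem.2 hx1)] with t ht using hyz ht
  have hd : deriv y x = 0 := by
    rw [hev.deriv_eq]
    simp
  ext j
  simp [diffExpr, hd, hyz hmem]

/-- The operator `L_{C,D}(Q)` in `L²([0,1]; ℂⁿ)`. -/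
def bvpOperator {n : ℕ} (b : Fin n → ℂ) (Q : ℝ → Matrix (Fin n) (Fin n) ℂ)
    (C D : Matrix (Fin n) (Fin n) ℂ) : L2 n →ₗ.[ℂ] L2 n :=
  (bvpGraph b Q C D).toLinearPMap

theorem bvpOperator_graph {n : ℕ} (b : Fin n → ℂ) (Q : ℝ → Matrix (Fin n) (Fin n) ℂ)
    (C D : Matrix (Fin n) (Fin n) ℂ) : (bvpOperator b Q C D).graph = bvpGraph b Q C D :=
  Submodule.toLinearPMap_graph_eq _ (bvpGraph_snd_eq_zero b Q C D)

/-! ### The quantities `ω₀` and `ω₁` -/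

/-- `z` is admissible: `Re (i b_j z) ≠ 0` for all `j`. -/
def Admissible {n : ℕ} (b : Fin n → ℂ) (z : ℂ) : Prop :=
  ∀ j, (Complex.I * b j * z).re ≠ 0

/-- The matrix `T_A(C, D)`, `A = diag(a)`: its `k`th column is that of `C` if `Re a_k < 0`, and
that of `D` if `Re a_k > 0` (the case `Re a_k = 0` does not occur). -/
def TMatrix {n : ℕ} (a : Fin n → ℂ) (C D : Matrix (Fin n) (Fin n) ℂ) :
    Matrix (Fin n) (Fin n) ℂ :=
  Matrix.of fun i k => if (a k).re < 0 then C i k else D i k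

/-- The matrix `T_{izB}(C, D)`. -/
def TizB {n : ℕ} (b : Fin n → ℂ) (C D : Matrix (Fin n) (Fin n) ℂ) (z : ℂ) :
    Matrix (Fin n) (Fin n) ℂ :=
  TMatrix (fun k => Complex.I * b k * z) C D

/-- `ω₀(z) = det T_{izB}(C, D)`. -/
def omega0 {n : ℕ} (b : Fin n → ℂ) (C D : Matrix (Fin n) (Fin n) ℂ) (z : ℂ) : ℂ :=
  (TizB b C D z).det

/-- `ω₁(z)`: the sum over all `j, k` with `Re (i b_j z) < 0 < Re (i b_k z)` of
`(det T^{c_j → c_k} b_k q_{kj}(0) - det T^{d_k → d_j} b_j q_{jk}(1)) / (b_k - b_j)`, where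
`T^{c_j → c_k}` is `T_{izB}(C, D)` with its `j`th column replaced by the `k`th column of `C`, and
`T^{d_k → d_j}` is `T_{izB}(C, D)` with its `k`th column replaced by the `j`th column of `D`. -/
def omega1 {n : ℕ} (b : Fin n → ℂ) (Q : ℝ → Matrix (Fin n) (Fin n) ℂ)
    (C D : Matrix (Fin n) (Fin n) ℂ) (z : ℂ) : ℂ :=
  ∑ j, ∑ k,
    if (Complex.I * b j * z).re < 0 ∧ 0 < (Complex.I * b k * z).re then
      (((TizB b C D z).updateCol j (fun i => C i k)).det * b k * Q 0 k j
        - ((TizB b C D z).updateCol k (fun i => D i j)).det * b j * Q 1 j k) / (b k - b j)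
    else 0

end BVP

end

/-! Write R(λ) for the resolvent of the operator and Δ for its characteristic determinant. Rewriting
the problem as a Volterra integral equation makes Δ and Δ·R entire, and the weak matrix elements ⟨f,
Δ(λ)R(λ)g⟩ are of exponential type, because the solution operator of the equation is
(`IntegralModel`, `isExpType_sol_bvpModel`).

Completeness. Let f be orthogonal to all root vectors. Then the numerator of ⟨f, R(λ)g⟩ vanishes at
each zero of Δ at least to the order of Δ (`le_analyticOrderAt_pairing`), so ⟨f, R(λ)g⟩ extends to
an entire function, of exponential type as a quotient of such functions (`IsExpType.of_mul_eq`). If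
R grows at most linearly along the three rays through the z_m, Phragmén–Lindelöf in the cones
between them and Liouville's theorem show that the function is affine
(`affine_of_linear_growth_on_rays`). The resolvent identity then makes f orthogonal to the range of
R(μ)³, which is dense because the domain of the operator is dense (`dense_domain`). Hence f = 0.

Minimality only needs Δ ≢ 0. The entire functionals `coeff` are built so that their Taylor
coefficients at μ, up to the order of the zero of Δ, annihilate the root subspaces at all other
points and are injective on the one at μ. They separate a root vector at μ from the closed span of
the others.

The bound on rays. For λ = rz the equation Ly = λy + g reads y' = r diag(a) y + V y + f with a_j = i
b_j z and V = -iBQ. Each component decays away from one end of [0,1]. Let v collect the values at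
those ends. The values at the opposite ends equal -(coupling · v)/r up to o(1/r)·|v| + O(‖g‖); this
is a Laplace asymptotic that needs continuity of the entries of Q at the ends only where the signs
of Re a_j differ (`eventually_norm_farVal_le`). The boundary condition becomes (T + S/r + o(1/r)) v
= O(‖g‖), where det (T + S/r) = ω₀ + ω₁/(zr) + O(1/r²) (`omega1_eq`). If ω₀ or ω₁ is nonzero, the
determinant is at least of order 1/r, so |v| = O(r‖g‖), and a Gronwall argument with exponential
weights controls all of y (`rayBound_bvpModel`). -/

noncomputable section
namespace BVP

/-! ### Entire functions of exponential type -/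

section ExponentialType

/-- `f` is of exponential type: `‖f z‖ ≤ exp (K (‖z‖ + 1))` for some `K ≥ 0`. -/
def IsExpType {F : Type*} [Norm F] (f : ℂ → F) : Prop :=
  ∃ K : ℝ, 0 ≤ K ∧ ∀ z, ‖f z‖ ≤ Real.exp (K * (‖z‖ + 1))

theorem isExpType_of_le {F : Type*} [Norm F] {f : ℂ → F} {C K : ℝ}
    (h : ∀ z, ‖f z‖ ≤ C * Real.exp (K * (‖z‖ + 1))) : IsExpType f := by
  refine ⟨|C| + |K|, by positivity, fun z => (h z).trans ?_⟩
  have h1 : C ≤ Real.exp |C| := (le_abs_self C).trans (by linarith [Real.add_one_le_exp |C|])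
  calc C * Real.exp (K * (‖z‖ + 1)) ≤ Real.exp |C| * Real.exp (K * (‖z‖ + 1)) := by gcongr
    _ = Real.exp (|C| + K * (‖z‖ + 1)) := by rw [Real.exp_add]
    _ ≤ _ := by
      apply Real.exp_le_exp.2
      have := le_abs_self K
      have h2 := norm_nonneg z
      have h3 := abs_nonneg C
      nlinarith

theorem IsExpType.mul {f g : ℂ → ℂ} (hf : IsExpType f) (hg : IsExpType g) :
    IsExpType (fun z => f z * g z) := by
  obtain ⟨K, hK, h⟩ := hf
  obtain ⟨K', hK', h'⟩ := hg
  refine ⟨K + K', by positivity, fun z => ?_⟩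
  rw [norm_mul, add_mul, Real.exp_add]
  exact mul_le_mul (h z) (h' z) (norm_nonneg _) (Real.exp_pos _).le

theorem IsExpType.const {F : Type*} [NormedAddCommGroup F] (c : F) :
    IsExpType (fun _ : ℂ => c) :=
  isExpType_of_le (C := ‖c‖) (K := 0) fun z => by simp

theorem IsExpType.add {F : Type*} [NormedAddCommGroup F] {f g : ℂ → F} (hf : IsExpType f)
    (hg : IsExpType g) : IsExpType (fun z => f z + g z) := by
  obtain ⟨K, hK, h⟩ := hf
  obtain ⟨K', hK', h'⟩ := hg
  refine isExpType_of_le (C := 2) (K := K + K') fun z => (norm_add_le _ _).trans ?_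
  have hz : 0 ≤ ‖z‖ + 1 := by positivity
  have h1 : Real.exp (K * (‖z‖ + 1)) ≤ Real.exp ((K + K') * (‖z‖ + 1)) :=
    Real.exp_le_exp.2 (by nlinarith)
  have h2 : Real.exp (K' * (‖z‖ + 1)) ≤ Real.exp ((K + K') * (‖z‖ + 1)) :=
    Real.exp_le_exp.2 (by nlinarith)
  linarith [h z, h' z]

theorem IsExpType.sum {F : Type*} [NormedAddCommGroup F] {α : Type*} {s : Finset α}
    {f : α → ℂ → F} (hf : ∀ i ∈ s, IsExpType (f i)) : IsExpType (fun z => ∑ i ∈ s, f i z) := by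
  classical
  induction s using Finset.induction_on with
  | empty => simpa using IsExpType.const (0 : F)
  | insert a s ha ih =>
    simp only [Finset.sum_insert ha]
    exact (hf a (by simp)).add (ih fun i hi => hf i (by simp [hi]))

theorem IsExpType.prod {α : Type*} {s : Finset α}
    {f : α → ℂ → ℂ} (hf : ∀ i ∈ s, IsExpType (f i)) : IsExpType (fun z => ∏ i ∈ s, f i z) := by
  classical
  induction s using Finset.induction_on with
  | empty => simpa using IsExpType.const (1 : ℂ)
  | insert a s ha ih =>
    simp only [Finset.prod_insert ha]
    exact (hf a (by simp)).mul (ih fun i hi => hf i (by simp [hi]))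

theorem IsExpType.of_norm_le {F G : Type*} [NormedAddCommGroup F] [NormedAddCommGroup G]
    {f : ℂ → F} {g : ℂ → G} (hf : IsExpType f) {C : ℝ} (h : ∀ z, ‖g z‖ ≤ C * ‖f z‖) :
    IsExpType g := by
  obtain ⟨K, hK, hK'⟩ := hf
  refine isExpType_of_le (C := |C|) (K := K) fun z => (h z).trans ?_
  exact mul_le_mul (le_abs_self C) (hK' z) (norm_nonneg _) (abs_nonneg _)

theorem circleAverage_posLog_le {f : ℂ → ℂ} (hf : Differentiable ℂ f) {K : ℝ} (hK : 0 ≤ K)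
    (h : ∀ z, ‖f z‖ ≤ Real.exp (K * (‖z‖ + 1))) {r : ℝ} (hr : 0 ≤ r) :
    ValueDistribution.proximity f ⊤ r ≤ K * (r + 1) := by
  rw [ValueDistribution.proximity_top]
  apply Real.circleAverage_mono_on_of_le_circle
  · exact MeromorphicOn.circleIntegrable_posLog_norm
      fun x _ => (hf.analyticAt x).meromorphicAt
  · intro x hx
    have hx' : ‖x‖ = r := by simpa [abs_of_nonneg hr] using hx
    rw [← hx', Real.posLog_def]
    refine max_le (by positivity) ?_
    rcases eq_or_ne (f x) 0 with h0 | h0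
    · simp [h0]; positivity
    · exact (Real.log_le_iff_le_exp (norm_pos_iff.2 h0)).2 (h x)

/-- Nevanlinna's first main theorem: the proximity function of G/D is at most that of G plus that of
1/D, and the characteristics of D and 1/D differ by the logarithm of the leading coefficient of D at
0. As D has no poles, its characteristic is its proximity function, which is linear in r. The
restriction r ≥ 1 makes the counting function of 1/D nonnegative, so that it can be dropped. -/
theorem proximity_le_of_mul_eq {F G D : ℂ → ℂ}
    (hG : Differentiable ℂ G) (hD : Differentiable ℂ D) (hD0 : ∃ w, D w ≠ 0)
    (h : ∀ z, G z = F z * D z) (hGt : IsExpType G) (hDt : IsExpType D) :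
    ∃ K, 0 ≤ K ∧ ∀ r, 1 ≤ r → ValueDistribution.proximity F ⊤ r ≤ K * (r + 1) := by
  obtain ⟨K, hK, hGK⟩ := hGt
  obtain ⟨K', hK', hDK⟩ := hDt
  have mer : ∀ {f : ℂ → ℂ}, Differentiable ℂ f → Meromorphic f :=
    fun hf x => (hf.analyticAt x).meromorphicAt
  refine ⟨K + K' + |Real.log ‖meromorphicTrailingCoeffAt D 0‖|, by positivity, fun r hr => ?_⟩
  have hr0 : r ≠ 0 := by positivity
  have hcod : F =ᶠ[codiscrete ℂ] G * D⁻¹ := by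
    have hne : ∀ᶠ z in codiscrete ℂ, D z ≠ 0 := by
      have hDa : AnalyticOnNhd ℂ D univ := fun x _ => hD.analyticAt x
      obtain ⟨w, hw⟩ := hD0
      rcases hDa.eqOn_zero_or_eventually_ne_zero_of_preconnected isPreconnected_univ with h0 | h0
      · exact absurd (h0 (mem_univ w)) hw
      · exact h0
    filter_upwards [hne] with z hz
    simp [h z, hz]
  rw [ValueDistribution.proximity_congr_codiscrete hcod hr0]
  have h1 := ValueDistribution.proximity_mul_top_le (mer hG) (mer hD).inv r
  have h2 := ValueDistribution.characteristic_sub_characteristic_inv_of_ne_zero (mer hD) hr0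
  have h3 : ValueDistribution.logCounting D ⊤ = 0 := by
    rw [ValueDistribution.logCounting_top]
    have : (MeromorphicOn.divisor D univ)⁻ = 0 := by
      have : 0 ≤ MeromorphicOn.divisor D univ :=
        MeromorphicOn.AnalyticOnNhd.divisor_nonneg fun x _ => hD.analyticAt x
      exact negPart_eq_zero.2 this
    rw [this]; simp
  have h4 := ValueDistribution.logCounting_nonneg (f := D⁻¹) (e := ⊤) hr
  simp only [ValueDistribution.characteristic, Pi.add_apply, h3, Pi.zero_apply] at h2 h1
  have h5 := circleAverage_posLog_le hG hK hGK (zero_le_one.trans hr)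
  have h6 := circleAverage_posLog_le hD hK' hDK (zero_le_one.trans hr)
  have h7 := neg_abs_le (Real.log ‖meromorphicTrailingCoeffAt D 0‖)
  have h8 := abs_nonneg (Real.log ‖meromorphicTrailingCoeffAt D 0‖)
  nlinarith

/-- Polar coordinates around c. Disks with different centres, unlike circles, can be compared by
inclusion; this is how a bound on circle averages around 0 becomes a pointwise bound. -/
theorem setIntegral_ball_eq {u : ℂ → ℝ} (hu : Continuous u) (c : ℂ) (ρ : ℝ) :
    ∫ z in Metric.ball c ρ, u z =
      ∫ s in Ioo 0 ρ, s * (2 * Real.pi * Real.circleAverage u c s) := by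
  have hcont : Continuous fun p : ℝ × ℝ => p.1 * u (circleMap c p.1 p.2) := by
    unfold circleMap; fun_prop
  calc ∫ z in Metric.ball c ρ, u z
      = ∫ w, (Metric.ball c ρ).indicator u (c + w) := by
        rw [integral_add_left_eq_self (fun w => (Metric.ball c ρ).indicator u w) c,
          integral_indicator Metric.isOpen_ball.measurableSet]
    _ = ∫ p in polarCoord.target,
          p.1 • (Metric.ball c ρ).indicator u (c + Complex.polarCoord.symm p) :=
        (Complex.integral_comp_polarCoord_symm _).symm
    _ = ∫ p in polarCoord.target, (Ioo 0 ρ ×ˢ univ).indicator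
          (fun p : ℝ × ℝ => p.1 * u (circleMap c p.1 p.2)) p := by
        apply setIntegral_congr_fun polarCoord.open_target.measurableSet
        intro p hp
        simp only [polarCoord_target, mem_prod, mem_Ioi] at hp
        have hmap : c + Complex.polarCoord.symm p = circleMap c p.1 p.2 := by
          rw [Complex.polarCoord_symm_apply, circleMap, Complex.exp_mul_I]
          push_cast; ring
        have hmem : c + Complex.polarCoord.symm p ∈ Metric.ball c ρ ↔ p ∈ Ioo 0 ρ ×ˢ univ := by
          rw [hmap]; simp [hp.1, circleMap, abs_of_pos hp.1, dist_eq_norm]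
        beta_reduce
        by_cases h : p ∈ (Ioo 0 ρ ×ˢ univ : Set (ℝ × ℝ))
        · rw [indicator_of_mem h, indicator_of_mem (hmem.2 h), smul_eq_mul, hmap]
        · rw [indicator_of_notMem h, indicator_of_notMem (fun h' => h (hmem.1 h')), smul_zero]
    _ = ∫ p in Ioo 0 ρ ×ˢ Ioo (-Real.pi) Real.pi, p.1 * u (circleMap c p.1 p.2) := by
        rw [setIntegral_indicator (measurableSet_Ioo.prod MeasurableSet.univ)]
        congr 2
        ext p
        simp only [polarCoord_target, mem_inter_iff, mem_prod, mem_Ioi, mem_Ioo, mem_univ]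
        tauto
    _ = ∫ s in Ioo 0 ρ, ∫ θ in Ioo (-Real.pi) Real.pi, s * u (circleMap c s θ) := by
        rw [Measure.volume_eq_prod, setIntegral_prod]
        exact (hcont.continuousOn.integrableOn_compact
          (isCompact_Icc.prod isCompact_Icc)).mono_set
          (prod_mono Ioo_subset_Icc_self Ioo_subset_Icc_self)
    _ = _ := by
        congr 1
        ext s
        rw [integral_const_mul, Real.circleAverage_eq_integral_add (-Real.pi),
          intervalIntegral.integral_comp_add_right (fun θ => u (circleMap c s θ)),
          intervalIntegral.integral_of_le (by linarith [Real.pi_pos]),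
          integral_Ioc_eq_integral_Ioo, smul_eq_mul]
        have : 2 * Real.pi + -Real.pi = Real.pi := by ring
        rw [this, zero_add]
        field_simp

/-- Jensen's formula: every zero in the disk contributes a nonnegative term, so dropping the zeros
and passing from log to log⁺ only increases the average. -/
theorem log_norm_le_circleAverage {F : ℂ → ℂ} (hF : Differentiable ℂ F) (z : ℂ) (h0 : F z ≠ 0)
    {s : ℝ} (hs : 0 < s) :
    Real.log ‖F z‖ ≤ Real.circleAverage (fun w => Real.posLog ‖F w‖) z s := by
  have hFa : AnalyticOnNhd ℂ F (Metric.closedBall z |s|) := fun x _ => hF.analyticAt x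
  have h1 := hFa.circleAverage_log_norm hs.ne' h0
  have h2 : 0 ≤ ∑ᶠ u, (MeromorphicOn.divisor F (Metric.closedBall z |s|) u : ℝ)
      * Real.log (s * ‖z - u‖⁻¹) := by
    apply finsum_nonneg
    intro u
    by_cases hu : u ∈ Metric.closedBall z |s|
    · apply mul_nonneg
      · exact_mod_cast MeromorphicOn.AnalyticOnNhd.divisor_nonneg hFa u
      · rcases eq_or_ne z u with rfl | hzu
        · simp
        · apply Real.log_nonneg
          rw [← div_eq_mul_inv, le_div_iff₀ (norm_pos_iff.2 (sub_ne_zero.2 hzu)), one_mul,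
            ← dist_eq_norm, dist_comm]
          simpa [abs_of_pos hs] using hu
    · simp [Function.locallyFinsuppWithin.apply_eq_zero_of_notMem _ hu]
  have h3 : Real.circleAverage (fun w => Real.log ‖F w‖) z s
      ≤ Real.circleAverage (fun w => Real.posLog ‖F w‖) z s := by
    apply Real.circleAverage_mono
    · exact MeromorphicOn.circleIntegrable_log_norm fun x _ => (hF.analyticAt x).meromorphicAt
    · exact MeromorphicOn.circleIntegrable_posLog_norm fun x _ => (hF.analyticAt x).meromorphicAt
    · intro x _
      exact le_max_right _ _
  linarith

/-- An entire quotient of entire functions of exponential type is of exponential type. -/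
theorem IsExpType.of_mul_eq {F G D : ℂ → ℂ} (hF : Differentiable ℂ F)
    (hG : Differentiable ℂ G) (hD : Differentiable ℂ D) (hD0 : ∃ w, D w ≠ 0)
    (h : ∀ z, G z = F z * D z) (hGt : IsExpType G) (hDt : IsExpType D) : IsExpType F := by
  obtain ⟨K, hK, hprox⟩ := proximity_le_of_mul_eq hG hD hD0 h hGt hDt
  have hu : Continuous fun w => Real.posLog ‖F w‖ :=
    Real.continuous_posLog.comp hF.continuous.norm
  have hmono : ∀ s, 0 < s → ∀ z, F z ≠ 0 →
      Real.log ‖F z‖ ≤ Real.circleAverage (fun w => Real.posLog ‖F w‖) z s :=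
    fun s hs z hz => log_norm_le_circleAverage hF z hz hs
  have hpos : ∀ z, 0 ≤ Real.posLog ‖F z‖ := fun z => Real.posLog_nonneg
  -- M covers the circles of radius below 1, where the bound from value distribution is not
  -- available.
  obtain ⟨M, hM⟩ := (isCompact_closedBall (0 : ℂ) 1).exists_bound_of_continuousOn hu.continuousOn
  have hM0 : 0 ≤ M := (norm_nonneg _).trans (hM 0 (by simp))
  have hbound : ∀ s, 0 < s →
      Real.circleAverage (fun w => Real.posLog ‖F w‖) 0 s ≤ (K + M) * (s + 1) := by
    intro s hs
    rcases le_or_gt 1 s with h1 | h1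
    · have := hprox s h1
      rw [ValueDistribution.proximity_top] at this
      nlinarith
    · refine (Real.circleAverage_mono_on_of_le_circle (a := M)
        (hu.continuousOn.circleIntegrable hs.le) fun x hx => ?_).trans (by nlinarith)
      refine (le_abs_self _).trans (hM x ?_)
      have : ‖x‖ = s := by simpa [abs_of_pos hs] using hx
      simp [this, h1.le]
  -- With ρ = ‖z‖ + 1, the disk of radius ρ about z lies in the disk of radius 2ρ about 0. The
  -- integral of log⁺‖F‖ over the latter is at most 8πρ²(K + M)(2ρ + 1), which is at most 24π(K +
  -- M)ρ³ because ρ ≥ 1. Dividing by πρ² gives the constant.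
  refine ⟨24 * (K + M), by positivity, fun z => ?_⟩
  rcases eq_or_ne (F z) 0 with h0 | h0
  · rw [h0, norm_zero]; positivity
  rw [← Real.log_le_iff_le_exp (norm_pos_iff.2 h0)]
  set ρ := ‖z‖ + 1 with hρ
  have hρ1 : 1 ≤ ρ := by linarith [norm_nonneg z]
  have hcont : ∀ c : ℂ, Continuous fun s : ℝ =>
      s * (2 * Real.pi * Real.circleAverage (fun w => Real.posLog ‖F w‖) c s) := fun c => by
    fun_prop
  have hint : ∀ c : ℂ, ∀ a : ℝ, IntegrableOn (fun s : ℝ =>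
      s * (2 * Real.pi * Real.circleAverage (fun w => Real.posLog ‖F w‖) c s)) (Ioo 0 a) :=
    fun c a => ((hcont c).continuousOn.integrableOn_compact isCompact_Icc).mono_set
      Ioo_subset_Icc_self
  have h1 : Real.pi * Real.log ‖F z‖ * ρ ^ 2 ≤ ∫ w in Metric.ball z ρ, Real.posLog ‖F w‖ := by
    rw [setIntegral_ball_eq hu]
    have : ∫ s in Ioo 0 ρ, s * (2 * Real.pi * Real.log ‖F z‖)
        = Real.pi * Real.log ‖F z‖ * ρ ^ 2 := by
      rw [← integral_Ioc_eq_integral_Ioo, ← intervalIntegral.integral_of_le (by positivity),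
        intervalIntegral.integral_mul_const, integral_id]
      ring
    rw [← this]
    refine setIntegral_mono_on ?_ (hint z ρ) measurableSet_Ioo fun s hs => ?_
    · exact ((continuous_id.mul continuous_const).continuousOn.integrableOn_compact
        isCompact_Icc).mono_set Ioo_subset_Icc_self
    · have := hmono s hs.1 z h0
      have h2 := hs.1
      gcongr
  have h2 : ∫ w in Metric.ball z ρ, Real.posLog ‖F w‖
      ≤ ∫ w in Metric.ball 0 (2 * ρ), Real.posLog ‖F w‖ := by
    apply setIntegral_mono_set
    · exact (hu.continuousOn.integrableOn_compact (isCompact_closedBall 0 (2 * ρ))).mono_set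
        Metric.ball_subset_closedBall
    · exact Eventually.of_forall hpos
    · apply LE.le.eventuallyLE
      apply Metric.ball_subset_ball'
      rw [dist_zero_right]; linarith
  have h3 : ∫ w in Metric.ball 0 (2 * ρ), Real.posLog ‖F w‖
      ≤ (2 * ρ) * (2 * Real.pi * ((K + M) * (2 * ρ + 1))) * (2 * ρ) := by
    rw [setIntegral_ball_eq hu]
    have hc : ∫ s in Ioo 0 (2 * ρ), (2 * ρ) * (2 * Real.pi * ((K + M) * (2 * ρ + 1)))
        = (2 * ρ) * (2 * Real.pi * ((K + M) * (2 * ρ + 1))) * (2 * ρ) := by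
      rw [setIntegral_const]
      simp [Measure.real, (by positivity : (0:ℝ) ≤ ρ)]
      ring
    rw [← hc]
    refine setIntegral_mono_on (hint 0 _) (integrableOn_const measure_Ioo_lt_top.ne) measurableSet_Ioo fun s hs => ?_
    have h4 := hbound s hs.1
    have h5 := hs.1
    have h6 := hs.2.le
    have h7 : (K + M) * (s + 1) ≤ (K + M) * (2 * ρ + 1) := by gcongr
    calc s * (2 * Real.pi * Real.circleAverage (fun w => Real.posLog ‖F w‖) 0 s)
        ≤ s * (2 * Real.pi * ((K + M) * (2 * ρ + 1))) := by
          gcongr; exact h4.trans h7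
      _ ≤ _ := by gcongr
  have h4 : Real.pi * Real.log ‖F z‖ * ρ ^ 2 ≤ Real.pi * (24 * (K + M) * ρ) * ρ ^ 2 := by
    refine (h1.trans (h2.trans h3)).trans ?_
    have : 0 ≤ Real.pi * (K + M) * ρ ^ 2 * (ρ - 1) := by
      have : 0 ≤ ρ - 1 := by linarith
      positivity
    nlinarith
  have h5 := le_of_mul_le_mul_right h4 (by positivity)
  exact le_of_mul_le_mul_left h5 Real.pi_pos

end ExponentialType

/-! ### Three rays -/

section Rays

/-- The map w ↦ z₁ exp w carries the strip 0 ≤ Im w ≤ θ onto the cone without its vertex.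
Exponential type becomes growth exp(K' e^{|Re w|}), which Phragmén–Lindelöf in a strip of width θ
permits exactly because θ < π. -/
theorem norm_le_on_cone_of_im_pos {F : ℂ → ℂ} (hF : Differentiable ℂ F) (hFt : IsExpType F)
    {z₁ z₂ : ℂ} (h1 : z₁ ≠ 0) (him : 0 < (z₂ / z₁).im) {C : ℝ}
    (hC1 : ∀ t : ℝ, 0 ≤ t → ‖F (t * z₁)‖ ≤ C) (hC2 : ∀ t : ℝ, 0 ≤ t → ‖F (t * z₂)‖ ≤ C)
    {s t : ℝ} (hs : 0 ≤ s) (ht : 0 ≤ t) : ‖F (s * z₁ + t * z₂)‖ ≤ C := by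
  set q := z₂ / z₁ with hq
  have hz2 : z₂ = q * z₁ := by rw [hq]; field_simp
  have hq0 : q ≠ 0 := fun h => by simp [h] at him
  set θ := Complex.arg q with hθ
  have hθ0 : 0 < θ := by
    refine lt_of_le_of_ne (Complex.arg_nonneg_iff.2 him.le) fun h => ?_
    have := (Complex.arg_eq_zero_iff.1 h.symm).2
    exact him.ne' this
  have hθπ : θ < Real.pi :=
    lt_of_le_of_ne (Complex.arg_le_pi q) fun h => him.ne' (Complex.arg_eq_pi_iff.1 h).2
  by_cases hu : (s : ℂ) + t * q = 0
  · have : (s : ℂ) * z₁ + t * z₂ = (0 : ℝ) * z₁ := by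
      rw [hz2]; push_cast; linear_combination z₁ * hu
    rw [this]
    exact hC1 0 le_rfl
  have hsu : (s : ℂ) * z₁ + t * z₂ = z₁ * Complex.exp (Complex.log (s + t * q)) := by
    rw [Complex.exp_log hu, hz2]; ring
  rw [hsu]
  obtain ⟨K, hK, hFK⟩ := hFt
  refine PhragmenLindelof.horizontal_strip (f := fun w => F (z₁ * Complex.exp w)) (a := 0)
    (b := θ) (C := C) ?_ ⟨1, ?_, K * (‖z₁‖ + 1), ?_⟩ ?_ ?_ ?_ ?_
  · exact (hF.comp (Complex.differentiable_exp.const_mul z₁)).diffContOnCl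
  · rw [sub_zero, lt_div_iff₀ hθ0, one_mul]; exact hθπ
  · refine Asymptotics.IsBigO.of_bound 1 (Eventually.of_forall fun w => ?_)
    rw [one_mul, Real.norm_of_nonneg (Real.exp_pos _).le]
    refine (hFK _).trans (Real.exp_le_exp.2 ?_)
    rw [mul_assoc]
    apply mul_le_mul_of_nonneg_left _ hK
    rw [norm_mul, Complex.norm_exp, one_mul, add_mul, one_mul]
    have h2 : Real.exp w.re ≤ Real.exp |w.re| := Real.exp_le_exp.2 (le_abs_self _)
    have h3 : 1 ≤ Real.exp |w.re| := Real.one_le_exp (abs_nonneg _)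
    gcongr
  · intro w hw
    have : z₁ * Complex.exp w = (Real.exp w.re : ℝ) * z₁ := by
      conv_lhs => rw [← Complex.re_add_im w, hw]
      push_cast; simp [mul_comm]
    simp only [this]
    exact hC1 _ (Real.exp_pos _).le
  · intro w hw
    have : z₁ * Complex.exp w = (Real.exp w.re / ‖q‖ : ℝ) * z₂ := by
      conv_lhs => rw [← Complex.re_add_im w, hw, Complex.exp_add]
      rw [hz2]
      have : (‖q‖ : ℂ) ≠ 0 := by exact_mod_cast norm_ne_zero_iff.2 hq0
      have h4 : Complex.exp (θ * Complex.I) = q / ‖q‖ := by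
        rw [eq_div_iff this, mul_comm]; exact Complex.norm_mul_exp_arg_mul_I q
      rw [h4]
      push_cast
      ring
    simp only [this]
    exact hC2 _ (by positivity)
  · rw [Complex.log_im]
    refine Complex.arg_nonneg_iff.2 ?_
    simp only [Complex.add_im, Complex.ofReal_im, Complex.mul_im, Complex.ofReal_re]
    nlinarith
  · rw [Complex.log_im]
    set u : ℂ := s + t * q with hu'
    by_contra! hlt
    have hsin : 0 < Real.sin (Complex.arg u - θ) :=
      Real.sin_pos_of_pos_of_lt_pi (by linarith) (by linarith [Complex.arg_le_pi u])
    -- The imaginary part of u·conj q has the sign of sin(arg u - θ), and it equals -s·Im q ≤ 0. So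
    -- arg u cannot exceed θ.
    have key : (u * (starRingEnd ℂ) q).im = ‖u‖ * ‖q‖ * Real.sin (Complex.arg u - θ) := by
      rw [Real.sin_sub, Complex.mul_im, Complex.conj_re, Complex.conj_im,
        ← Complex.norm_mul_cos_arg u, ← Complex.norm_mul_sin_arg u,
        ← Complex.norm_mul_cos_arg q, ← Complex.norm_mul_sin_arg q]
      ring
    have key2 : (u * (starRingEnd ℂ) q).im = -(s * q.im) := by
      simp [hu', Complex.mul_im]; ring
    have h3 : 0 < ‖u‖ * ‖q‖ * Real.sin (Complex.arg u - θ) := by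
      have := norm_pos_iff.2 hu
      have := norm_pos_iff.2 hq0
      positivity
    nlinarith

/-- Phragmén–Lindelöf in the convex cone spanned by two rays. -/
theorem norm_le_on_cone {F : ℂ → ℂ} (hF : Differentiable ℂ F) (hFt : IsExpType F)
    {z₁ z₂ : ℂ} {C : ℝ}
    (hC1 : ∀ t : ℝ, 0 ≤ t → ‖F (t * z₁)‖ ≤ C) (hC2 : ∀ t : ℝ, 0 ≤ t → ‖F (t * z₂)‖ ≤ C)
    {s t : ℝ} (hs : 0 ≤ s) (ht : 0 ≤ t) : ‖F (s * z₁ + t * z₂)‖ ≤ C := by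
  rcases eq_or_ne z₁ 0 with rfl | h1
  · simpa using hC2 t ht
  rcases eq_or_ne z₂ 0 with rfl | h2
  · simpa using hC1 s hs
  rcases lt_trichotomy (z₂ / z₁).im 0 with him | him | him
  · rw [add_comm]
    refine norm_le_on_cone_of_im_pos hF hFt h2 ?_ hC2 hC1 ht hs
    rw [← inv_div, Complex.inv_im]
    have : z₂ / z₁ ≠ 0 := div_ne_zero h2 h1
    exact div_pos (by linarith) (Complex.normSq_pos.2 this)
  -- Collinear rays, z₂ = p z₁: the point lies on the first ray or, if s + tp < 0 (which forces p <
  -- 0), on the second.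
  · set p := (z₂ / z₁).re with hp
    have hz2 : z₂ = p * z₁ := by
      have : (p : ℂ) = z₂ / z₁ := Complex.ext (by simp [hp]) (by simp [him])
      rw [this]; field_simp
    rcases le_or_gt 0 (s + t * p) with h | h
    · have := hC1 _ h
      rw [hz2]; push_cast at this; convert this using 3; ring
    · have hp0 : p < 0 := by
        by_contra! hp0
        nlinarith [mul_nonneg ht hp0]
      have := hC2 ((s + t * p) / p) (div_nonneg_of_nonpos h.le hp0.le)
      have hpc : (p : ℂ) ≠ 0 := by exact_mod_cast hp0.ne
      convert this using 3
      rw [hz2]; push_cast; field_simp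
  · exact norm_le_on_cone_of_im_pos hF hFt h1 him hC1 hC2 hs ht

theorem exists_convex_combination {z : Fin 3 → ℂ} {w : ℂ} (hw : w ∈ convexHull ℝ (range z)) :
    ∃ c : Fin 3 → ℝ, (∀ i, 0 ≤ c i) ∧ w = ∑ i, c i * z i := by
  rw [convexHull_range_eq_exists_affineCombination] at hw
  obtain ⟨s, c, hc, hsum, rfl⟩ := hw
  refine ⟨fun i => if i ∈ s then c i else 0, fun i => ?_, ?_⟩
  · by_cases h : i ∈ s
    · simp [h, hc i h]
    · simp [h]
  · rw [Finset.affineCombination_eq_linear_combination _ _ _ hsum]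
    simp [apply_ite Complex.ofReal, ite_mul]

theorem exists_nonneg_combination {z : Fin 3 → ℂ}
    (hz0 : (0 : ℂ) ∈ interior (convexHull ℝ (range z))) (w : ℂ) :
    ∃ ε : ℝ, 0 < ε ∧ ∃ c : Fin 3 → ℝ, (∀ i, 0 ≤ c i) ∧ ε * w = ∑ i, c i * z i := by
  obtain ⟨r, hr, hball⟩ := Metric.mem_nhds_iff.1 (mem_interior_iff_mem_nhds.1 hz0)
  have hpos : 0 < r / (2 * (‖w‖ + 1)) := by positivity
  refine ⟨r / (2 * (‖w‖ + 1)), hpos, exists_convex_combination (hball ?_)⟩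
  rw [Metric.mem_ball, dist_zero_right, norm_mul, Complex.norm_real, Real.norm_of_nonneg hpos.le,
    div_mul_eq_mul_div, div_lt_iff₀ (by positivity)]
  nlinarith [norm_nonneg w]

/-- Representing each -z_m with nonnegative coefficients and adding up gives a relation ∑ p_i z_i =
0 with all p_i > 0. From a nonnegative representation of a multiple of w, subtract the multiple of
this relation given by the least ratio c_k / p_k: all coefficients stay nonnegative and the kth
disappears. -/
theorem exists_mem_cone {z : Fin 3 → ℂ}
    (hz0 : (0 : ℂ) ∈ interior (convexHull ℝ (range z))) (w : ℂ) :
    ∃ i j : Fin 3, ∃ s t : ℝ, 0 ≤ s ∧ 0 ≤ t ∧ w = s * z i + t * z j := by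
  have hrel : ∃ p : Fin 3 → ℝ, (∀ i, 0 < p i) ∧ ∑ i, (p i : ℂ) * z i = 0 := by
    choose ε hε c hc h using fun m => exists_nonneg_combination hz0 (-z m)
    refine ⟨fun i => ∑ m, (c m i + if i = m then ε m else 0), fun i => ?_, ?_⟩
    · apply Finset.sum_pos'
      · intro m _
        have := hc m i; have := (hε m).le
        split_ifs <;> linarith
      · exact ⟨i, Finset.mem_univ _, by simpa using add_pos_of_nonneg_of_pos (hc i i) (hε i)⟩
    · have : ∀ m, ∑ i, ((c m i + if i = m then ε m else 0 : ℝ) : ℂ) * z i = 0 := by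
        intro m
        simp only [Complex.ofReal_add, add_mul, Finset.sum_add_distrib]
        rw [← h m]
        simp [apply_ite Complex.ofReal, ite_mul]
      simp only [Complex.ofReal_sum, Finset.sum_mul]
      rw [Finset.sum_comm]
      exact Finset.sum_eq_zero fun m _ => this m
  obtain ⟨p, hp, hp0⟩ := hrel
  obtain ⟨ε, hε, c, hc, hw⟩ := exists_nonneg_combination hz0 w
  obtain ⟨k, -, hk⟩ := Finset.exists_min_image Finset.univ (fun i => c i / p i)
    ⟨0, Finset.mem_univ _⟩
  set d : Fin 3 → ℝ := fun i => (c i - c k / p k * p i) / ε with hd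
  have hd0 : ∀ i, 0 ≤ d i := fun i => by
    have := hk i (Finset.mem_univ _)
    rw [le_div_iff₀ (hp i)] at this
    exact div_nonneg (by linarith) hε.le
  have hdk : d k = 0 := by
    have := (hp k).ne'
    simp only [hd]; field_simp; simp
  have hεc : (ε : ℂ) ≠ 0 := by exact_mod_cast hε.ne'
  have hwd : w = ∑ i, (d i : ℂ) * z i := by
    have : w = (ε : ℂ)⁻¹ * (∑ i, (c i : ℂ) * z i - (c k / p k : ℝ) * ∑ i, (p i : ℂ) * z i) := by
      rw [hp0, ← hw]; field_simp; simp
    rw [this, Finset.mul_sum, ← Finset.sum_sub_distrib, Finset.mul_sum]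
    refine Finset.sum_congr rfl fun i _ => ?_
    simp only [hd]; push_cast; field_simp
  rw [Fin.sum_univ_three] at hwd
  fin_cases k
  · exact ⟨1, 2, d 1, d 2, hd0 _, hd0 _, by simpa [show d 0 = 0 from hdk] using hwd⟩
  · exact ⟨0, 2, d 0, d 2, hd0 _, hd0 _, by simpa [show d 1 = 0 from hdk] using hwd⟩
  · exact ⟨0, 1, d 0, d 1, hd0 _, hd0 _, by simpa [show d 2 = 0 from hdk] using hwd⟩

/-- An entire function of exponential type that grows at most linearly along three rays which
positively span the plane is affine. -/
theorem affine_of_linear_growth_on_rays {F : ℂ → ℂ} (hF : Differentiable ℂ F) (hFt : IsExpType F)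
    {z : Fin 3 → ℂ} (hz0 : (0 : ℂ) ∈ interior (convexHull ℝ (range z)))
    (hray : ∀ m, ∃ C r₀ : ℝ, ∀ r : ℝ, r₀ ≤ r → ‖F (r * z m)‖ ≤ C * r) :
    ∃ a b : ℂ, ∀ w, F w = a + b * w := by
  -- Linear growth of F on the rays means that the difference quotient (F w - F 0)/w is bounded
  -- there; so it is bounded on all cones between the rays, hence everywhere, hence constant.
  set F₁ := dslope F 0 with hF₁
  have hF₁d : Differentiable ℂ F₁ := by
    rw [← differentiableOn_univ] at hF ⊢
    exact (Complex.differentiableOn_dslope univ_mem).2 hF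
  have hFF : ∀ w, F w = F 0 + F₁ w * w := fun w => by
    have := sub_smul_dslope F 0 w
    rw [sub_zero, smul_eq_mul] at this
    rw [hF₁]; linear_combination -this
  obtain ⟨M, hM⟩ := (isCompact_closedBall (0 : ℂ) 1).exists_bound_of_continuousOn
    hF₁d.continuous.continuousOn
  have hout : ∀ w, 1 ≤ ‖w‖ → ‖F₁ w‖ ≤ ‖F w‖ + ‖F 0‖ := fun w hw => by
    have h1 : F₁ w * w = F w - F 0 := by rw [hFF w]; ring
    have h2 := norm_sub_le (F w) (F 0)
    rw [← h1, norm_mul] at h2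
    nlinarith [norm_nonneg (F₁ w)]
  have hF₁t : IsExpType F₁ := by
    obtain ⟨K, hK, hFK⟩ := hFt
    refine isExpType_of_le (C := 1 + ‖F 0‖ + |M|) (K := K) fun w => ?_
    have h1 : 1 ≤ Real.exp (K * (‖w‖ + 1)) := Real.one_le_exp (by positivity)
    have h2 := abs_nonneg M
    have h3 := norm_nonneg (F 0)
    rcases le_or_gt 1 ‖w‖ with hw | hw
    · have := hout w hw
      have := hFK w
      nlinarith
    · have := hM w (by simpa using hw.le)
      have := le_abs_self M
      nlinarith
  have hbd : ∀ m, ∃ C, ∀ t : ℝ, 0 ≤ t → ‖F₁ (t * z m)‖ ≤ C := by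
    intro m
    obtain ⟨C, r₀, h⟩ := hray m
    rcases eq_or_ne (z m) 0 with hz | hz
    · exact ⟨‖F₁ 0‖, fun t _ => by simp [hz]⟩
    have hzm : 0 < ‖z m‖ := norm_pos_iff.2 hz
    obtain ⟨M', hM'⟩ := (isCompact_Icc (a := 0) (b := max r₀ 1)).exists_bound_of_continuousOn
      (f := fun t : ℝ => F₁ (t * z m)) (hF₁d.continuous.comp (by fun_prop)).continuousOn
    refine ⟨max M' ((C + ‖F 0‖) / ‖z m‖), fun t ht => ?_⟩
    rcases le_or_gt t (max r₀ 1) with h1 | h1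
    · exact (hM' t ⟨ht, h1⟩).trans (le_max_left _ _)
    · refine le_trans ?_ (le_max_right _ _)
      have ht1 : 1 < t := (le_max_right _ _).trans_lt h1
      have h2 : F₁ (t * z m) * (t * z m) = F (t * z m) - F 0 := by rw [hFF (t * z m)]; ring
      have h3 := norm_sub_le (F (t * z m)) (F 0)
      rw [← h2, norm_mul, norm_mul, Complex.norm_real, Real.norm_of_nonneg ht] at h3
      have h4 := h t ((le_max_left _ _).trans h1.le)
      rw [le_div_iff₀ hzm]
      have h5 : t * (‖F₁ (t * z m)‖ * ‖z m‖) ≤ t * (C + ‖F 0‖) := by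
        nlinarith [norm_nonneg (F 0)]
      exact le_of_mul_le_mul_left h5 (by linarith)
  choose C hC using hbd
  have hbdd : ∀ w, ‖F₁ w‖ ≤ max (C 0) (max (C 1) (C 2)) := by
    intro w
    obtain ⟨i, j, s, t, hs, ht, rfl⟩ := exists_mem_cone hz0 w
    have hle : ∀ m, C m ≤ max (C 0) (max (C 1) (C 2)) := fun m => by
      fin_cases m <;> simp
    exact norm_le_on_cone hF₁d hF₁t (fun t ht => (hC i t ht).trans (hle i)) (fun t ht => (hC j t ht).trans (hle j)) hs ht
  obtain ⟨c, hc⟩ := hF₁d.exists_const_forall_eq_of_bounded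
    ((isBounded_iff_forall_norm_le).2 ⟨_, by rintro _ ⟨w, rfl⟩; exact hbdd w⟩)
  exact ⟨F 0, c, fun w => by rw [hFF w, hc w]⟩

end Rays
end BVP
end

noncomputable section
namespace BVP

/-! ### Entire quotients and orders of vanishing -/

section Orders

theorem analyticOrderAt_ne_top_of_entire {D : ℂ → ℂ} (hD : Differentiable ℂ D)
    (hD0 : ∃ w, D w ≠ 0) (μ : ℂ) : analyticOrderAt D μ ≠ ⊤ := by
  obtain ⟨w, hw⟩ := hD0
  intro h
  have hDa : AnalyticOnNhd ℂ D univ := fun x _ => hD.analyticAt x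
  exact hw (hDa.eqOn_zero_of_preconnected_of_eventuallyEq_zero isPreconnected_univ (mem_univ μ)
    (analyticOrderAt_eq_top.1 h) (mem_univ w))

/-- The meromorphic quotient has nonnegative order at every point, so its normal form, which
replaces the meaningless values of G / D at the zeros of D, is entire. The identity holds off a
discrete set and extends by continuity. -/
theorem exists_entire_quotient {G D : ℂ → ℂ} (hG : Differentiable ℂ G) (hD : Differentiable ℂ D)
    (hD0 : ∃ w, D w ≠ 0) (h : ∀ μ, analyticOrderAt D μ ≤ analyticOrderAt G μ) :
    ∃ F : ℂ → ℂ, Differentiable ℂ F ∧ ∀ z, G z = F z * D z := by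
  have hmer : MeromorphicOn (fun z => G z / D z) univ := fun x _ =>
    (hG.analyticAt x).meromorphicAt.div (hD.analyticAt x).meromorphicAt
  set F := toMeromorphicNFOn (fun z => G z / D z) univ with hF
  have hnf : MeromorphicNFOn F univ := meromorphicNFOn_toMeromorphicNFOn _ _
  have hne : ∀ x, ∀ᶠ z in 𝓝[≠] x, D z ≠ 0 := by
    intro x
    rcases (hD.analyticAt x).eventually_eq_zero_or_eventually_ne_zero with h0 | h0
    · exact absurd (analyticOrderAt_eq_top.2 h0) (analyticOrderAt_ne_top_of_entire hD hD0 x)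
    · exact h0
  have hFa : ∀ x, AnalyticAt ℂ F x := by
    intro x
    rw [← (hnf (mem_univ x)).meromorphicOrderAt_nonneg_iff_analyticAt,
      meromorphicOrderAt_toMeromorphicNFOn hmer (mem_univ x)]
    obtain ⟨g, hg, hg0, hDg⟩ := (hD.analyticAt x).analyticOrderAt_ne_top.1
      (analyticOrderAt_ne_top_of_entire hD hD0 x)
    have hle := h x
    rw [← Nat.cast_analyticOrderNatAt (analyticOrderAt_ne_top_of_entire hD hD0 x)] at hle
    obtain ⟨g', hg', hGg⟩ := (natCast_le_analyticOrderAt (hG.analyticAt x)).1 hle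
    have : (fun z => G z / D z) =ᶠ[𝓝[≠] x] fun z => g' z / g z := by
      filter_upwards [hDg.filter_mono nhdsWithin_le_nhds, hGg.filter_mono nhdsWithin_le_nhds,
        self_mem_nhdsWithin] with z h1 h2 h3
      rw [h1, h2]
      exact mul_div_mul_left _ _ (pow_ne_zero _ (sub_ne_zero.2 h3))
    rw [meromorphicOrderAt_congr this]
    exact (hg'.div hg hg0).meromorphicOrderAt_nonneg
  have hFd : Differentiable ℂ F := fun x => (hFa x).differentiableAt
  refine ⟨F, hFd, fun z => ?_⟩
  have hev : G =ᶠ[𝓝[≠] z] fun w => F w * D w := by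
    filter_upwards [hne z, hmer.toMeromorphicNFOn_eq_self_on_nhdsNE (mem_univ z)] with w h1 h2
    rw [hF, h2]; field_simp
  exact ((ContinuousAt.eventuallyEq_nhds_iff_eventuallyEq_nhdsNE hG.continuous.continuousAt
    (hFd.mul hD).continuous.continuousAt).1 hev).eq_of_nhds

theorem dslope_differentiable {F : Type*} [NormedAddCommGroup F] [NormedSpace ℂ F]
    [CompleteSpace F] {f : ℂ → F} (hf : Differentiable ℂ f) (c : ℂ) :
    Differentiable ℂ (dslope f c) := by
  rw [← differentiableOn_univ] at hf ⊢
  exact (Complex.differentiableOn_dslope univ_mem).2 hf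

theorem le_analyticOrderAt_dslope {D : ℂ → ℂ} (hD : Differentiable ℂ D) {μ : ℂ} (h0 : D μ = 0)
    {m : ℕ} (h : ((m + 1 : ℕ) : ℕ∞) ≤ analyticOrderAt D μ) :
    (m : ℕ∞) ≤ analyticOrderAt (dslope D μ) μ := by
  have h1 : D = (fun z => z - μ) * dslope D μ := by
    funext z
    have := sub_smul_dslope D μ z
    simp only [Pi.mul_apply, h0, sub_zero, smul_eq_mul] at this ⊢
    exact this.symm
  rw [h1, analyticOrderAt_mul (by fun_prop) ((dslope_differentiable hD μ).analyticAt μ),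
    analyticOrderAt_id_sub_const_self] at h
  push_cast at h
  rw [add_comm] at h
  exact (ENat.add_le_add_iff_left ENat.one_ne_top).1 h

end Orders

/-! ### Root subspaces -/

section Roots

variable {H : Type*} [AddCommGroup H] [Module ℂ H] {A : H →ₗ.[ℂ] H}

theorem mem_kerPow_succ {μ : ℂ} {k : ℕ} {v : H} :
    v ∈ kerPow A μ (k + 1) ↔ ∃ w, (v, w) ∈ A.graph ∧ w - μ • v ∈ kerPow A μ k := by
  simp only [kerPow, Submodule.mem_map, Submodule.mem_comap, LinearPMap.mem_graph_iff]
  constructor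
  · rintro ⟨x, hx, rfl⟩
    exact ⟨A x, ⟨x, rfl, rfl⟩, hx⟩
  · rintro ⟨w, ⟨x, hx1, hx2⟩, hw⟩
    subst hx1 hx2
    exact ⟨x, hw, rfl⟩

theorem kerPow_mono (μ : ℂ) : Monotone (kerPow A μ) := by
  refine monotone_nat_of_le_succ fun k => ?_
  induction k with
  | zero => exact bot_le
  | succ k ih =>
    intro v hv
    obtain ⟨w, hw, hw'⟩ := mem_kerPow_succ.1 hv
    exact mem_kerPow_succ.2 ⟨w, hw, ih hw'⟩

theorem mem_rootSubspace {μ : ℂ} {v : H} : v ∈ rootSubspace A μ ↔ ∃ k, v ∈ kerPow A μ k :=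
  Submodule.mem_iSup_of_directed _ (kerPow_mono μ).directed_le

theorem mem_rootSubspace_of_graph {μ : ℂ} {v w : H} (h : (v, w) ∈ A.graph)
    (hw : w - μ • v ∈ rootSubspace A μ) : v ∈ rootSubspace A μ := by
  obtain ⟨k, hk⟩ := mem_rootSubspace.1 hw
  exact mem_rootSubspace.2 ⟨k + 1, mem_kerPow_succ.2 ⟨w, h, hk⟩⟩

end Roots

/-! ### Boundary value problems given by a family of integral equations -/

/-- A description of the operator `A` by an integral equation in a Banach space `X`:
`A f = g` means that `f = emb y`, `bdry y = 0`, `y = cst (init y) + pot y + prim g`. -/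
structure IntegralModel {H : Type*} [NormedAddCommGroup H] [NormedSpace ℂ H] (A : H →ₗ.[ℂ] H)
    (X : Type*) [NormedAddCommGroup X] [NormedSpace ℂ X] (n : ℕ) where
  emb : X →L[ℂ] H
  prim : H →L[ℂ] X
  pot : X →L[ℂ] X
  cst : (Fin n → ℂ) →L[ℂ] X
  init : X →L[ℂ] (Fin n → ℂ)
  bdry : X →L[ℂ] (Fin n → ℂ)
  init_cst : ∀ c, init (cst c) = c
  init_pot : ∀ y, init (pot y) = 0
  init_prim : ∀ g, init (prim g) = 0
  -- No value of the parameter is exceptional, as for Volterra operators. This makes the solution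
  -- operator entire in l, so the zeros of the characteristic determinant are the only possible
  -- singularities of the resolvent.
  isUnit : ∀ l : ℂ, IsUnit (1 - pot - l • (prim ∘L emb))
  mem_graph : ∀ f g, (f, g) ∈ A.graph ↔
    ∃ y, emb y = f ∧ bdry y = 0 ∧ y = cst (init y) + pot y + prim g

namespace IntegralModel

section Basic

variable {H : Type*} [NormedAddCommGroup H] [NormedSpace ℂ H] {A : H →ₗ.[ℂ] H}
  {X : Type*} [NormedAddCommGroup X] [NormedSpace ℂ X] {n : ℕ}
  (P : IntegralModel A X n)

/-- The inverse of `1 - pot - l • prim ∘ emb`. -/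
def sol (l : ℂ) : X →L[ℂ] X := Ring.inverse (1 - P.pot - l • (P.prim ∘L P.emb))

theorem sol_differentiable [CompleteSpace X] : Differentiable ℂ P.sol := fun l =>
  DifferentiableAt.inverse (h := fun l : ℂ => 1 - P.pot - l • (P.prim ∘L P.emb))
    (by fun_prop) (P.isUnit l)

theorem eq_sol_iff {l : ℂ} {y w : X} :
    y = w + P.pot y + l • P.prim (P.emb y) ↔ y = P.sol l w := by
  have h1 := Ring.mul_inverse_cancel _ (P.isUnit l)
  have h2 := Ring.inverse_mul_cancel _ (P.isUnit l)
  have h1' := fun x : X => DFunLike.congr_fun h1 x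
  have h2' := fun x : X => DFunLike.congr_fun h2 x
  simp only [mul_apply_eq_comp, one_apply_eq_self] at h1' h2'
  constructor
  · intro h
    have : w = (1 - P.pot - l • (P.prim ∘L P.emb)) y := by
      simp only [_root_.sub_apply, one_apply_eq_self,
        _root_.smul_apply, ContinuousLinearMap.comp_apply]
      nth_rewrite 1 [h]; abel
    rw [this]; exact (h2' y).symm
  · intro h
    have := h1' w
    change (1 - P.pot - l • (P.prim ∘L P.emb)) (P.sol l w) = w at this
    rw [← h] at this
    simp only [_root_.sub_apply, one_apply_eq_self,
      _root_.smul_apply, ContinuousLinearMap.comp_apply] at this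
    rw [← this]; abel

/-- The characteristic matrix. -/
def charMat (l : ℂ) : Matrix (Fin n) (Fin n) ℂ :=
  Matrix.of fun i j => P.bdry (P.sol l (P.cst (Pi.single j 1))) i

/-- The characteristic determinant. -/
def charDet (l : ℂ) : ℂ := (P.charMat l).det

theorem charMat_mulVec (l : ℂ) (c : Fin n → ℂ) :
    P.charMat l *ᵥ c = P.bdry (P.sol l (P.cst c)) := by
  have hc : c = ∑ j, c j • (Pi.single j 1 : Fin n → ℂ) := by
    funext i; simp [Finset.sum_apply, Pi.single_apply]
  conv_rhs => rw [hc]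
  simp only [map_sum, map_smul]
  funext i
  simp [Matrix.mulVec, dotProduct, charMat, Finset.sum_apply, mul_comm]

/-- The functionals `g ↦ (adj M(l) · bdry (sol l (prim g)))ᵢ`. -/
def coeff (i : Fin n) (l : ℂ) : H →L[ℂ] ℂ :=
  ∑ j, (P.charMat l).adjugate i j • (ContinuousLinearMap.proj j ∘L P.bdry ∘L P.sol l ∘L P.prim)

theorem coeff_apply (i : Fin n) (l : ℂ) (g : H) :
    P.coeff i l g = ((P.charMat l).adjugate *ᵥ P.bdry (P.sol l (P.prim g))) i := by
  simp [coeff, Matrix.mulVec, dotProduct]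

/-- The resolvent multiplied by the characteristic determinant. -/
def adjRes (g : H) (l : ℂ) : X :=
  P.charDet l • P.sol l (P.prim g) - P.sol l (P.cst fun i => P.coeff i l g)

theorem bdry_adjRes (g : H) (l : ℂ) : P.bdry (P.adjRes g l) = 0 := by
  have : (fun i => P.coeff i l g) = (P.charMat l).adjugate *ᵥ P.bdry (P.sol l (P.prim g)) :=
    funext fun i => P.coeff_apply i l g
  rw [adjRes, map_sub, ← charMat_mulVec, this, Matrix.mulVec_mulVec, Matrix.mul_adjugate,
    Matrix.smul_mulVec, Matrix.one_mulVec, map_smul]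
  exact sub_self _

theorem init_sol {l : ℂ} {c : Fin n → ℂ} {g : H} :
    P.init (P.sol l (P.cst c + P.prim g)) = c := by
  set y := P.sol l (P.cst c + P.prim g) with hy
  have := P.eq_sol_iff.2 hy
  rw [this]
  simp [P.init_cst, P.init_pot, P.init_prim]

theorem adjRes_eq (g : H) (l : ℂ) :
    P.adjRes g l = P.sol l (P.cst (-fun i => P.coeff i l g) + P.prim (P.charDet l • g)) := by
  simp only [adjRes, map_add, map_neg, map_smul]; abel

theorem adjRes_spec (g : H) (l : ℂ) :
    P.adjRes g l = P.cst (P.init (P.adjRes g l)) + P.pot (P.adjRes g l)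
      + l • P.prim (P.emb (P.adjRes g l)) + P.prim (P.charDet l • g) := by
  have h1 : P.init (P.adjRes g l) = -fun i => P.coeff i l g := by
    rw [adjRes_eq, init_sol]
  have h2 := P.eq_sol_iff.2 (P.adjRes_eq g l)
  rw [h1]
  nth_rewrite 1 [h2]
  abel

/-- The values of the functionals `coeff` on the right-hand side of a solvable problem. -/
theorem coeff_of_solution {l : ℂ} {y : X} {g : H} (hb : P.bdry y = 0)
    (hy : y = P.cst (P.init y) + P.pot y + l • P.prim (P.emb y) + P.prim g) (i : Fin n) :
    P.coeff i l g = -(P.charDet l * P.init y i) := by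
  have h1 : y = P.sol l (P.cst (P.init y) + P.prim g) := by
    rw [← P.eq_sol_iff]
    nth_rewrite 1 [hy]; abel
  have h2 : P.bdry (P.sol l (P.prim g)) = -(P.charMat l *ᵥ P.init y) := by
    rw [charMat_mulVec, eq_neg_iff_add_eq_zero, ← map_add, ← map_add, add_comm (P.prim g), ← h1, hb]
  rw [coeff_apply, h2, Matrix.mulVec_neg, Matrix.mulVec_mulVec, Matrix.adjugate_mul,
    Matrix.smul_mulVec, Matrix.one_mulVec]
  simp [charDet]

theorem differentiable_det {m : ℕ} {M : ℂ → Matrix (Fin m) (Fin m) ℂ}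
    (h : ∀ i j, Differentiable ℂ fun l => M l i j) : Differentiable ℂ fun l => (M l).det := by
  simp only [Matrix.det_apply]
  refine Differentiable.fun_sum fun σ _ => Differentiable.const_smul ?_ _
  exact Differentiable.fun_finsetProd fun i _ => h _ _

theorem isExpType_det {m : ℕ} {M : ℂ → Matrix (Fin m) (Fin m) ℂ}
    (h : ∀ i j, IsExpType fun l => M l i j) : IsExpType fun l => (M l).det := by
  simp only [Matrix.det_apply']
  exact IsExpType.sum fun σ _ => (IsExpType.const _).mul (IsExpType.prod fun i _ => h _ _)

theorem differentiable_adjugate {m : ℕ} {M : ℂ → Matrix (Fin m) (Fin m) ℂ}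
    (h : ∀ i j, Differentiable ℂ fun l => M l i j) (i j : Fin m) :
    Differentiable ℂ fun l => (M l).adjugate i j := by
  simp only [Matrix.adjugate_apply]
  refine differentiable_det fun i' j' => ?_
  by_cases hij : i' = j
  · subst hij; simp
  · simpa [Matrix.updateRow_ne hij] using h i' j'

theorem isExpType_adjugate {m : ℕ} {M : ℂ → Matrix (Fin m) (Fin m) ℂ}
    (h : ∀ i j, IsExpType fun l => M l i j) (i j : Fin m) :
    IsExpType fun l => (M l).adjugate i j := by
  simp only [Matrix.adjugate_apply]
  refine isExpType_det fun i' j' => ?_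
  by_cases hij : i' = j
  · subst hij; simpa using IsExpType.const _
  · simpa [Matrix.updateRow_ne hij] using h i' j'

theorem charMat_differentiable [CompleteSpace X] (i j : Fin n) : Differentiable ℂ fun l => P.charMat l i j := by
  have := P.sol_differentiable
  have h : Differentiable ℂ fun l =>
      (ContinuousLinearMap.proj (R := ℂ) (φ := fun _ : Fin n => ℂ) i ∘L P.bdry)
        (P.sol l (P.cst (Pi.single j 1))) := by fun_prop
  exact h

theorem charDet_differentiable [CompleteSpace X] : Differentiable ℂ P.charDet :=
  differentiable_det P.charMat_differentiable

theorem coeff_differentiable [CompleteSpace X] (i : Fin n) : Differentiable ℂ (P.coeff i) := by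
  unfold coeff
  refine Differentiable.fun_sum fun j _ => Differentiable.smul
    (differentiable_adjugate P.charMat_differentiable i j) ?_
  have := P.sol_differentiable
  fun_prop

theorem adjRes_differentiable [CompleteSpace X] (g : H) : Differentiable ℂ (P.adjRes g) := by
  unfold adjRes
  have h1 := P.sol_differentiable
  have h2 := P.charDet_differentiable
  have h3 : Differentiable ℂ fun l => (fun i => P.coeff i l g) :=
    differentiable_pi.2 fun i => (P.coeff_differentiable i).clm_apply (differentiable_const g)
  exact ((h2.smul (h1.clm_apply (differentiable_const _)))).sub
    (h1.clm_apply (P.cst.differentiable.comp h3))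

theorem isExpType_clm_sol (hS : IsExpType P.sol) (φ : X →L[ℂ] ℂ) (x : X) : IsExpType fun l => φ (P.sol l x) :=
  hS.of_norm_le (C := ‖φ‖ * ‖x‖) fun l => by
    calc ‖φ (P.sol l x)‖ ≤ ‖φ‖ * (‖P.sol l‖ * ‖x‖) :=
          (φ.le_opNorm _).trans (by gcongr; exact (P.sol l).le_opNorm x)
      _ = _ := by ring

theorem isExpType_charMat (hS : IsExpType P.sol) (i j : Fin n) : IsExpType fun l => P.charMat l i j :=
  P.isExpType_clm_sol hS
    (ContinuousLinearMap.proj (R := ℂ) (φ := fun _ : Fin n => ℂ) i ∘L P.bdry) _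

theorem isExpType_charDet (hS : IsExpType P.sol) : IsExpType P.charDet := isExpType_det (P.isExpType_charMat hS)

theorem isExpType_coeff (hS : IsExpType P.sol) (i : Fin n) (g : H) : IsExpType fun l => P.coeff i l g := by
  simp only [coeff, _root_.sum_apply, _root_.smul_apply, smul_eq_mul]
  exact IsExpType.sum fun j _ => (isExpType_adjugate (P.isExpType_charMat hS) i j).mul
    (P.isExpType_clm_sol hS
      (ContinuousLinearMap.proj (R := ℂ) (φ := fun _ : Fin n => ℂ) j ∘L P.bdry) (P.prim g))

/-- Expanding the vector of coefficients in the standard basis writes the function as a sum of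
products of scalar functions of exponential type. -/
theorem isExpType_clm_adjRes (hS : IsExpType P.sol) (φ : X →L[ℂ] ℂ) (g : H) : IsExpType fun l => φ (P.adjRes g l) := by
  have h : ∀ l, φ (P.adjRes g l) = P.charDet l * φ (P.sol l (P.prim g))
      + ∑ i, (-P.coeff i l g) * φ (P.sol l (P.cst (Pi.single i 1))) := by
    intro l
    have hc : (fun i => P.coeff i l g) = ∑ j, P.coeff j l g • (Pi.single j 1 : Fin n → ℂ) := by
      funext i; simp [Finset.sum_apply, Pi.single_apply]
    rw [adjRes, hc]
    simp only [map_sub, map_sum, map_smul, smul_eq_mul, neg_mul, Finset.sum_neg_distrib]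
    ring
  simp only [h]
  refine ((P.isExpType_charDet hS).mul (P.isExpType_clm_sol hS φ _)).add (IsExpType.sum fun i _ =>
    IsExpType.mul ?_ (P.isExpType_clm_sol hS φ _))
  exact (P.isExpType_coeff hS i g).of_norm_le (C := 1) fun l => by simp

end Basic

end IntegralModel

end BVP
end

noncomputable section
namespace BVP
namespace IntegralModel

/-! ### Completeness -/

section Completeness

variable {H : Type*} [NormedAddCommGroup H] [InnerProductSpace ℂ H] {A : H →ₗ.[ℂ] H}
  {X : Type*} [NormedAddCommGroup X] [NormedSpace ℂ X] {n : ℕ}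
  (P : IntegralModel A X n)

/-- The pairing `x ↦ ⟪f, emb x⟫`. -/
def pairing (f : H) : X →L[ℂ] ℂ := innerSL ℂ f ∘L P.emb

theorem graph_of_solution {l : ℂ} {y : X} {g : H} (hb : P.bdry y = 0)
    (hy : y = P.cst (P.init y) + P.pot y + l • P.prim (P.emb y) + P.prim g) :
    (P.emb y, l • P.emb y + g) ∈ A.graph := by
  refine (P.mem_graph _ _).2 ⟨y, rfl, hb, ?_⟩
  nth_rewrite 1 [hy]
  simp only [map_add, map_smul]; abel

/-- A functional vanishing on the root subspace at `μ` annihilates the singular part at `μ` of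
the solutions. -/
theorem le_analyticOrderAt_pairing [CompleteSpace X] {f : H} {μ : ℂ}
    (hf : ∀ v ∈ rootSubspace A μ, inner ℂ f v = 0) (g : H) (m : ℕ) :
    ∀ (y : ℂ → X) (D : ℂ → ℂ) (w : H), Differentiable ℂ y → Differentiable ℂ D →
      w ∈ rootSubspace A μ → (∀ l, P.bdry (y l) = 0) →
      (∀ l, y l = P.cst (P.init (y l)) + P.pot (y l) + l • P.prim (P.emb (y l))
        + P.prim (D l • g + w)) →
      (m : ℕ∞) ≤ analyticOrderAt D μ →
      (m : ℕ∞) ≤ analyticOrderAt (fun l => P.pairing f (y l)) μ := by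
  induction m with
  | zero => intros; simp
  | succ m ih =>
    intro y D w hy hD hw hb heq hord
    have hD0 : D μ = 0 := apply_eq_zero_of_analyticOrderAt_ne_zero fun h => by simp [h] at hord
    have heqμ := heq μ
    rw [hD0, zero_smul, zero_add] at heqμ
    -- At l = μ the term with g disappears, so (A - μ) maps the value of y to the root vector w: the
    -- value is a root vector itself and f annihilates it.
    have hroot : P.emb (y μ) ∈ rootSubspace A μ :=
      mem_rootSubspace_of_graph (P.graph_of_solution (hb μ) heqμ) (by simpa using hw)
    have hyd := dslope_differentiable hy μ
    have hDd := dslope_differentiable hD μ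
    have hys : ∀ l, (l - μ) • dslope y μ l = y l - y μ := fun l => sub_smul_dslope y μ l
    have hDs : ∀ l, (l - μ) * dslope D μ l = D l := fun l => by
      simpa [hD0] using sub_smul_dslope D μ l
    have hb' : ∀ l, P.bdry (dslope y μ l) = 0 := by
      refine fun l => congrFun (Continuous.ext_on (dense_compl_singleton μ)
        (P.bdry.continuous.comp hyd.continuous) continuous_const (g := fun _ => 0) ?_) l
      intro l hl
      have h1 : (l - μ) • P.bdry (dslope y μ l) = 0 := by
        rw [← map_smul, hys, map_sub, hb, hb, sub_zero]
      exact (smul_eq_zero.1 h1).resolve_left (sub_ne_zero.2 hl)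
    -- The difference quotient solves a problem of the same kind, with D replaced by its difference
    -- quotient and w by the root vector just found: in the difference of the equations at l and μ
    -- the old w cancels, and l·y(l) - μ·y(μ) = l(y(l) - y(μ)) + (l - μ)y(μ) produces the new one.
    -- Off μ this is algebra; at μ it follows by continuity.
    have heq' : ∀ l, dslope y μ l = P.cst (P.init (dslope y μ l)) + P.pot (dslope y μ l)
        + l • P.prim (P.emb (dslope y μ l)) + P.prim (dslope D μ l • g + P.emb (y μ)) := by
      refine fun l => congrFun (Continuous.ext_on (dense_compl_singleton μ)
        hyd.continuous (g := fun l => P.cst (P.init (dslope y μ l)) + P.pot (dslope y μ l)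
        + l • P.prim (P.emb (dslope y μ l)) + P.prim (dslope D μ l • g + P.emb (y μ))) ?_ ?_) l
      · have := hyd.continuous
        have := hDd.continuous
        fun_prop
      · intro l hl
        have hl' : l - μ ≠ 0 := sub_ne_zero.2 hl
        apply smul_right_injective X hl'
        simp only
        rw [hys]
        have e1 : (l - μ) • P.cst (P.init (dslope y μ l))
            = P.cst (P.init (y l)) - P.cst (P.init (y μ)) := by
          rw [← map_smul, ← map_smul, hys, map_sub, map_sub]
        have e2 : (l - μ) • P.pot (dslope y μ l) = P.pot (y l) - P.pot (y μ) := by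
          rw [← map_smul, hys, map_sub]
        have e3 : (l - μ) • P.prim (P.emb (dslope y μ l))
            = P.prim (P.emb (y l)) - P.prim (P.emb (y μ)) := by
          rw [← map_smul, ← map_smul, hys, map_sub, map_sub]
        have e4 : (l - μ) • P.prim (dslope D μ l • g + P.emb (y μ))
            = P.prim (D l • g) + (l - μ) • P.prim (P.emb (y μ)) := by
          rw [← map_smul, smul_add, smul_smul, hDs, map_add, map_smul _ (l - μ)]
        rw [smul_add, smul_add, smul_add, e1, e2, e4, smul_comm, e3]
        nth_rewrite 1 [heq l, heqμ]
        rw [map_add P.prim]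
        module
    have h1 := ih (dslope y μ) (dslope D μ) (P.emb (y μ)) hyd hDd hroot hb' heq'
      (le_analyticOrderAt_dslope hD hD0 hord)
    have ha : ∀ {u : ℂ → X}, Differentiable ℂ u → AnalyticAt ℂ (fun l => P.pairing f (u l)) μ :=
      fun hu => ((P.pairing f).differentiable.comp hu).analyticAt μ
    have h2 : (fun l => P.pairing f (y l))
        = (fun l => l - μ) * fun l => P.pairing f (dslope y μ l) := by
      funext l
      have h3 : P.pairing f (y μ) = 0 := hf _ hroot
      have h4 := congrArg (P.pairing f) (hys l)
      rw [map_smul, map_sub, h3, sub_zero, smul_eq_mul] at h4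
      exact h4.symm
    rw [h2, analyticOrderAt_mul (by fun_prop) (ha hyd), analyticOrderAt_id_sub_const_self]
    push_cast
    rw [add_comm]
    gcongr

/-- The resolvent at a point where the characteristic determinant does not vanish. -/
def res (l : ℂ) (g : H) : H := (P.charDet l)⁻¹ • P.emb (P.adjRes g l)

theorem res_graph {l : ℂ} (hl : P.charDet l ≠ 0) (g : H) :
    (P.res l g, l • P.res l g + g) ∈ A.graph := by
  have h := P.graph_of_solution (P.bdry_adjRes g l) (P.adjRes_spec g l)
  have h2 := A.graph.smul_mem (P.charDet l)⁻¹ h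
  have h3 : (P.charDet l)⁻¹ • (P.emb (P.adjRes g l), l • P.emb (P.adjRes g l) + P.charDet l • g)
      = (P.res l g, l • P.res l g + g) := by
    rw [Prod.smul_mk, smul_add, smul_smul _ (P.charDet l), inv_mul_cancel₀ hl, one_smul,
      smul_comm]
    rfl
  rwa [h3] at h2

/-- For any solution y the functionals `coeff` recover -charDet · init y, so `adjRes` and charDet ·
y solve the same initial value problem and coincide. -/
theorem res_unique {l : ℂ} (hl : P.charDet l ≠ 0) {f g : H} (h : (f, l • f + g) ∈ A.graph) :
    f = P.res l g := by
  obtain ⟨y, rfl, hb, hy⟩ := (P.mem_graph _ _).1 h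
  rw [map_add, map_smul, ← add_assoc] at hy
  have h1 := fun i => P.coeff_of_solution hb hy i
  have h2 : P.init (P.adjRes g l) = P.charDet l • P.init y := by
    rw [adjRes_eq, init_sol]
    funext i
    simp [h1 i]
  have h3 : P.adjRes g l = P.charDet l • y := by
    have e1 := P.adjRes_spec g l
    have e2 : P.charDet l • y = P.sol l (P.cst (P.charDet l • P.init y)
        + P.prim (P.charDet l • g)) := by
      rw [← P.eq_sol_iff]
      nth_rewrite 1 [hy]
      simp only [map_smul, smul_add]
      module
    rw [e2, ← h2, ← P.eq_sol_iff]
    nth_rewrite 1 [e1]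
    abel
  rw [res, h3, map_smul, smul_smul, inv_mul_cancel₀ hl, one_smul]

/-- The resolvent identity, obtained from uniqueness: both sides solve the problem with parameter l
and right-hand side g. -/
theorem res_sub {l μ : ℂ} (hl : P.charDet l ≠ 0) (hμ : P.charDet μ ≠ 0) (g : H) :
    P.res l g - P.res μ g = (l - μ) • P.res l (P.res μ g) := by
  have h1 := P.res_graph hl (P.res μ g)
  have h2 := P.res_graph hμ g
  have h3 := A.graph.add_mem h2 (A.graph.smul_mem (l - μ) h1)
  have h4 : P.res μ g + (l - μ) • P.res l (P.res μ g) = P.res l g := by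
    refine P.res_unique hl ?_
    convert h3 using 1
    ext
    · simp
    · simp only [Prod.smul_mk, Prod.mk_add_mk]
      module
  rw [← h4]; abel

theorem continuous_res (l : ℂ) : Continuous (P.res l) := by
  have h : Continuous fun g => (fun i => P.coeff i l g) :=
    continuous_pi fun i => (P.coeff i l).continuous
  unfold res adjRes
  fun_prop

/-- The range of the resolvent contains the domain: f is the resolvent applied to Af - l f. -/
theorem denseRange_res {l : ℂ} (hl : P.charDet l ≠ 0) (hA : Dense (A.domain : Set H)) :
    DenseRange (P.res l) := by
  refine hA.mono fun f hf => ?_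
  have h : (f, A ⟨f, hf⟩) ∈ A.graph := A.mem_graph ⟨f, hf⟩
  refine ⟨A ⟨f, hf⟩ - l • f, (P.res_unique hl ?_).symm⟩
  simpa using h

/-- Linear growth of the inverse along the ray through `z`. -/
def RayBound (z : ℂ) : Prop :=
  ∃ C r₀ : ℝ, ∀ r : ℝ, r₀ ≤ r → ∀ (y : X) (g : H), P.bdry y = 0 →
    y = P.cst (P.init y) + P.pot y + (r * z : ℂ) • P.prim (P.emb y) + P.prim g →
    ‖y‖ ≤ C * r * ‖g‖

variable {P}

/-- A kernel vector of the characteristic matrix is the initial value of a solution with g = 0; the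
bound forces this solution, and with it the vector, to vanish. -/
theorem RayBound.charDet_ne_zero {z : ℂ} (h : P.RayBound z) :
    ∃ r₀ : ℝ, ∀ r : ℝ, r₀ ≤ r → P.charDet (r * z) ≠ 0 := by
  obtain ⟨C, r₀, h⟩ := h
  refine ⟨r₀, fun r hr hdet => ?_⟩
  obtain ⟨c, hc, hMc⟩ := Matrix.exists_mulVec_eq_zero_iff.2 hdet
  set y := P.sol (r * z) (P.cst c) with hy
  have hinit : P.init y = c := by
    have := P.init_sol (l := r * z) (c := c) (g := 0)
    rwa [map_zero, add_zero] at this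
  have hb : P.bdry y = 0 := by rw [hy, ← charMat_mulVec, hMc]
  have := h r hr y 0 hb (by
    rw [hinit, map_zero, add_zero]; exact P.eq_sol_iff.2 hy)
  rw [norm_zero, mul_zero] at this
  have hy0 : y = 0 := norm_le_zero_iff.1 this
  rw [hy0, map_zero] at hinit
  exact hc hinit.symm

variable (P)

/-- For f orthogonal to the system, ⟨f, R(l)g⟩ = a + b l for every g. The resolvent identity turns
this into (l - μ)⟨f, R(l)R(μ)g⟩ = b(l - μ), so ⟨f, R(l)R(μ)g⟩ does not depend on l. Applying the
identity once more, to R(μ)g, gives ⟨f, R(μ)³g⟩ = 0, and the range of R(μ)³ is dense. -/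
theorem isCompleteSystem [CompleteSpace H] [CompleteSpace X] (hS : IsExpType P.sol)
    {z : Fin 3 → ℂ} (hz0 : (0 : ℂ) ∈ interior (convexHull ℝ (range z)))
    (hray : ∀ m, P.RayBound (z m)) (hA : Dense (A.domain : Set H))
    {ι : Type*} {ev : ι → ℂ} {e : ι → H} (he : IsRootSystem A ev e) : IsCompleteSystem e := by
  rw [IsCompleteSystem, Submodule.topologicalClosure_eq_top_iff, Submodule.eq_bot_iff]
  intro f hf
  have hroot : ∀ μ, ∀ v ∈ rootSubspace A μ, inner ℂ f v = 0 := by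
    intro μ v hv
    rw [← he.span_eq μ] at hv
    exact (Submodule.mem_orthogonal' _ _).1 hf v
      (Submodule.span_mono (image_subset_range _ _) hv)
  have hdet : ∃ w, P.charDet w ≠ 0 := by
    obtain ⟨r₀, h⟩ := (hray 0).charDet_ne_zero
    exact ⟨_, h r₀ le_rfl⟩
  have haff : ∀ g, ∃ a b : ℂ, ∀ l, P.charDet l ≠ 0 → inner ℂ f (P.res l g) = a + b * l := by
    intro g
    have hGd : Differentiable ℂ fun l => P.pairing f (P.adjRes g l) :=
      (P.pairing f).differentiable.comp (P.adjRes_differentiable g)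
    obtain ⟨F, hF, hFG⟩ := exists_entire_quotient hGd P.charDet_differentiable hdet (by
      intro μ
      have hne := analyticOrderAt_ne_top_of_entire P.charDet_differentiable hdet μ
      rw [← Nat.cast_analyticOrderNatAt hne]
      refine P.le_analyticOrderAt_pairing (hroot μ) g _ (P.adjRes g) P.charDet 0
        (P.adjRes_differentiable g) P.charDet_differentiable (Submodule.zero_mem _)
        (P.bdry_adjRes g) ?_ (Nat.cast_analyticOrderNatAt hne).le
      intro l
      rw [add_zero]
      exact P.adjRes_spec g l)
    have hFt : IsExpType F := IsExpType.of_mul_eq hF hGd P.charDet_differentiable hdet hFG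
      (P.isExpType_clm_adjRes hS _ g) (P.isExpType_charDet hS)
    have hFres : ∀ l, P.charDet l ≠ 0 → inner ℂ f (P.res l g) = F l := by
      intro l hl
      rw [res, inner_smul_right]
      have : inner ℂ f (P.emb (P.adjRes g l)) = F l * P.charDet l := hFG l
      rw [this]; field_simp
    obtain ⟨a, b, hab⟩ := affine_of_linear_growth_on_rays hF hFt hz0 (by
      intro m
      obtain ⟨r₀, h0⟩ := (hray m).charDet_ne_zero
      obtain ⟨C, r₁, h1⟩ := hray m
      refine ⟨‖P.pairing f‖ * (C * ‖g‖), max r₀ r₁, fun r hr => ?_⟩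
      have hd := h0 r ((le_max_left _ _).trans hr)
      have h2 := h1 r ((le_max_right _ _).trans hr) (P.adjRes g (r * z m))
        (P.charDet (r * z m) • g) (P.bdry_adjRes g _) (P.adjRes_spec g _)
      have h3 := hFG (r * z m)
      have h4 := (P.pairing f).le_opNorm (P.adjRes g (r * z m))
      rw [h3, norm_mul] at h4
      have hdn := norm_pos_iff.2 hd
      rw [norm_smul] at h2
      -- The function `adjRes` solves the problem with right-hand side charDet · g, so the modulus
      -- of the determinant stands on both sides and cancels.
      refine le_of_mul_le_mul_right ?_ hdn
      calc _ ≤ _ := h4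
        _ ≤ ‖P.pairing f‖ * (C * r * (‖P.charDet (r * z m)‖ * ‖g‖)) := by gcongr
        _ = _ := by ring)
    exact ⟨a, b, fun l hl => by rw [hFres l hl, hab]⟩
  -- Otherwise the triangle is a point and has no interior.
  have hz : ∃ m, z m ≠ 0 := by
    by_contra! h
    have : range z ⊆ {0} := by rintro _ ⟨m, rfl⟩; simp [h m]
    have h2 := interior_mono (convexHull_mono this) hz0
    simp at h2
  obtain ⟨m, hm⟩ := hz
  obtain ⟨r₀, hr⟩ := (hray m).charDet_ne_zero
  -- Three distinct points of one ray where the resolvent exists. Two points besides μ are needed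
  -- because the resolvent identity gives no information at l = μ, and an affine function is
  -- determined by two values.
  set μ : ℂ := r₀ * z m with hμ
  set l₁ : ℂ := (r₀ + 1 : ℝ) * z m with hl₁
  set l₂ : ℂ := (r₀ + 2 : ℝ) * z m with hl₂
  have dμ : P.charDet μ ≠ 0 := hr r₀ le_rfl
  have d1 : P.charDet l₁ ≠ 0 := hr _ (by linarith)
  have d2 : P.charDet l₂ ≠ 0 := hr _ (by linarith)
  have n1 : l₁ - μ ≠ 0 := by
    rw [hl₁, hμ]; push_cast; ring_nf; exact hm
  have n2 : l₂ - μ ≠ 0 := by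
    rw [hl₂, hμ]; push_cast; ring_nf; simpa using hm
  have n3 : l₂ - l₁ ≠ 0 := by
    rw [hl₂, hl₁]; push_cast; ring_nf; exact hm
  have hconst : ∀ g, ∃ a : ℂ, ∀ l, P.charDet l ≠ 0 → inner ℂ f (P.res l (P.res μ g)) = a := by
    intro g
    obtain ⟨a, b, hab⟩ := haff g
    obtain ⟨a', b', hab'⟩ := haff (P.res μ g)
    have key : ∀ l, P.charDet l ≠ 0 → l - μ ≠ 0 → a' + b' * l = b := by
      intro l hl hlμ
      have h1 := congrArg (inner ℂ f) (P.res_sub hl dμ g)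
      rw [inner_sub_right, inner_smul_right, hab l hl, hab μ dμ, hab' l hl] at h1
      apply mul_left_cancel₀ hlμ
      rw [← h1]; ring
    have k1 := key l₁ d1 n1
    have k2 := key l₂ d2 n2
    have hb' : b' = 0 := by
      have : b' * (l₂ - l₁) = 0 := by linear_combination k2 - k1
      exact (mul_eq_zero.1 this).resolve_right n3
    exact ⟨a', fun l hl => by rw [hab' l hl, hb']; ring⟩
  have hzero : ∀ g, inner ℂ f (P.res μ (P.res μ (P.res μ g))) = 0 := by
    intro g
    obtain ⟨a, ha⟩ := hconst g
    obtain ⟨a', ha'⟩ := hconst (P.res μ g)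
    have h1 := congrArg (inner ℂ f) (P.res_sub d1 dμ (P.res μ g))
    rw [inner_sub_right, inner_smul_right, ha _ d1, ha _ dμ, ha' _ d1, sub_self] at h1
    rw [ha' _ dμ]
    exact (mul_eq_zero.1 h1.symm).resolve_left n1
  have hden := P.denseRange_res dμ hA
  have hcont := P.continuous_res μ
  have hden3 : DenseRange (P.res μ ∘ P.res μ ∘ P.res μ) :=
    hden.comp (hden.comp hden hcont) hcont
  have h0 : (fun v => inner ℂ f v) = fun _ => (0 : ℂ) := by
    refine hden3.equalizer (by fun_prop) continuous_const ?_
    funext g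
    exact hzero g
  exact inner_self_eq_zero.1 (congrFun h0 f)

end Completeness

/-! ### Minimality -/

section Minimality

variable {H : Type*} [NormedAddCommGroup H] [NormedSpace ℂ H] {A : H →ₗ.[ℂ] H}
  {X : Type*} [NormedAddCommGroup X] [NormedSpace ℂ X] {n : ℕ}
  (P : IntegralModel A X n)

theorem iteratedDeriv_clm_apply_const {φ : ℂ → H →L[ℂ] ℂ} (hφ : Differentiable ℂ φ) (v : H)
    (k : ℕ) (μ : ℂ) : iteratedDeriv k (fun l => φ l v) μ = iteratedDeriv k φ μ v := by
  have hd : ∀ k, Differentiable ℂ (iteratedDeriv k φ) := fun k =>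
    (hφ.contDiff (n := k + 1)).differentiable_iteratedDeriv k (by exact_mod_cast Nat.lt_succ_self k)
  induction k generalizing μ with
  | zero => simp
  | succ k ih =>
    rw [iteratedDeriv_succ, iteratedDeriv_succ, funext fun l => ih l]
    exact (((hd k).differentiableAt (x := μ)).hasDerivAt.clm_apply
      (hasDerivAt_const μ v)).deriv.trans (by simp)

/-- The Taylor coefficients at `μ` of the functionals `coeff`, up to order `m`. -/
def taylor (μ : ℂ) (m : ℕ) : H →L[ℂ] (Fin n × Fin m → ℂ) :=
  ContinuousLinearMap.pi fun p => iteratedDeriv p.2 (P.coeff p.1) μ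

theorem taylor_eq_zero_iff [CompleteSpace X] {μ : ℂ} {m : ℕ} {v : H} :
    P.taylor μ m v = 0 ↔ ∀ i, (m : ℕ∞) ≤ analyticOrderAt (fun l => P.coeff i l v) μ := by
  have ha : ∀ i, AnalyticAt ℂ (fun l => P.coeff i l v) μ := fun i =>
    ((P.coeff_differentiable i).clm_apply (differentiable_const v)).analyticAt μ
  simp only [natCast_le_analyticOrderAt_iff_iteratedDeriv_eq_zero (ha _),
    iteratedDeriv_clm_apply_const (P.coeff_differentiable _)]
  constructor
  · intro h i k hk
    exact congrFun h (i, ⟨k, hk⟩)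
  · intro h
    funext p
    exact h p.1 p.2 p.2.2

/-- The splitting w - l v = (w - ν v) + (ν - l) v is inserted into `coeff_of_solution`. The vector c
is the initial value of the solution; an eigenvector with initial value zero solves a homogeneous
Volterra equation and vanishes. This recursion moves down a chain of root vectors. -/
theorem coeff_of_graph {ν : ℂ} {v w : H} (h : (v, w) ∈ A.graph) :
    ∃ c : Fin n → ℂ, (∀ (l : ℂ) i, P.coeff i l (w - ν • v) + (ν - l) * P.coeff i l v
      = -(P.charDet l * c i)) ∧ (c = 0 → w = ν • v → v = 0) := by
  obtain ⟨y, rfl, hb, hy⟩ := (P.mem_graph _ _).1 h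
  refine ⟨P.init y, fun l i => ?_, fun hc hw => ?_⟩
  · rw [← P.coeff_of_solution (l := l) (g := w - l • P.emb y) hb _ i]
    · simp only [map_sub, map_smul, smul_eq_mul]; ring
    · nth_rewrite 1 [hy]
      simp only [map_sub, map_smul]; abel
  · have : y = P.sol ν 0 := by
      rw [← P.eq_sol_iff]
      nth_rewrite 1 [hy]
      rw [hc, hw, map_zero, map_smul]
    rw [this, map_zero, map_zero]

/-- The Taylor map at μ, truncated at the order m of the zero of the determinant, vanishes on the
root subspaces at other points and is injective on the one at μ. It is continuous with
finite-dimensional target, where spans are closed. So a member at μ lying in the closed span of the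
others would lie in the plain span of the other members at μ, against linear independence. -/
theorem isMinimalSystem [CompleteSpace X] (hdet : ∃ w, P.charDet w ≠ 0)
    {ι : Type*} {ev : ι → ℂ} {e : ι → H} (he : IsRootSystem A ev e) : IsMinimalSystem e := by
  intro i₀ hi₀
  set μ := ev i₀ with hμ
  have hne := analyticOrderAt_ne_top_of_entire P.charDet_differentiable hdet μ
  set m := analyticOrderNatAt P.charDet μ with hm
  have hmo : analyticOrderAt P.charDet μ = m := (Nat.cast_analyticOrderNatAt hne).symm
  have hca : ∀ i v, AnalyticAt ℂ (fun l => P.coeff i l v) μ := fun i v =>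
    ((P.coeff_differentiable i).clm_apply (differentiable_const v)).analyticAt μ
  have hda : AnalyticAt ℂ P.charDet μ := P.charDet_differentiable.analyticAt μ
  have hdc : ∀ c : ℂ, (m : ℕ∞) ≤ analyticOrderAt (fun l => P.charDet l * c) μ := fun c => by
    have : analyticOrderAt (fun l => P.charDet l * c) μ
        = analyticOrderAt P.charDet μ + analyticOrderAt (fun _ : ℂ => c) μ :=
      analyticOrderAt_mul hda analyticAt_const
    rw [this, hmo]; exact le_self_add
  -- Induction along the chain: (ν - l)·coeff(v) is a multiple of the determinant minus a term of
  -- order at least m, and the factor ν - l does not vanish at μ.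
  have hother : ∀ ν, ν ≠ μ → ∀ v ∈ rootSubspace A ν, P.taylor μ m v = 0 := by
    intro ν hν v hv
    obtain ⟨k, hk⟩ := mem_rootSubspace.1 hv
    clear hv
    induction k generalizing v with
    | zero => rw [(Submodule.mem_bot ℂ).1 hk, map_zero]
    | succ k ih =>
      obtain ⟨w, hw, hw'⟩ := mem_kerPow_succ.1 hk
      have h1 := P.taylor_eq_zero_iff.1 (ih _ hw')
      obtain ⟨c, hc, -⟩ := P.coeff_of_graph (ν := ν) hw
      rw [taylor_eq_zero_iff]
      intro i
      have h2 : (fun l => (ν - l) * P.coeff i l v)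
          = (fun l => P.charDet l * (-c i)) - fun l => P.coeff i l (w - ν • v) := by
        funext l
        have := hc l i
        simp only [Pi.sub_apply]
        linear_combination this
      have h3 : (m : ℕ∞) ≤ analyticOrderAt (fun l => (ν - l) * P.coeff i l v) μ := by
        rw [h2]
        exact (le_min (hdc _) (h1 i)).trans le_analyticOrderAt_sub
      have h4 : analyticOrderAt (fun l => (ν - l) * P.coeff i l v) μ
          = analyticOrderAt (fun l => ν - l) μ + analyticOrderAt (fun l => P.coeff i l v) μ :=
        analyticOrderAt_mul (by fun_prop) (hca i v)
      have h5 : analyticOrderAt (fun l => ν - l) μ = 0 :=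
        (AnalyticAt.analyticOrderAt_eq_zero (by fun_prop)).2 (sub_ne_zero.2 hν)
      rwa [h4, h5, zero_add] at h3
  -- Now the factor μ - l gains one order. First the data of w - μ v vanish to order m, so w = μ v
  -- by induction. Then charDet · c vanishes to order m + 1, one more than charDet, which forces c =
  -- 0 and hence v = 0.
  have hsame : ∀ v ∈ rootSubspace A μ, P.taylor μ m v = 0 → v = 0 := by
    intro v hv
    obtain ⟨k, hk⟩ := mem_rootSubspace.1 hv
    clear hv
    induction k generalizing v with
    | zero => exact fun _ => (Submodule.mem_bot ℂ).1 hk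
    | succ k ih =>
      intro hv0
      obtain ⟨w, hw, hw'⟩ := mem_kerPow_succ.1 hk
      obtain ⟨c, hc, hc0⟩ := P.coeff_of_graph (ν := μ) hw
      have h1 := P.taylor_eq_zero_iff.1 hv0
      have h4 : ∀ i, ((m + 1 : ℕ) : ℕ∞) ≤ analyticOrderAt (fun l => (μ - l) * P.coeff i l v) μ := by
        intro i
        have e1 : analyticOrderAt (fun l => (μ - l) * P.coeff i l v) μ
            = analyticOrderAt (fun l => μ - l) μ + analyticOrderAt (fun l => P.coeff i l v) μ :=
          analyticOrderAt_mul (by fun_prop) (hca i v)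
        have e2 : analyticOrderAt (fun l => μ - l) μ ≠ 0 :=
          (AnalyticAt.analyticOrderAt_ne_zero (by fun_prop)).2 (sub_self μ)
        rw [e1]
        push_cast
        rw [add_comm]
        exact add_le_add (Order.one_le_iff_ne_zero.2 e2) (h1 i)
      have hw0 : w - μ • v = 0 := by
        refine ih _ hw' (P.taylor_eq_zero_iff.2 fun i => ?_)
        have h2 : (fun l => P.coeff i l (w - μ • v))
            = (fun l => P.charDet l * (-c i)) - fun l => (μ - l) * P.coeff i l v := by
          funext l
          have := hc l i
          simp only [Pi.sub_apply]
          linear_combination this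
        rw [h2]
        refine (le_min (hdc _) ?_).trans le_analyticOrderAt_sub
        exact le_trans (by exact_mod_cast Nat.le_succ m) (h4 i)
      refine hc0 ?_ (sub_eq_zero.1 hw0)
      funext i
      by_contra hci
      have h2 : (fun l => (μ - l) * P.coeff i l v) = fun l => P.charDet l * (-c i) := by
        funext l
        have := hc l i
        rw [hw0, map_zero] at this
        linear_combination this
      have h3 := h4 i
      have e1 : analyticOrderAt (fun l => P.charDet l * (-c i)) μ
          = analyticOrderAt P.charDet μ + analyticOrderAt (fun _ : ℂ => -c i) μ :=
        analyticOrderAt_mul hda analyticAt_const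
      have e2 : analyticOrderAt (fun _ : ℂ => -c i) μ = 0 :=
        (AnalyticAt.analyticOrderAt_eq_zero analyticAt_const).2 (neg_ne_zero.2 hci)
      rw [h2, e1, e2, add_zero, hmo] at h3
      have : m + 1 ≤ m := by exact_mod_cast h3
      omega
  have hroot : ∀ i, e i ∈ rootSubspace A (ev i) := fun i => by
    rw [← he.span_eq]; exact Submodule.subset_span ⟨i, rfl, rfl⟩
  have h1 : P.taylor μ m (e i₀) ∈
      (Submodule.span ℂ (P.taylor μ m '' (e '' {j | j ≠ i₀}))).topologicalClosure := by
    rw [← ContinuousLinearMap.coe_coe, ← Submodule.map_span]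
    exact image_closure_subset_closure_image (P.taylor μ m).continuous ⟨_, hi₀, rfl⟩
  rw [(Submodule.closed_of_finiteDimensional _).submodule_topologicalClosure_eq] at h1
  have h2 : Submodule.span ℂ (P.taylor μ m '' (e '' {j | j ≠ i₀}))
      ≤ (Submodule.span ℂ (e '' {j | ev j = μ ∧ j ≠ i₀})).map (P.taylor μ m).toLinearMap := by
    rw [Submodule.span_le]
    rintro _ ⟨_, ⟨j, hj, rfl⟩, rfl⟩
    by_cases hjμ : ev j = μ
    · exact ⟨e j, Submodule.subset_span ⟨j, ⟨hjμ, hj⟩, rfl⟩, rfl⟩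
    · rw [hother _ hjμ _ (hroot j)]
      exact Submodule.zero_mem _
  obtain ⟨u, hu, hue⟩ := h2 h1
  have hu' : u ∈ rootSubspace A μ := by
    rw [← he.span_eq]
    exact Submodule.span_mono (image_mono fun j hj => hj.1) hu
  have hz := hsame (e i₀ - u) (Submodule.sub_mem _ (hroot i₀) hu') (by
    rw [map_sub, sub_eq_zero]; exact hue.symm)
  rw [sub_eq_zero] at hz
  rw [← hz] at hu
  have hli := he.linearIndependent μ
  have hnot := hli.notMem_span_image (s := {j | j ≠ ⟨i₀, rfl⟩}) (x := ⟨i₀, rfl⟩) (by simp)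
  apply hnot
  suffices h : (fun i : {i // ev i = μ} => e i) '' {j | j ≠ ⟨i₀, rfl⟩}
      = e '' {j | ev j = μ ∧ j ≠ i₀} by rw [h]; exact hu
  ext x
  constructor
  · rintro ⟨⟨j, hj⟩, hj', rfl⟩
    exact ⟨j, ⟨hj, fun h => hj' (Subtype.ext h)⟩, rfl⟩
  · rintro ⟨j, ⟨hj, hj'⟩, rfl⟩
    exact ⟨⟨j, hj⟩, fun h => hj' (congrArg Subtype.val h), rfl⟩

end Minimality

end IntegralModel
end BVP
end

noncomputable section
namespace BVP

/-! ### Exponential kernels and integrable functions -/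

section Kernel

theorem integrableOn_exp_mul {N : ℝ → ℝ} (hN : IntegrableOn N (Icc (0 : ℝ) 1)) (K x : ℝ) :
    IntegrableOn (fun t => Real.exp (-K * |x - t|) * N t) (Icc (0 : ℝ) 1) :=
  hN.continuousOn_mul (by fun_prop) isCompact_Icc

/-- The exponential kernels `exp (-K |x - t|)` integrate an integrable function to a quantity that
tends to zero as `K → ∞`, uniformly in `x`. -/
theorem exists_kernel_integral_le {N : ℝ → ℝ} (hN : IntegrableOn N (Icc (0 : ℝ) 1))
    (h0 : ∀ t, 0 ≤ N t) {ε : ℝ} (hε : 0 < ε) :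
    ∃ K₀ : ℝ, 0 < K₀ ∧ ∀ K, K₀ ≤ K → ∀ x : ℝ,
      ∫ t in Icc (0 : ℝ) 1, Real.exp (-K * |x - t|) * N t ≤ ε := by
  have hfin : ∫⁻ t in Icc (0 : ℝ) 1, ENNReal.ofReal (N t) ≠ ⊤ := by
    rw [← ofReal_integral_eq_lintegral_ofReal hN (Eventually.of_forall h0)]
    exact ENNReal.ofReal_ne_top
  -- Absolute continuity of the integral: the contribution of t within η of x is small by its length
  -- alone, which gives uniformity in x.
  obtain ⟨δ, hδ, hs⟩ := exists_pos_setLIntegral_lt_of_measure_lt hfin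
    (ε := ENNReal.ofReal (ε / 2)) (by simpa using hε)
  obtain ⟨η, hη, hηδ⟩ : ∃ η : ℝ, 0 < η ∧ ENNReal.ofReal (2 * η) < δ := by
    obtain ⟨q, hq0, hq⟩ := ENNReal.lt_iff_exists_nnreal_btwn.1 hδ
    refine ⟨q / 2, by have : (0 : ENNReal) < q := hq0; simpa using this, ?_⟩
    rw [mul_div_cancel₀ _ two_ne_zero, ENNReal.ofReal_coe_nnreal]
    exact hq
  set I := ∫ t in Icc (0 : ℝ) 1, N t with hI
  have hI0 : 0 ≤ I := integral_nonneg h0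
  -- At distance at least η from x the kernel is at most exp(-Kη) ≤ 1/(Kη), and this choice makes
  -- I/(Kη) ≤ ε/2. The summand 1 keeps the threshold positive when I = 0.
  refine ⟨2 * (I + 1) / (η * ε), by positivity, fun K hK x => ?_⟩
  have hKη : 2 * (I + 1) / ε ≤ K * η := by
    rw [div_le_iff₀ (by positivity)] at hK ⊢
    nlinarith
  set s := Icc (x - η) (x + η) with hsdef
  have hsI : ∫ t in Icc (0 : ℝ) 1, s.indicator N t ≤ ε / 2 := by
    have h1 := hs s (by
      refine (Measure.restrict_apply_le _ s).trans_lt ?_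
      rw [hsdef, Real.volume_Icc]
      convert hηδ using 2
      ring)
    rw [integral_indicator measurableSet_Icc, integral_eq_lintegral_of_nonneg_ae
      (Eventually.of_forall h0) (hN.1.mono_measure Measure.restrict_le_self)]
    exact ENNReal.toReal_le_of_le_ofReal (by positivity) h1.le
  have hexp : Real.exp (-(K * η)) * I ≤ ε / 2 := by
    have h2 : 0 < K * η := lt_of_lt_of_le (by positivity) hKη
    have h3 : Real.exp (-(K * η)) ≤ 1 / (K * η) := by
      rw [Real.exp_neg, ← one_div]
      apply one_div_le_one_div_of_le h2
      linarith [Real.add_one_le_exp (K * η)]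
    rw [div_le_iff₀ hε] at hKη
    calc Real.exp (-(K * η)) * I ≤ 1 / (K * η) * I := by gcongr
      _ = I / (K * η) := by ring
      _ ≤ ε / 2 := by rw [div_le_iff₀ h2]; nlinarith
  calc ∫ t in Icc (0 : ℝ) 1, Real.exp (-K * |x - t|) * N t
      ≤ ∫ t in Icc (0 : ℝ) 1, (s.indicator N t + Real.exp (-(K * η)) * N t) := by
        refine setIntegral_mono (integrableOn_exp_mul hN K x)
          ((Integrable.indicator hN measurableSet_Icc).add (hN.const_mul _)) fun t => ?_
        have hK0 : 0 ≤ K := by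
          by_contra! h
          have : 0 < 2 * (I + 1) / ε := by positivity
          nlinarith
        by_cases ht : t ∈ s
        · rw [indicator_of_mem ht]
          have h4 : Real.exp (-K * |x - t|) ≤ 1 :=
            Real.exp_le_one_iff.2 (by nlinarith [abs_nonneg (x - t)])
          have := h0 t
          have := (Real.exp_pos (-(K * η))).le
          nlinarith [mul_nonneg this (h0 t)]
        · rw [indicator_of_notMem ht, zero_add]
          have h5 : η ≤ |x - t| := by
            by_contra! h
            rw [abs_lt] at h
            exact ht ⟨by linarith, by linarith⟩
          have := h0 t
          gcongr
          nlinarith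
    _ = (∫ t in Icc (0 : ℝ) 1, s.indicator N t) + Real.exp (-(K * η)) * I := by
        rw [integral_add (Integrable.indicator hN measurableSet_Icc) (hN.const_mul _),
          integral_const_mul]
    _ ≤ ε := by linarith

theorem integral_exp_kernel_le {K : ℝ} (hK : 0 < K) (x : ℝ) :
    ∫ t in (0 : ℝ)..x, Real.exp (-K * (x - t)) ≤ 1 / K := by
  have h : ∀ t ∈ uIcc 0 x, HasDerivAt (fun t => Real.exp (-K * (x - t)) / K)
      (Real.exp (-K * (x - t))) t := by
    intro t _
    have h1 : HasDerivAt (fun t => -K * (x - t)) K t := by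
      simpa using ((hasDerivAt_id t).const_sub x).const_mul (-K)
    have := h1.exp.div_const K
    rwa [mul_div_cancel_right₀ _ hK.ne'] at this
  rw [intervalIntegral.integral_eq_sub_of_hasDerivAt h
    ((by fun_prop : Continuous fun t => Real.exp (-K * (x - t))).intervalIntegrable _ _)]
  simp only [sub_self, mul_zero, Real.exp_zero]
  have : 0 ≤ Real.exp (-K * (x - 0)) / K := by positivity
  linarith

end Kernel

/-! ### Matrix-valued functions -/

section MatrixFunctions

variable {n : ℕ}

/-- The product of a matrix and a vector of the Euclidean space. -/
def mv (M : Matrix (Fin n) (Fin n) ℂ) (v : EuclideanSpace ℂ (Fin n)) :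
    EuclideanSpace ℂ (Fin n) := WithLp.toLp 2 (M *ᵥ ⇑v)

theorem mv_apply (M : Matrix (Fin n) (Fin n) ℂ) (v : EuclideanSpace ℂ (Fin n)) (i : Fin n) :
    mv M v i = ∑ k, M i k * v k := rfl

theorem mv_add (M : Matrix (Fin n) (Fin n) ℂ) (v w : EuclideanSpace ℂ (Fin n)) :
    mv M (v + w) = mv M v + mv M w := by
  ext i; simp [mv_apply, mul_add, Finset.sum_add_distrib]

theorem mv_smul (M : Matrix (Fin n) (Fin n) ℂ) (c : ℂ) (v : EuclideanSpace ℂ (Fin n)) :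
    mv M (c • v) = c • mv M v := by
  ext i; simp only [mv_apply, PiLp.smul_apply, smul_eq_mul, Finset.mul_sum]
  exact Finset.sum_congr rfl fun k _ => by ring

theorem mv_real_smul (M : Matrix (Fin n) (Fin n) ℂ) (c : ℝ) (v : EuclideanSpace ℂ (Fin n)) :
    mv M (c • v) = c • mv M v := by
  rw [RCLike.real_smul_eq_coe_smul (K := ℂ) c v, mv_smul, ← RCLike.real_smul_eq_coe_smul]

theorem add_mv (M M' : Matrix (Fin n) (Fin n) ℂ) (v : EuclideanSpace ℂ (Fin n)) :
    mv (M + M') v = mv M v + mv M' v := by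
  ext i; simp [mv_apply, add_mul, Finset.sum_add_distrib]

theorem smul_mv (c : ℂ) (M : Matrix (Fin n) (Fin n) ℂ) (v : EuclideanSpace ℂ (Fin n)) :
    mv (c • M) v = c • mv M v := by
  ext i; simp only [mv_apply, PiLp.smul_apply, smul_eq_mul, Finset.mul_sum, Matrix.smul_apply]
  exact Finset.sum_congr rfl fun k _ => by ring

/-- The sum of the absolute values of the entries. -/
def matNorm (M : Matrix (Fin n) (Fin n) ℂ) : ℝ := ∑ j, ∑ k, ‖M j k‖

theorem matNorm_nonneg (M : Matrix (Fin n) (Fin n) ℂ) : 0 ≤ matNorm M := by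
  unfold matNorm; positivity

theorem norm_le_sum (v : EuclideanSpace ℂ (Fin n)) : ‖v‖ ≤ ∑ i, ‖v i‖ := by
  have h : v = ∑ i, v i • EuclideanSpace.single i (1 : ℂ) := by
    ext j; simp [Finset.sum_apply, Pi.single_apply]
  conv_lhs => rw [h]
  refine (norm_sum_le _ _).trans (Finset.sum_le_sum fun i _ => ?_)
  rw [norm_smul]; simp

theorem norm_mv_le (M : Matrix (Fin n) (Fin n) ℂ) (v : EuclideanSpace ℂ (Fin n)) :
    ‖mv M v‖ ≤ matNorm M * ‖v‖ := by
  refine (norm_le_sum _).trans ?_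
  rw [matNorm, Finset.sum_mul]
  refine Finset.sum_le_sum fun i _ => ?_
  rw [mv_apply, Finset.sum_mul]
  refine (norm_sum_le _ _).trans (Finset.sum_le_sum fun k _ => ?_)
  rw [norm_mul]
  gcongr
  exact PiLp.norm_apply_le v k

theorem integrable_of_coord {μ : Measure ℝ} {f : ℝ → EuclideanSpace ℂ (Fin n)}
    (h : ∀ i, Integrable (fun t => f t i) μ) : Integrable f μ := by
  have hf : f = fun t => ∑ i, f t i • EuclideanSpace.single i (1 : ℂ) := by
    funext t; ext j; simp [Finset.sum_apply, Pi.single_apply]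
  rw [hf]
  exact integrable_finsetSum _ fun i _ => (h i).smul_const _

theorem coord_integrable {μ : Measure ℝ} {f : ℝ → EuclideanSpace ℂ (Fin n)}
    (h : Integrable f μ) (i : Fin n) : Integrable (fun t => f t i) μ :=
  (EuclideanSpace.proj (𝕜 := ℂ) i).integrable_comp h

theorem integrable_matNorm {M : ℝ → Matrix (Fin n) (Fin n) ℂ}
    (hM : ∀ j k, IntegrableOn (fun t => M t j k) (Icc (0 : ℝ) 1)) :
    IntegrableOn (fun t => matNorm (M t)) (Icc (0 : ℝ) 1) :=
  integrable_finsetSum _ fun j _ => integrable_finsetSum _ fun k _ => (hM j k).norm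

theorem integrable_mv {M : ℝ → Matrix (Fin n) (Fin n) ℂ}
    (hM : ∀ j k, IntegrableOn (fun t => M t j k) (Icc (0 : ℝ) 1))
    {y : ℝ → EuclideanSpace ℂ (Fin n)} (hy : ContinuousOn y (Icc (0 : ℝ) 1)) :
    IntegrableOn (fun t => mv (M t) (y t)) (Icc (0 : ℝ) 1) := by
  refine integrable_of_coord fun i => ?_
  simp only [mv_apply]
  refine integrable_finsetSum _ fun k _ => ?_
  exact (hM i k).mul_continuousOn ((EuclideanSpace.proj (𝕜 := ℂ) k).continuous.comp_continuousOn hy)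
    isCompact_Icc

theorem integrable_const_mv (M : Matrix (Fin n) (Fin n) ℂ)
    {g : ℝ → EuclideanSpace ℂ (Fin n)} (hg : IntegrableOn g (Icc (0 : ℝ) 1)) :
    IntegrableOn (fun t => mv M (g t)) (Icc (0 : ℝ) 1) := by
  refine integrable_of_coord fun i => ?_
  simp only [mv_apply]
  exact integrable_finsetSum _ fun k _ => (coord_integrable hg k).const_mul _

end MatrixFunctions

/-! ### Volterra operators in the space of continuous functions -/

section Volterra

variable {n : ℕ}

/-- Continuous functions on `[0,1]` with values in `ℂⁿ`. -/
abbrev Path (n : ℕ) : Type := C(Icc (0 : ℝ) 1, EuclideanSpace ℂ (Fin n))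

/-- The continuous extension to the real line. -/
def ext (y : Path n) : ℝ → EuclideanSpace ℂ (Fin n) := IccExtend zero_le_one y

theorem continuous_ext (y : Path n) : Continuous (ext y) := y.continuous.Icc_extend'

theorem ext_of_mem (y : Path n) {x : ℝ} (hx : x ∈ Icc (0 : ℝ) 1) : ext y x = y ⟨x, hx⟩ :=
  IccExtend_of_mem _ _ hx

theorem norm_ext_le (y : Path n) (x : ℝ) : ‖ext y x‖ ≤ ‖y‖ := y.norm_coe_le_norm _

theorem ext_add (y z : Path n) (x : ℝ) : ext (y + z) x = ext y x + ext z x := rfl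

theorem ext_smul (c : ℂ) (y : Path n) (x : ℝ) : ext (c • y) x = c • ext y x := rfl

theorem intervalIntegrable_of_Icc {F : Type*} [NormedAddCommGroup F] {h : ℝ → F}
    (hh : IntegrableOn h (Icc (0 : ℝ) 1)) {a b : ℝ} (ha : a ∈ Icc (0 : ℝ) 1)
    (hb : b ∈ Icc (0 : ℝ) 1) : IntervalIntegrable h volume a b :=
  (hh.mono_set (uIcc_subset_Icc ha hb)).intervalIntegrable

/-- The primitive of an integrable function. -/
def primFun (h : ℝ → EuclideanSpace ℂ (Fin n)) (hh : IntegrableOn h (Icc (0 : ℝ) 1)) :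
    Path n where
  toFun x := ∫ t in (0 : ℝ)..x, h t
  continuous_toFun := by
    have := intervalIntegral.continuousOn_primitive_interval (a := 0) (b := 1)
      (by rwa [uIcc_of_le zero_le_one])
    rw [uIcc_of_le zero_le_one] at this
    exact continuousOn_iff_continuous_domRestrict.1 this

theorem norm_integral_le_setIntegral {h : ℝ → EuclideanSpace ℂ (Fin n)} {u : ℝ → ℝ}
    (hu : IntegrableOn u (Icc (0 : ℝ) 1)) (hle : ∀ t ∈ Icc (0 : ℝ) 1, ‖h t‖ ≤ u t)
    {x : ℝ} (hx : x ∈ Icc (0 : ℝ) 1) :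
    ‖∫ t in (0 : ℝ)..x, h t‖ ≤ ∫ t in (0 : ℝ)..x, u t := by
  refine intervalIntegral.norm_integral_le_of_norm_le hx.1 ?_
    (intervalIntegrable_of_Icc hu (by simp) hx)
  exact Eventually.of_forall fun t ht => hle t ⟨ht.1.le, ht.2.trans hx.2⟩

theorem integral_le_setIntegral {u : ℝ → ℝ}
    (hu : IntegrableOn u (Icc (0 : ℝ) 1)) (h0 : ∀ t, 0 ≤ u t)
    {x : ℝ} (hx : x ∈ Icc (0 : ℝ) 1) :
    ∫ t in (0 : ℝ)..x, u t ≤ ∫ t in Icc (0 : ℝ) 1, u t := by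
  rw [intervalIntegral.integral_of_le hx.1]
  exact setIntegral_mono_set hu (Eventually.of_forall h0)
    (LE.le.eventuallyLE fun t ht => ⟨ht.1.le, ht.2.trans hx.2⟩)

/-- The Volterra operator with the kernel `M`. -/
def volterra (M : ℝ → Matrix (Fin n) (Fin n) ℂ)
    (hM : ∀ j k, IntegrableOn (fun t => M t j k) (Icc (0 : ℝ) 1)) : Path n →L[ℂ] Path n :=
  LinearMap.mkContinuous
    { toFun := fun y => primFun _ (integrable_mv hM (continuous_ext y).continuousOn)
      map_add' := fun y z => by
        ext1 x
        simp only [primFun, ContinuousMap.coe_mk, ContinuousMap.add_apply, ext_add, mv_add]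
        exact intervalIntegral.integral_add
          (intervalIntegrable_of_Icc (integrable_mv hM (continuous_ext y).continuousOn)
            (by simp) x.2)
          (intervalIntegrable_of_Icc (integrable_mv hM (continuous_ext z).continuousOn)
            (by simp) x.2)
      map_smul' := fun c y => by
        ext1 x
        simp only [primFun, ContinuousMap.coe_mk, ContinuousMap.smul_apply, ext_smul, mv_smul,
          RingHom.id_apply]
        exact intervalIntegral.integral_smul c _ }
    (∫ t in Icc (0 : ℝ) 1, matNorm (M t)) fun y => by
      rw [ContinuousMap.norm_le _ (mul_nonneg (integral_nonneg fun t => matNorm_nonneg _)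
        (norm_nonneg _))]
      intro x
      refine (norm_integral_le_setIntegral ((integrable_matNorm hM).mul_const ‖y‖)
        (fun t _ => (norm_mv_le _ _).trans (mul_le_mul_of_nonneg_left (norm_ext_le y t)
          (matNorm_nonneg _))) x.2).trans ?_
      rw [intervalIntegral.integral_mul_const]
      exact mul_le_mul_of_nonneg_right (integral_le_setIntegral (integrable_matNorm hM)
        (fun t => matNorm_nonneg _) x.2) (norm_nonneg _)

theorem volterra_apply (M : ℝ → Matrix (Fin n) (Fin n) ℂ)
    (hM : ∀ j k, IntegrableOn (fun t => M t j k) (Icc (0 : ℝ) 1)) (y : Path n)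
    (x : Icc (0 : ℝ) 1) :
    volterra M hM y x = ∫ t in (0 : ℝ)..x, mv (M t) (ext y t) := rfl

/-- Multiplication by `exp (-K x)`. -/
def mulExp (n : ℕ) (K : ℝ) : Path n →L[ℂ] Path n :=
  LinearMap.mkContinuous
    { toFun := fun y => ⟨fun x => (Real.exp (-K * x) : ℂ) • y x, by fun_prop⟩
      map_add' := fun y z => by ext1 x; simp [smul_add]
      map_smul' := fun c y => by
        ext1 x
        simp only [ContinuousMap.coe_mk, ContinuousMap.smul_apply, RingHom.id_apply]
        rw [smul_comm] }
    (Real.exp |K|) fun y => by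
      rw [ContinuousMap.norm_le _ (by positivity)]
      intro x
      simp only [LinearMap.coe_mk, AddHom.coe_mk, ContinuousMap.coe_mk]
      rw [norm_smul, Complex.norm_real, Real.norm_of_nonneg (Real.exp_pos _).le]
      gcongr
      · have h1 := x.2.1
        have h2 := x.2.2
        have h3 := neg_abs_le K
        have h4 := abs_nonneg K
        nlinarith
      · exact y.norm_coe_le_norm x

theorem mulExp_apply (K : ℝ) (y : Path n) (x : Icc (0 : ℝ) 1) :
    mulExp n K y x = (Real.exp (-K * x) : ℂ) • y x := rfl

theorem norm_mulExp_le (K : ℝ) : ‖mulExp n K‖ ≤ Real.exp |K| :=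
  LinearMap.mkContinuous_norm_le _ (Real.exp_pos _).le _

theorem mulExp_mul_neg (K : ℝ) : mulExp n K * mulExp n (-K) = 1 := by
  ext1 y; ext1 x
  rw [mul_apply_eq_comp, mulExp_apply, mulExp_apply, smul_smul, ← Complex.ofReal_mul,
    ← Real.exp_add]
  simp

/-- Bielecki's weighted norm: conjugation by exp(-Kx) multiplies the Volterra kernel by exp(-K(x -
t)), which makes the operator a contraction for large K. -/
theorem mulExp_conj_norm_le {M : ℝ → Matrix (Fin n) (Fin n) ℂ}
    (hM : ∀ j k, IntegrableOn (fun t => M t j k) (Icc (0 : ℝ) 1)) {K q : ℝ} (hq : 0 ≤ q)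
    (h : ∀ x ∈ Icc (0 : ℝ) 1, ∫ t in (0 : ℝ)..x, Real.exp (-K * (x - t)) * matNorm (M t) ≤ q) :
    ‖mulExp n K * volterra M hM * mulExp n (-K)‖ ≤ q := by
  refine ContinuousLinearMap.opNorm_le_bound _ hq fun y => ?_
  rw [ContinuousMap.norm_le _ (by positivity)]
  intro x
  simp only [mul_apply_eq_comp]
  rw [mulExp_apply, norm_smul, Complex.norm_real, Real.norm_of_nonneg (Real.exp_pos _).le,
    volterra_apply]
  have hint : IntegrableOn (fun t => Real.exp (K * t) * matNorm (M t) * ‖y‖) (Icc (0 : ℝ) 1) :=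
    ((integrable_matNorm hM).continuousOn_mul (by fun_prop) isCompact_Icc).mul_const _
  have h1 := norm_integral_le_setIntegral hint (h := fun t => mv (M t) (ext (mulExp n (-K) y) t))
    (fun t ht => by
      have h3 : ‖ext (mulExp n (-K) y) t‖ ≤ Real.exp (K * t) * ‖y‖ := by
        rw [ext_of_mem _ ht, mulExp_apply, norm_smul, Complex.norm_real,
          Real.norm_of_nonneg (Real.exp_pos _).le, neg_neg]
        exact mul_le_mul_of_nonneg_left (y.norm_coe_le_norm ⟨t, ht⟩) (Real.exp_pos _).le
      calc ‖mv (M t) (ext (mulExp n (-K) y) t)‖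
          ≤ matNorm (M t) * ‖ext (mulExp n (-K) y) t‖ := norm_mv_le _ _
        _ ≤ matNorm (M t) * (Real.exp (K * t) * ‖y‖) :=
          mul_le_mul_of_nonneg_left h3 (matNorm_nonneg _)
        _ = Real.exp (K * t) * matNorm (M t) * ‖y‖ := by ring) x.2
  refine (mul_le_mul_of_nonneg_left h1 (Real.exp_pos _).le).trans ?_
  rw [intervalIntegral.integral_mul_const, ← mul_assoc, ← intervalIntegral.integral_const_mul]
  refine mul_le_mul_of_nonneg_right ?_ (norm_nonneg _)
  refine le_of_eq_of_le ?_ (h x x.2)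
  congr 1
  funext t
  rw [← mul_assoc, ← Real.exp_add]
  congr 2; ring

theorem isUnit_one_sub_of_conj {R : Type*} [Ring R] {a b v : R} (h1 : a * b = 1)
    (h2 : b * a = 1) (hu : IsUnit (1 - a * v * b)) : IsUnit (1 - v) := by
  have ha : IsUnit a := ⟨⟨_, _, h1, h2⟩, rfl⟩
  have hb : IsUnit b := ⟨⟨_, _, h2, h1⟩, rfl⟩
  have : 1 - v = b * (1 - a * v * b) * a := by
    rw [mul_sub, sub_mul, mul_one, h2]
    congr 1
    calc v = (b * a) * v * (b * a) := by rw [h2, one_mul, mul_one]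
      _ = _ := by simp only [mul_assoc]
  rw [this]
  exact (hb.mul hu).mul ha

theorem isUnit_one_sub_volterra {M : ℝ → Matrix (Fin n) (Fin n) ℂ}
    (hM : ∀ j k, IntegrableOn (fun t => M t j k) (Icc (0 : ℝ) 1)) {K : ℝ}
    (h : ∀ x ∈ Icc (0 : ℝ) 1,
      ∫ t in (0 : ℝ)..x, Real.exp (-K * (x - t)) * matNorm (M t) ≤ 1 / 2) :
    IsUnit (1 - volterra M hM) := by
  have h1 : mulExp n K * mulExp n (-K) = 1 := mulExp_mul_neg K
  have h2 : mulExp n (-K) * mulExp n K = 1 := by simpa using mulExp_mul_neg (n := n) (-K)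
  have hlt : ‖(mulExp n K * volterra M hM * mulExp n (-K) : Path n →L[ℂ] Path n)‖ < 1 :=
    (mulExp_conj_norm_le hM (by norm_num) h).trans_lt (by norm_num)
  have hu := isUnit_one_sub_of_norm_lt_one
    (x := (mulExp n K * volterra M hM * mulExp n (-K) : Path n →L[ℂ] Path n)) hlt
  exact isUnit_one_sub_of_conj h1 h2 hu

/-- In the weighted norm the operator has norm at most 1/2, which gives the factor 2; removing the
weight costs exp K. Since K may be taken linear in the spectral parameter, this is the source of
exponential type. -/
theorem norm_le_of_eq_add_volterra {M : ℝ → Matrix (Fin n) (Fin n) ℂ}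
    (hM : ∀ j k, IntegrableOn (fun t => M t j k) (Icc (0 : ℝ) 1)) {K : ℝ} (hK : 0 ≤ K)
    (h : ∀ x ∈ Icc (0 : ℝ) 1,
      ∫ t in (0 : ℝ)..x, Real.exp (-K * (x - t)) * matNorm (M t) ≤ 1 / 2)
    {y w : Path n} (hy : y = w + volterra M hM y) : ‖y‖ ≤ 2 * Real.exp K * ‖w‖ := by
  have h2 : mulExp n (-K) * mulExp n K = 1 := by simpa using mulExp_mul_neg (n := n) (-K)
  have hback : y = mulExp n (-K) (mulExp n K y) := by
    rw [← mul_apply_eq_comp, h2, one_apply_eq_self]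
  have hexp : ‖mulExp n (-K)‖ ≤ Real.exp K := by
    have := norm_mulExp_le (n := n) (-K)
    rwa [abs_neg, abs_of_nonneg hK] at this
  have hone : ‖mulExp n K w‖ ≤ ‖w‖ := by
    rw [ContinuousMap.norm_le _ (norm_nonneg _)]
    intro x
    rw [mulExp_apply, norm_smul, Complex.norm_real, Real.norm_of_nonneg (Real.exp_pos _).le]
    have h3 : Real.exp (-K * x) ≤ 1 := Real.exp_le_one_iff.2 (by nlinarith [x.2.1])
    have := w.norm_coe_le_norm x
    nlinarith [norm_nonneg (w x)]
  have h4 : mulExp n K y = mulExp n K w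
      + (mulExp n K * volterra M hM * mulExp n (-K)) (mulExp n K y) := by
    simp only [mul_apply_eq_comp]
    rw [← hback, ← map_add, ← hy]
  have h5 : ‖mulExp n K y‖ ≤ ‖w‖ + 1 / 2 * ‖mulExp n K y‖ := by
    nth_rewrite 1 [h4]
    refine (norm_add_le _ _).trans (add_le_add hone ?_)
    exact (ContinuousLinearMap.le_opNorm _ _).trans (mul_le_mul_of_nonneg_right
      (mulExp_conj_norm_le hM (by norm_num) h) (norm_nonneg _))
  have h6 := (mulExp n (-K)).le_opNorm (mulExp n K y)
  rw [← hback] at h6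
  calc ‖y‖ ≤ ‖mulExp n (-K)‖ * ‖mulExp n K y‖ := h6
    _ ≤ Real.exp K * (2 * ‖w‖) := by gcongr; linarith
    _ = _ := by ring

end Volterra

end BVP
end

noncomputable section
namespace BVP

/-! ### Primitives of vector-valued functions -/

section Primitive

variable {F : Type*} [NormedAddCommGroup F] [NormedSpace ℝ F]

/-- The increments are dominated by those of the scalar primitive of ‖h‖, which is absolutely
continuous. -/
theorem absolutelyContinuous_primitive {h : ℝ → F} (hh : IntegrableOn h (Icc (0 : ℝ) 1)) (c : F) :
    AbsolutelyContinuousOnInterval (fun x => c + ∫ t in (0 : ℝ)..x, h t) 0 1 := by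
  have hn : IntervalIntegrable (fun t => ‖h t‖) volume 0 1 :=
    (intervalIntegrable_of_Icc hh (by simp) (by simp)).norm
  have h1 := hn.absolutelyContinuousOnInterval_intervalIntegral (c := 0) (by simp)
  have key : ∀ x ∈ uIcc (0 : ℝ) 1, ∀ y ∈ uIcc (0 : ℝ) 1,
      dist (c + ∫ t in (0 : ℝ)..x, h t) (c + ∫ t in (0 : ℝ)..y, h t)
        ≤ dist (∫ t in (0 : ℝ)..x, ‖h t‖) (∫ t in (0 : ℝ)..y, ‖h t‖) := by
    intro x hx y hy
    rw [uIcc_of_le zero_le_one] at hx hy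
    rw [dist_add_left, dist_eq_norm, dist_eq_norm,
      intervalIntegral.integral_interval_sub_left
        (intervalIntegrable_of_Icc hh (by simp) hx) (intervalIntegrable_of_Icc hh (by simp) hy),
      intervalIntegral.integral_interval_sub_left
        (intervalIntegrable_of_Icc hh.norm (by simp) hx)
        (intervalIntegrable_of_Icc hh.norm (by simp) hy)]
    exact intervalIntegral.norm_integral_le_abs_integral_norm
  refine squeeze_zero' (Eventually.of_forall fun E => Finset.sum_nonneg fun _ _ => dist_nonneg)
    ?_ h1
  have hE : ∀ᶠ E in AbsolutelyContinuousOnInterval.totalLengthFilter ⊓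
      𝓟 (AbsolutelyContinuousOnInterval.disjWithin (0 : ℝ) 1),
      E ∈ AbsolutelyContinuousOnInterval.disjWithin (0 : ℝ) 1 :=
    eventually_inf_principal.mpr (by simp)
  filter_upwards [hE] with E hE
  exact Finset.sum_le_sum fun i hi => key _ (hE.1 i hi).1 _ (hE.1 i hi).2

theorem ae_hasDerivAt_primitive [CompleteSpace F] {h : ℝ → F} (hh : IntegrableOn h (Icc (0 : ℝ) 1)) (c : F) :
    ∀ᵐ x ∂(volume.restrict (Icc (0 : ℝ) 1)),
      HasDerivAt (fun x => c + ∫ t in (0 : ℝ)..x, h t) (h x) x := by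
  have hn : IntervalIntegrable h volume 0 1 := intervalIntegrable_of_Icc hh (by simp) (by simp)
  rw [ae_restrict_iff' measurableSet_Icc]
  filter_upwards [hn.ae_hasDerivAt_integral] with x hx hmem
  rw [uIcc_of_le zero_le_one] at hx
  exact (hx hmem 0 (by simp)).const_add c

theorem eq_add_integral_of_ae_hasDerivAt [CompleteSpace F] {y h : ℝ → F} (hy : AbsolutelyContinuousOnInterval y 0 1)
    (hh : IntegrableOn h (Icc (0 : ℝ) 1))
    (hd : ∀ᵐ x ∂(volume.restrict (Icc (0 : ℝ) 1)), HasDerivAt y (h x) x)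
    {x : ℝ} (hx : x ∈ Icc (0 : ℝ) 1) : y x = y 0 + ∫ t in (0 : ℝ)..x, h t := by
  have hg := hy.sub (absolutelyContinuous_primitive hh (y 0))
  have h0 := ae_hasDerivAt_primitive hh (y 0)
  rw [ae_restrict_iff' measurableSet_Icc] at hd h0
  obtain ⟨c, hc⟩ := hg.const_of_ae_hasDerivAt_zero (by
    rw [uIcc_of_le zero_le_one]
    filter_upwards [hd, h0] with t h1 h2 ht
    simpa using (h1 ht).sub (h2 ht))
  rw [uIcc_of_le zero_le_one] at hc
  have hc0 := hc 0 (by simp)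
  have hcx := hc x hx
  simp only [Pi.sub_apply, intervalIntegral.integral_same, add_zero, sub_self] at hc0 hcx
  rw [← hc0] at hcx
  exact sub_eq_zero.1 hcx

end Primitive

/-! ### The integral model of the boundary value problem -/

section Model

variable {n : ℕ}

/-- The coefficient `-i B Q` of the first order system. -/
def potMat (b : Fin n → ℂ) (Q : ℝ → Matrix (Fin n) (Fin n) ℂ) (t : ℝ) :
    Matrix (Fin n) (Fin n) ℂ :=
  Matrix.of fun j k => -(Complex.I * b j) * Q t j k

/-- The matrix `i B`. -/
def diagI (b : Fin n → ℂ) : Matrix (Fin n) (Fin n) ℂ := Matrix.diagonal fun j => Complex.I * b j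

theorem mv_diagI_apply (b : Fin n → ℂ) (v : EuclideanSpace ℂ (Fin n)) (j : Fin n) :
    mv (diagI b) v j = Complex.I * b j * v j := by
  simp [mv_apply, diagI, Matrix.diagonal_apply]

theorem mv_potMat_apply (b : Fin n → ℂ) (Q : ℝ → Matrix (Fin n) (Fin n) ℂ) (t : ℝ)
    (v : EuclideanSpace ℂ (Fin n)) (j : Fin n) :
    mv (potMat b Q t) v j = -(Complex.I * b j) * (Q t *ᵥ ⇑v) j := by
  simp only [mv_apply, potMat, Matrix.of_apply, Matrix.mulVec, dotProduct, Finset.mul_sum, mul_assoc]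

theorem integrable_potMat {b : Fin n → ℂ} {Q : ℝ → Matrix (Fin n) (Fin n) ℂ}
    (hQ : ∀ j k, IntegrableOn (fun x => Q x j k) (Icc (0 : ℝ) 1)) (j k : Fin n) :
    IntegrableOn (fun t => potMat b Q t j k) (Icc (0 : ℝ) 1) :=
  (hQ j k).const_mul _

theorem eq_diffExpr_iff {b : Fin n → ℂ} (hb : ∀ j, b j ≠ 0) (Q : ℝ → Matrix (Fin n) (Fin n) ℂ)
    (y : ℝ → EuclideanSpace ℂ (Fin n)) (x : ℝ) (g : EuclideanSpace ℂ (Fin n)) :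
    g = diffExpr b Q y x ↔ deriv y x = mv (potMat b Q x) (y x) + mv (diagI b) g := by
  constructor
  · rintro rfl
    ext j
    have := hb j
    simp only [PiLp.add_apply, mv_potMat_apply, mv_diagI_apply, diffExpr]
    field_simp
    linear_combination (deriv y x).ofLp j * Complex.I_sq
  · intro h
    ext j
    have := hb j
    simp only [diffExpr, h, PiLp.add_apply, mv_potMat_apply, mv_diagI_apply]
    field_simp
    linear_combination (g.ofLp j - (Q x *ᵥ ⇑(y x)) j) * Complex.I_sq

theorem memLp_ext (y : Path n) : MemLp (ext y) 2 (volume.restrict (Icc (0 : ℝ) 1)) :=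
  MemLp.of_bound (continuous_ext y).aestronglyMeasurable ‖y‖ (Eventually.of_forall (norm_ext_le y))

theorem integrableOn_L2 (g : L2 n) : IntegrableOn g (Icc (0 : ℝ) 1) :=
  (Lp.memLp g).integrable one_le_two

theorem setIntegral_norm_le (g : L2 n) : ∫ t in Icc (0 : ℝ) 1, ‖g t‖ ≤ ‖g‖ := by
  rw [integral_norm_eq_lintegral_enorm (integrableOn_L2 g).1, ← eLpNorm_one_eq_lintegral_enorm,
    Lp.norm_def]
  have : IsProbabilityMeasure (volume.restrict (Icc (0 : ℝ) 1)) := ⟨by simp⟩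
  exact ENNReal.toReal_mono (Lp.eLpNorm_ne_top g)
    (eLpNorm_le_eLpNorm_of_exponent_le one_le_two (Lp.aestronglyMeasurable g))

/-- The embedding of the continuous functions into `L²`. -/
def embL (n : ℕ) : Path n →L[ℂ] L2 n :=
  LinearMap.mkContinuous
    { toFun := fun y => (memLp_ext y).toLp (ext y)
      map_add' := fun y z => MemLp.toLp_add (memLp_ext y) (memLp_ext z)
      map_smul' := fun c y => MemLp.toLp_const_smul c (memLp_ext y) } 1 fun y => by
    have : ‖(memLp_ext y).toLp (ext y)‖ ≤ _ := Lp.norm_le_of_ae_bound (norm_nonneg y) (by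
      filter_upwards [(memLp_ext y).coeFn_toLp] with x hx
      rw [hx]; exact norm_ext_le y x)
    refine this.trans (le_of_eq ?_)
    simp [measureUnivNNReal]

theorem embL_coeFn (y : Path n) : embL n y =ᵐ[volume.restrict (Icc (0 : ℝ) 1)] ext y :=
  (memLp_ext y).coeFn_toLp

theorem intervalIntegral_congr_Icc {F : Type*} [NormedAddCommGroup F] [NormedSpace ℝ F]
    {h k : ℝ → F} (hk : h =ᵐ[volume.restrict (Icc (0 : ℝ) 1)] k) {x : ℝ}
    (hx : x ∈ Icc (0 : ℝ) 1) : ∫ t in (0 : ℝ)..x, h t = ∫ t in (0 : ℝ)..x, k t := by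
  apply intervalIntegral.integral_congr_ae
  rw [EventuallyEq, ae_restrict_iff' measurableSet_Icc] at hk
  filter_upwards [hk] with t ht hmem
  rw [uIoc_of_le hx.1] at hmem
  exact ht ⟨hmem.1.le, hmem.2.trans hx.2⟩

theorem primFun_apply (h : ℝ → EuclideanSpace ℂ (Fin n)) (hh : IntegrableOn h (Icc (0 : ℝ) 1))
    (x : Icc (0 : ℝ) 1) : primFun h hh x = ∫ t in (0 : ℝ)..x, h t := rfl

theorem integrableOn_const_matrix (M : Matrix (Fin n) (Fin n) ℂ) (j k : Fin n) :
    IntegrableOn (fun _ : ℝ => M j k) (Icc (0 : ℝ) 1) := integrableOn_const (by simp)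

theorem integrableOn_add_smul {M N : ℝ → Matrix (Fin n) (Fin n) ℂ}
    (hM : ∀ j k, IntegrableOn (fun t => M t j k) (Icc (0 : ℝ) 1))
    (hN : ∀ j k, IntegrableOn (fun t => N t j k) (Icc (0 : ℝ) 1)) (l : ℂ) (j k : Fin n) :
    IntegrableOn (fun t => (M t + l • N t) j k) (Icc (0 : ℝ) 1) :=
  (hM j k).add ((hN j k).const_mul l)

/-- The operator `g ↦ ∫₀ˣ M g`. -/
def primL (M : Matrix (Fin n) (Fin n) ℂ) : L2 n →L[ℂ] Path n :=
  LinearMap.mkContinuous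
    { toFun := fun g => primFun _ (integrable_const_mv M (integrableOn_L2 g))
      map_add' := fun g h => by
        ext1 x
        rw [ContinuousMap.add_apply, primFun_apply, primFun_apply, primFun_apply,
          ← intervalIntegral.integral_add
          (intervalIntegrable_of_Icc (integrable_const_mv M (integrableOn_L2 g)) (by simp) x.2)
          (intervalIntegrable_of_Icc (integrable_const_mv M (integrableOn_L2 h)) (by simp) x.2)]
        refine intervalIntegral_congr_Icc ?_ x.2
        filter_upwards [Lp.coeFn_add g h] with t ht
        rw [ht, Pi.add_apply, mv_add]
      map_smul' := fun c g => by
        ext1 x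
        rw [ContinuousMap.smul_apply, RingHom.id_apply, primFun_apply, primFun_apply,
          ← intervalIntegral.integral_smul]
        refine intervalIntegral_congr_Icc ?_ x.2
        filter_upwards [Lp.coeFn_smul c g] with t ht
        rw [ht, Pi.smul_apply, mv_smul] }
    (matNorm M) fun g => by
      rw [ContinuousMap.norm_le _ (mul_nonneg (matNorm_nonneg _) (norm_nonneg _))]
      intro x
      have hi : IntegrableOn (fun t => matNorm M * ‖g t‖) (Icc (0 : ℝ) 1) :=
        (integrableOn_L2 g).norm.const_mul _
      refine (norm_integral_le_setIntegral hi (fun t _ => norm_mv_le _ _) x.2).trans ?_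
      refine (integral_le_setIntegral hi
        (fun t => mul_nonneg (matNorm_nonneg _) (norm_nonneg _)) x.2).trans ?_
      rw [integral_const_mul]
      exact mul_le_mul_of_nonneg_left (setIntegral_norm_le g) (matNorm_nonneg _)

theorem primL_apply (M : Matrix (Fin n) (Fin n) ℂ) (g : L2 n) (x : Icc (0 : ℝ) 1) :
    primL M g x = ∫ t in (0 : ℝ)..x, mv M (g t) := rfl

theorem primL_embL (M : Matrix (Fin n) (Fin n) ℂ) :
    primL M ∘L embL n = volterra (fun _ => M) (integrableOn_const_matrix M) := by
  ext1 y; ext1 x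
  rw [ContinuousLinearMap.comp_apply, primL_apply, volterra_apply]
  refine intervalIntegral_congr_Icc ?_ x.2
  filter_upwards [embL_coeFn y] with t ht
  rw [ht]

/-- Constant functions. -/
def cstL (n : ℕ) : (Fin n → ℂ) →L[ℂ] Path n :=
  LinearMap.toContinuousLinearMap
    { toFun := fun c => ContinuousMap.const _ (WithLp.toLp 2 c)
      map_add' := fun _ _ => rfl
      map_smul' := fun _ _ => rfl }

/-- The coordinates of the value at a point. -/
def evalL (n : ℕ) (x : Icc (0 : ℝ) 1) : Path n →L[ℂ] (Fin n → ℂ) :=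
  ContinuousLinearMap.pi fun j =>
    (EuclideanSpace.proj (𝕜 := ℂ) j) ∘L (ContinuousMap.evalCLM ℂ x)

theorem evalL_apply (x : Icc (0 : ℝ) 1) (y : Path n) : evalL n x y = ⇑(y x) := rfl

/-- The boundary form `C y(0) + D y(1)`. -/
def bdryL (C D : Matrix (Fin n) (Fin n) ℂ) : Path n →L[ℂ] (Fin n → ℂ) :=
  LinearMap.toContinuousLinearMap C.mulVecLin ∘L evalL n 0
    + LinearMap.toContinuousLinearMap D.mulVecLin ∘L evalL n 1

theorem volterra_add_smul {M N : ℝ → Matrix (Fin n) (Fin n) ℂ}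
    (hM : ∀ j k, IntegrableOn (fun t => M t j k) (Icc (0 : ℝ) 1))
    (hN : ∀ j k, IntegrableOn (fun t => N t j k) (Icc (0 : ℝ) 1)) (l : ℂ) :
    volterra M hM + l • volterra N hN = volterra (fun t => M t + l • N t)
      (integrableOn_add_smul hM hN l) := by
  ext1 y; ext1 x
  simp only [_root_.add_apply, _root_.smul_apply, ContinuousMap.add_apply,
    ContinuousMap.smul_apply, volterra_apply]
  simp only [add_mv, smul_mv]
  have i1 : IntervalIntegrable (fun t => mv (M t) (ext y t)) volume 0 x :=
    intervalIntegrable_of_Icc (integrable_mv hM (continuous_ext y).continuousOn) (by simp) x.2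
  have i2 : IntervalIntegrable (fun t => mv (N t) (ext y t)) volume 0 x :=
    intervalIntegrable_of_Icc (integrable_mv hN (continuous_ext y).continuousOn) (by simp) x.2
  rw [← intervalIntegral.integral_smul]
  exact (intervalIntegral.integral_add i1 (i2.smul l)).symm

theorem matNorm_add_smul_le (M N : Matrix (Fin n) (Fin n) ℂ) (l : ℂ) :
    matNorm (M + l • N) ≤ matNorm M + ‖l‖ * matNorm N := by
  simp only [matNorm, Finset.mul_sum, ← Finset.sum_add_distrib]
  refine Finset.sum_le_sum fun j _ => Finset.sum_le_sum fun k _ => ?_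
  rw [← norm_mul]
  exact norm_add_le _ _

/-- The weighted kernels of `V + l W`, `V` with integrable and `W` with constant coefficients, are
small as soon as the weight grows linearly in `l`. -/
theorem exists_kernel_le_half {M : ℝ → Matrix (Fin n) (Fin n) ℂ}
    (hM : ∀ j k, IntegrableOn (fun t => M t j k) (Icc (0 : ℝ) 1))
    (N : Matrix (Fin n) (Fin n) ℂ) :
    ∃ K₀ : ℝ, 0 < K₀ ∧ ∀ l : ℂ, ∀ x ∈ Icc (0 : ℝ) 1,
      ∫ t in (0 : ℝ)..x, Real.exp (-(K₀ * (‖l‖ + 1)) * (x - t)) * matNorm (M t + l • N) ≤ 1 / 2 := by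
  obtain ⟨K₁, hK₁, h⟩ := exists_kernel_integral_le (integrable_matNorm hM)
    (fun t => matNorm_nonneg _) (ε := 1 / 4) (by norm_num)
  have hN0 := matNorm_nonneg N
  -- K₁ makes the contribution of the integrable part at most 1/4. The constant part contributes at
  -- most ‖l‖·matNorm N / K, and K ≥ 4‖l‖·matNorm N makes this at most 1/4 as well.
  refine ⟨K₁ + 4 * matNorm N, by positivity, fun l x hx => ?_⟩
  set K := (K₁ + 4 * matNorm N) * (‖l‖ + 1) with hKdef
  have hl := norm_nonneg l
  have hK : K₁ ≤ K := by nlinarith [mul_nonneg hN0 hl, mul_nonneg hK₁.le hl]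
  have hK' : 4 * (‖l‖ * matNorm N) ≤ K := by nlinarith [mul_nonneg hN0 hl, mul_nonneg hK₁.le hl]
  have hK0 : 0 < K := hK₁.trans_le hK
  have i1 : IntegrableOn (fun t => Real.exp (-K * (x - t)) * matNorm (M t)) (Icc (0 : ℝ) 1) :=
    (integrable_matNorm hM).continuousOn_mul (by fun_prop) isCompact_Icc
  have i2 : IntegrableOn (fun t => Real.exp (-K * (x - t)) * (‖l‖ * matNorm N)) (Icc (0 : ℝ) 1) :=
    (by fun_prop : Continuous fun t => Real.exp (-K * (x - t)) * (‖l‖ * matNorm N)).integrableOn_Icc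
  have i3 : IntegrableOn (fun t => Real.exp (-K * (x - t)) * matNorm (M t + l • N))
      (Icc (0 : ℝ) 1) :=
    (integrable_matNorm (M := fun t => M t + l • N) (integrableOn_add_smul hM
      (integrableOn_const_matrix N) l)).continuousOn_mul (by fun_prop) isCompact_Icc
  have e1 : ∫ t in (0 : ℝ)..x, Real.exp (-K * (x - t)) * matNorm (M t) ≤ 1 / 4 := by
    refine le_trans (le_of_eq_of_le ?_ (integral_le_setIntegral
      (integrableOn_exp_mul (integrable_matNorm hM) K x)
      (fun t => mul_nonneg (Real.exp_pos _).le (matNorm_nonneg _)) hx)) (h K hK x)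
    refine intervalIntegral.integral_congr fun t ht => ?_
    rw [uIcc_of_le hx.1] at ht
    simp only [abs_of_nonneg (sub_nonneg.2 ht.2)]
  have e2 : ∫ t in (0 : ℝ)..x, Real.exp (-K * (x - t)) * (‖l‖ * matNorm N) ≤ 1 / 4 := by
    rw [intervalIntegral.integral_mul_const]
    refine (mul_le_mul_of_nonneg_right (integral_exp_kernel_le hK0 x) (by positivity)).trans ?_
    rw [one_div_mul_eq_div, div_le_iff₀ hK0]
    linarith
  calc ∫ t in (0 : ℝ)..x, Real.exp (-K * (x - t)) * matNorm (M t + l • N)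
      ≤ ∫ t in (0 : ℝ)..x, (Real.exp (-K * (x - t)) * matNorm (M t)
          + Real.exp (-K * (x - t)) * (‖l‖ * matNorm N)) := by
        refine intervalIntegral.integral_mono_on hx.1 (intervalIntegrable_of_Icc i3 (by simp) hx)
          (intervalIntegrable_of_Icc (i1.add i2) (by simp) hx) fun t _ => ?_
        rw [← mul_add]
        exact mul_le_mul_of_nonneg_left (matNorm_add_smul_le _ _ _) (Real.exp_pos _).le
    _ ≤ 1 / 2 := by
        rw [intervalIntegral.integral_add (intervalIntegrable_of_Icc i1 (by simp) hx)
          (intervalIntegrable_of_Icc i2 (by simp) hx)]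
        linarith

theorem one_sub_sub_eq {b : Fin n → ℂ} {Q : ℝ → Matrix (Fin n) (Fin n) ℂ}
    (hQ : ∀ j k, IntegrableOn (fun x => Q x j k) (Icc (0 : ℝ) 1)) (l : ℂ) :
    1 - volterra (potMat b Q) (integrable_potMat hQ) - l • (primL (diagI b) ∘L embL n)
      = 1 - volterra (fun t => potMat b Q t + l • diagI b)
        (integrableOn_add_smul (integrable_potMat hQ)
          (integrableOn_const_matrix (diagI b)) l) := by
  rw [primL_embL,
    ← volterra_add_smul (integrable_potMat hQ) (integrableOn_const_matrix (diagI b)) l]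
  ext1 y
  exact sub_sub _ _ _

theorem ext_equation {b : Fin n → ℂ} {Q : ℝ → Matrix (Fin n) (Fin n) ℂ}
    (hQ : ∀ j k, IntegrableOn (fun x => Q x j k) (Icc (0 : ℝ) 1)) (y : Path n) (g : L2 n) :
    y = cstL n (evalL n 0 y) + volterra (potMat b Q) (integrable_potMat hQ) y + primL (diagI b) g
      ↔ ∀ x ∈ Icc (0 : ℝ) 1, ext y x = ext y 0 +
        ∫ t in (0 : ℝ)..x, (mv (potMat b Q t) (ext y t) + mv (diagI b) (g t)) := by
  have h0 : ext y 0 = y 0 := ext_of_mem y (by simp)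
  have key : ∀ x : Icc (0 : ℝ) 1, (cstL n (evalL n 0 y)
      + volterra (potMat b Q) (integrable_potMat hQ) y + primL (diagI b) g) x = ext y 0 +
        ∫ t in (0 : ℝ)..x, (mv (potMat b Q t) (ext y t) + mv (diagI b) (g t)) := by
    intro x
    rw [intervalIntegral.integral_add
      (intervalIntegrable_of_Icc (integrable_mv (integrable_potMat hQ)
        (continuous_ext y).continuousOn) (by simp) x.2)
      (intervalIntegrable_of_Icc (integrable_const_mv _ (integrableOn_L2 g)) (by simp) x.2)]
    rw [h0, ContinuousMap.add_apply, ContinuousMap.add_apply, add_assoc]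
    rfl
  constructor
  · intro h x hx
    rw [← key ⟨x, hx⟩, ← h, ext_of_mem y hx]
  · intro h
    ext1 x
    rw [key, ← h x x.2, ext_of_mem y x.2]

/-- Solving Ly = g for y' gives y' = -iBQy + iBg almost everywhere; for absolutely continuous y this
is the same as the integrated equation. -/
theorem mem_bvpGraph_iff {b : Fin n → ℂ} (hb : ∀ j, b j ≠ 0) {Q : ℝ → Matrix (Fin n) (Fin n) ℂ}
    (hQ : ∀ j k, IntegrableOn (fun x => Q x j k) (Icc (0 : ℝ) 1))
    (C D : Matrix (Fin n) (Fin n) ℂ) (f g : L2 n) :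
    (f, g) ∈ bvpGraph b Q C D ↔ ∃ y : Path n, embL n y = f ∧ bdryL C D y = 0 ∧
      y = cstL n (evalL n 0 y) + volterra (potMat b Q) (integrable_potMat hQ) y
        + primL (diagI b) g := by
  have hint : ∀ y : Path n, IntegrableOn
      (fun t => mv (potMat b Q t) (ext y t) + mv (diagI b) (g t)) (Icc (0 : ℝ) 1) := fun y =>
    (integrable_mv (integrable_potMat hQ) (continuous_ext y).continuousOn).add
      (integrable_const_mv _ (integrableOn_L2 g))
  constructor
  · rintro ⟨y, hy, hbd, hf, hg⟩
    have hc : ContinuousOn y (Icc (0 : ℝ) 1) := by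
      have h := hy.continuousOn
      rwa [uIcc_of_le zero_le_one] at h
    let Y : Path n := ⟨(Icc (0 : ℝ) 1).domRestrict y, continuousOn_iff_continuous_domRestrict.1 hc⟩
    have hY : ∀ x ∈ Icc (0 : ℝ) 1, ext Y x = y x := fun x hx => ext_of_mem Y hx
    have hYae : ext Y =ᵐ[volume.restrict (Icc (0 : ℝ) 1)] y := by
      filter_upwards [ae_restrict_mem measurableSet_Icc] with x hx using hY x hx
    refine ⟨Y, Lp.ext ((embL_coeFn Y).trans (hYae.trans hf.symm)), hbd, ?_⟩
    rw [ext_equation hQ]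
    intro x hx
    rw [hY x hx, hY 0 (by simp)]
    refine eq_add_integral_of_ae_hasDerivAt hy (hint Y) ?_ hx
    filter_upwards [hg, ae_differentiableAt hy, hYae] with t h1 h2 h3
    rw [h3, ← (eq_diffExpr_iff hb Q y t (g t)).1 h1]
    exact h2.hasDerivAt
  · rintro ⟨Y, hf, hbd, hY⟩
    rw [ext_equation hQ] at hY
    -- The right-hand side of the equation agrees with Y on [0,1], and as a primitive it comes with
    -- absolute continuity and the derivative almost everywhere.
    set y : ℝ → EuclideanSpace ℂ (Fin n) := fun x => ext Y 0 +
        ∫ t in (0 : ℝ)..x, (mv (potMat b Q t) (ext Y t) + mv (diagI b) (g t)) with hydef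
    have hyY : ∀ x ∈ Icc (0 : ℝ) 1, y x = ext Y x := fun x hx => (hY x hx).symm
    have hYae : ext Y =ᵐ[volume.restrict (Icc (0 : ℝ) 1)] y := by
      filter_upwards [ae_restrict_mem measurableSet_Icc] with x hx using hY x hx
    refine ⟨y, absolutelyContinuous_primitive (hint Y) _, ?_, ?_, ?_⟩
    · rw [hyY 0 (by simp), hyY 1 (by simp), ext_of_mem Y (by simp), ext_of_mem Y (by simp)]
      exact hbd
    · subst hf
      exact (embL_coeFn Y).trans hYae
    · filter_upwards [ae_hasDerivAt_primitive (hint Y) (ext Y 0), hYae] with t h1 h3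
      refine (eq_diffExpr_iff hb Q y t (g t)).2 ?_
      rw [← h3]
      exact h1.deriv

/-- The integral model of the operator `L_{C,D}(Q)`. -/
def bvpModel {b : Fin n → ℂ} (hb : ∀ j, b j ≠ 0) {Q : ℝ → Matrix (Fin n) (Fin n) ℂ}
    (hQ : ∀ j k, IntegrableOn (fun x => Q x j k) (Icc (0 : ℝ) 1))
    (C D : Matrix (Fin n) (Fin n) ℂ) : IntegralModel (bvpOperator b Q C D) (Path n) n where
  emb := embL n
  prim := primL (diagI b)
  pot := volterra (potMat b Q) (integrable_potMat hQ)
  cst := cstL n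
  init := evalL n 0
  bdry := bdryL C D
  init_cst _ := rfl
  init_pot y := by
    rw [evalL_apply, volterra_apply]
    simp
  init_prim g := by
    rw [evalL_apply, primL_apply]
    simp
  isUnit l := by
    rw [one_sub_sub_eq hQ]
    obtain ⟨K₀, _, h⟩ := exists_kernel_le_half (integrable_potMat (b := b) hQ) (diagI b)
    exact isUnit_one_sub_volterra _ (h l)
  mem_graph f g := by rw [bvpOperator_graph, mem_bvpGraph_iff hb hQ]

theorem isExpType_sol_bvpModel {b : Fin n → ℂ} (hb : ∀ j, b j ≠ 0)
    {Q : ℝ → Matrix (Fin n) (Fin n) ℂ}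
    (hQ : ∀ j k, IntegrableOn (fun x => Q x j k) (Icc (0 : ℝ) 1))
    (C D : Matrix (Fin n) (Fin n) ℂ) : IsExpType (bvpModel hb hQ C D).sol := by
  obtain ⟨K₀, hK₀, h⟩ := exists_kernel_le_half (integrable_potMat (b := b) hQ) (diagI b)
  refine isExpType_of_le (C := 2) (K := K₀) fun l => ?_
  refine ContinuousLinearMap.opNorm_le_bound _ (by positivity) fun w => ?_
  have h1 := (bvpModel hb hQ C D).eq_sol_iff.2 (rfl : _ = (bvpModel hb hQ C D).sol l w)
  refine norm_le_of_eq_add_volterra (integrableOn_add_smul (integrable_potMat hQ)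
    (integrableOn_const_matrix (diagI b)) l) (by positivity) (h l) ?_
  rw [← volterra_add_smul (integrable_potMat hQ) (integrableOn_const_matrix (diagI b)) l,
    ← primL_embL]
  nth_rewrite 1 [h1]
  rw [add_assoc]
  rfl

end Model

end BVP
end

noncomputable section
namespace BVP

/-! ### The domain is dense -/

section Dense

variable {n : ℕ}

/-- Backward uniqueness: with the weight exp(-K(x₀ - x)) the maximum s of the norm on [0, x₀]
satisfies s ≤ s/2. It shows that the fundamental matrix is invertible at every point. -/
theorem eq_zero_of_backward {M : ℝ → Matrix (Fin n) (Fin n) ℂ}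
    (hM : ∀ j k, IntegrableOn (fun t => M t j k) (Icc (0 : ℝ) 1)) {Y : Path n}
    {c : EuclideanSpace ℂ (Fin n)}
    (hY : ∀ x ∈ Icc (0 : ℝ) 1, ext Y x = c + ∫ t in (0 : ℝ)..x, mv (M t) (ext Y t))
    {x₀ : ℝ} (hx₀ : x₀ ∈ Icc (0 : ℝ) 1) (h0 : ext Y x₀ = 0) : c = 0 := by
  obtain ⟨K, hK, hker⟩ := exists_kernel_integral_le (integrable_matNorm hM)
    (fun t => matNorm_nonneg _) (ε := 1 / 2) (by norm_num)
  have hcont : Continuous fun x => Real.exp (-K * (x₀ - x)) * ‖ext Y x‖ := by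
    have := continuous_ext Y
    fun_prop
  obtain ⟨m, hm, hmax⟩ := isCompact_Icc.exists_isMaxOn (nonempty_Icc.2 hx₀.1) hcont.continuousOn
  have hm1 : m ∈ Icc (0 : ℝ) 1 := ⟨hm.1, hm.2.trans hx₀.2⟩
  set s := Real.exp (-K * (x₀ - m)) * ‖ext Y m‖ with hs
  have hint := integrable_mv hM (continuous_ext Y).continuousOn
  have hbound : ∀ t ∈ Icc (0 : ℝ) x₀, ‖ext Y t‖ ≤ s * Real.exp (K * (x₀ - t)) := by
    intro t ht
    have h1 : Real.exp (-K * (x₀ - t)) * ‖ext Y t‖ ≤ s := hmax ht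
    calc ‖ext Y t‖ = (Real.exp (-K * (x₀ - t)) * ‖ext Y t‖) * Real.exp (K * (x₀ - t)) := by
          rw [mul_right_comm, ← Real.exp_add]; simp
      _ ≤ _ := mul_le_mul_of_nonneg_right h1 (Real.exp_pos _).le
  have hYm : ext Y m = -∫ t in m..x₀, mv (M t) (ext Y t) := by
    have h1 := hY m hm1
    have h2 := hY x₀ hx₀
    have hz : (0 : ℝ) ∈ Icc (0 : ℝ) 1 := by simp
    rw [h0] at h2
    rw [← intervalIntegral.integral_interval_sub_left
      (intervalIntegrable_of_Icc hint hz hx₀)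
      (intervalIntegrable_of_Icc hint hz hm1), h1, eq_neg_of_add_eq_zero_left h2.symm]
    abel
  have hs2 : s ≤ s * (1 / 2) := by
    have i1 := integrableOn_exp_mul (integrable_matNorm hM) K m
    calc s = Real.exp (-K * (x₀ - m)) * ‖∫ t in m..x₀, mv (M t) (ext Y t)‖ := by
          rw [hs, hYm, norm_neg]
      _ ≤ Real.exp (-K * (x₀ - m)) *
          ∫ t in m..x₀, matNorm (M t) * (s * Real.exp (K * (x₀ - t))) := by
          refine mul_le_mul_of_nonneg_left ?_ (Real.exp_pos _).le
          refine intervalIntegral.norm_integral_le_of_norm_le hm.2 ?_ ?_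
          · refine Eventually.of_forall fun t ht => (norm_mv_le _ _).trans ?_
            exact mul_le_mul_of_nonneg_left (hbound t ⟨hm.1.trans ht.1.le, ht.2⟩)
              (matNorm_nonneg _)
          · refine intervalIntegrable_of_Icc ?_ hm1 hx₀
            exact (integrable_matNorm hM).mul_continuousOn (by fun_prop) isCompact_Icc
      _ = s * ∫ t in m..x₀, Real.exp (-K * |m - t|) * matNorm (M t) := by
          rw [← intervalIntegral.integral_const_mul, ← intervalIntegral.integral_const_mul]
          refine intervalIntegral.integral_congr fun t ht => ?_
          rw [uIcc_of_le hm.2] at ht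
          have : Real.exp (-K * |m - t|)
              = Real.exp (-K * (x₀ - m)) * Real.exp (K * (x₀ - t)) := by
            rw [← Real.exp_add, abs_of_nonpos (sub_nonpos.2 ht.1)]
            congr 1; ring
          simp only [this]; ring
      _ ≤ s * (1 / 2) := by
          refine mul_le_mul_of_nonneg_left (le_trans ?_ (hker K le_rfl m)) (by positivity)
          rw [intervalIntegral.integral_of_le hm.2]
          exact setIntegral_mono_set i1
            (Eventually.of_forall fun t => mul_nonneg (Real.exp_pos _).le (matNorm_nonneg _))
            (LE.le.eventuallyLE fun t ht => ⟨hm.1.trans ht.1.le, ht.2.trans hx₀.2⟩)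
  have hs0 : s ≤ 0 := by linarith
  have h00 := hY 0 (by simp)
  rw [intervalIntegral.integral_same, add_zero] at h00
  have h3 := hbound 0 ⟨le_rfl, hx₀.1⟩
  rw [h00] at h3
  exact norm_le_zero_iff.1 (h3.trans (mul_nonpos_of_nonpos_of_nonneg hs0 (Real.exp_pos _).le))

/-- Smooth functions need not belong to the domain, because Q is only integrable and Qy may fail to
be in L². If LY = 0, however, then L(φY) = -iB⁻¹φ'Y no longer contains Q, and φ(0) = φ(1) = 0
settles the boundary conditions. -/
theorem mem_domain_of_bump {b : Fin n → ℂ} (hb : ∀ j, b j ≠ 0)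
    {Q : ℝ → Matrix (Fin n) (Fin n) ℂ}
    (hQ : ∀ j k, IntegrableOn (fun x => Q x j k) (Icc (0 : ℝ) 1))
    (C D : Matrix (Fin n) (Fin n) ℂ) {Y : Path n} {c : EuclideanSpace ℂ (Fin n)}
    (hY : ∀ x ∈ Icc (0 : ℝ) 1, ext Y x = c + ∫ t in (0 : ℝ)..x, mv (potMat b Q t) (ext Y t))
    {φ : ℝ → ℝ} (hφ : ContDiff ℝ 1 φ) (h0 : φ 0 = 0) (h1 : φ 1 = 0) :
    ∃ f : L2 n, f ∈ (bvpOperator b Q C D).domain ∧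
      f =ᵐ[volume.restrict (Icc (0 : ℝ) 1)] fun x => φ x • ext Y x := by
  have hint := integrable_mv (integrable_potMat (b := b) hQ) (continuous_ext Y).continuousOn
  set y₀ : ℝ → EuclideanSpace ℂ (Fin n) :=
    fun x => c + ∫ t in (0 : ℝ)..x, mv (potMat b Q t) (ext Y t) with hy₀
  have hcφ : Continuous φ := hφ.continuous
  have hcd : Continuous (deriv φ) := hφ.continuous_deriv le_rfl
  have hYc := continuous_ext Y
  have hbdd : ∀ {ψ : ℝ → ℝ}, Continuous ψ →
      MemLp (fun x => ψ x • ext Y x) 2 (volume.restrict (Icc (0 : ℝ) 1)) := by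
    intro ψ hψ
    have hcont : Continuous fun x => ψ x • ext Y x := hψ.smul hYc
    obtain ⟨B, hB⟩ := isCompact_Icc.exists_bound_of_continuousOn (s := Icc (0 : ℝ) 1)
      hcont.continuousOn
    refine MemLp.of_bound hcont.aestronglyMeasurable B ?_
    filter_upwards [ae_restrict_mem measurableSet_Icc] with x hx using hB x hx
  have hf := hbdd hcφ
  have hg₀ := hbdd hcd
  have hg : MemLp (fun x => mv (Matrix.diagonal fun j => -Complex.I * (b j)⁻¹)
      (deriv φ x • ext Y x)) 2 (volume.restrict (Icc (0 : ℝ) 1)) := by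
    have := (LinearMap.toContinuousLinearMap (Matrix.toEuclideanLin
      (Matrix.diagonal fun j => -Complex.I * (b j)⁻¹))).comp_memLp' hg₀
    exact this
  refine ⟨hf.toLp _, ?_, hf.coeFn_toLp⟩
  refine LinearPMap.mem_domain_of_mem_graph (y := hg.toLp _) ?_
  rw [bvpOperator_graph]
  refine ⟨fun x => φ x • y₀ x, ?_, ?_, ?_, ?_⟩
  · exact hφ.contDiffOn.absolutelyContinuousOnInterval.smul
      (absolutelyContinuous_primitive hint c)
  · simp [h0, h1]
  · refine hf.coeFn_toLp.trans ?_
    filter_upwards [ae_restrict_mem measurableSet_Icc] with x hx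
    rw [hY x hx]
  · refine hg.coeFn_toLp.trans ?_
    filter_upwards [ae_restrict_mem measurableSet_Icc, ae_hasDerivAt_primitive hint c]
      with x hx hd
    rw [eq_diffExpr_iff hb]
    have h2 := ((hφ.differentiable one_ne_zero x).hasDerivAt.smul hd).deriv
    have h3 : deriv (fun x => φ x • y₀ x) x = _ := h2
    rw [h3, ← hY x hx, mv_real_smul]
    have hyx : y₀ x = ext Y x := (hY x hx).symm
    rw [hyx]
    congr 1
    ext j
    have := hb j
    rw [mv_diagI_apply, mv_apply]
    simp only [Matrix.diagonal_apply, ite_mul, zero_mul, Finset.sum_ite_eq, Finset.mem_univ,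
      if_true]
    field_simp
    linear_combination (deriv φ x • ext Y x).ofLp j * Complex.I_sq

/-- A vector h orthogonal to the domain is orthogonal to φY for every bump function φ and every
solution of LY = 0. By the fundamental lemma of the calculus of variations ⟨Y(x), h(x)⟩ = 0 almost
everywhere, and the values Y(x) of the solutions span ℂⁿ. -/
theorem dense_domain {b : Fin n → ℂ} (hb : ∀ j, b j ≠ 0)
    {Q : ℝ → Matrix (Fin n) (Fin n) ℂ}
    (hQ : ∀ j k, IntegrableOn (fun x => Q x j k) (Icc (0 : ℝ) 1))
    (C D : Matrix (Fin n) (Fin n) ℂ) : Dense ((bvpOperator b Q C D).domain : Set (L2 n)) := by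
  rw [Submodule.dense_iff_topologicalClosure_eq_top, Submodule.topologicalClosure_eq_top_iff,
    Submodule.eq_bot_iff]
  intro h hh
  set P := bvpModel hb hQ C D
  set Φ : (Fin n → ℂ) →ₗ[ℂ] Path n := ((P.sol 0) ∘L (cstL n)).toLinearMap with hΦ
  have hsol : ∀ c, ∀ x ∈ Icc (0 : ℝ) 1, ext (Φ c) x = WithLp.toLp 2 c +
      ∫ t in (0 : ℝ)..x, mv (potMat b Q t) (ext (Φ c) t) := by
    intro c x hx
    have h1 : Φ c = cstL n c + P.pot (Φ c) + (0 : ℂ) • P.prim (P.emb (Φ c)) :=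
      P.eq_sol_iff.2 rfl
    have h3 : ∀ v : Path n, (0 : ℂ) • v = 0 := fun v => by
      ext1 t; exact zero_smul ℂ (v t)
    have h2 := DFunLike.congr_fun (h1.trans ((congrArg _ (h3 _)).trans (add_zero _))) ⟨x, hx⟩
    rw [ext_of_mem _ hx, h2]
    rfl
  have horth : ∀ c, ∀ᵐ x ∂(volume.restrict (Icc (0 : ℝ) 1)), inner ℂ (ext (Φ c) x) (h x) = 0 := by
    intro c
    have hloc : IntegrableOn (fun x => inner ℂ (ext (Φ c) x) (h x)) (Icc (0 : ℝ) 1) := by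
      refine Integrable.mono' ((integrableOn_L2 h).norm.const_mul ‖Φ c‖)
        ((continuous_ext _).aestronglyMeasurable.inner (integrableOn_L2 h).1)
        (Eventually.of_forall fun x => ?_)
      exact (norm_inner_le_norm _ _).trans
        (mul_le_mul_of_nonneg_right (norm_ext_le _ _) (norm_nonneg _))
    have hae := isOpen_Ioo.ae_eq_zero_of_integral_contDiff_smul_eq_zero (U := Ioo (0 : ℝ) 1)
      (hloc.mono_set Ioo_subset_Icc_self).locallyIntegrableOn (fun φ hφ _ hsupp => by
        have hout : ∀ x, x ∉ Ioo (0 : ℝ) 1 → φ x = 0 := fun x hx =>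
          image_eq_zero_of_notMem_tsupport fun hx' => hx (hsupp hx')
        obtain ⟨f, hf, hfe⟩ := mem_domain_of_bump hb hQ C D (hsol c)
          (hφ.of_le (by exact_mod_cast le_top)) (hout 0 (by simp)) (hout 1 (by simp))
        have h1 : inner ℂ f h = 0 := (Submodule.mem_orthogonal _ _).1 hh f hf
        rw [L2.inner_def] at h1
        rw [← setIntegral_eq_integral_of_forall_compl_eq_zero (s := Icc (0 : ℝ) 1), ← h1]
        · refine integral_congr_ae ?_
          filter_upwards [hfe] with x hx
          rw [hx, ← Complex.coe_smul (φ x) (ext (Φ c) x), inner_smul_left, Complex.conj_ofReal]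
          exact Complex.real_smul
        · intro x hx
          rw [hout x fun h' => hx (Ioo_subset_Icc_self h'), zero_smul])
    rw [ae_restrict_iff' measurableSet_Icc]
    have hz : ∀ᵐ x : ℝ ∂volume, x ≠ 0 := by simp [ae_iff]
    have ho : ∀ᵐ x : ℝ ∂volume, x ≠ 1 := by simp [ae_iff]
    filter_upwards [hae, hz, ho] with x h1 h2 h3 h4
    exact h1 ⟨lt_of_le_of_ne h4.1 (Ne.symm h2), lt_of_le_of_ne h4.2 h3⟩
  have hall : ∀ᵐ x ∂(volume.restrict (Icc (0 : ℝ) 1)), ∀ j : Fin n,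
      inner ℂ (ext (Φ (Pi.single j 1)) x) (h x) = 0 :=
    ae_all_iff.2 fun j => horth _
  apply Lp.ext
  filter_upwards [hall, Lp.coeFn_zero (EuclideanSpace ℂ (Fin n)) 2
    (volume.restrict (Icc (0 : ℝ) 1)), ae_restrict_mem measurableSet_Icc] with x h1 h2 hx
  rw [h2]
  -- The fundamental matrix at x, from initial values to values. It is injective by backward
  -- uniqueness, hence surjective, so h(x) is the value of some solution.
  let T : (Fin n → ℂ) →ₗ[ℂ] (Fin n → ℂ) :=
    { toFun := fun c => ⇑(Φ c ⟨x, hx⟩)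
      map_add' := fun c d => by rw [map_add]; rfl
      map_smul' := fun a d => by rw [map_smul]; rfl }
  have hTinj : Function.Injective T := by
    rw [← LinearMap.ker_eq_bot, LinearMap.ker_eq_bot']
    intro c hc
    have h3 : ext (Φ c) x = 0 := by
      rw [ext_of_mem _ hx]
      exact (WithLp.ofLp_injective 2) hc
    have h4 := eq_zero_of_backward (integrable_potMat hQ) (hsol c) hx h3
    exact (WithLp.toLp_injective 2) h4
  obtain ⟨c, hc⟩ := (LinearMap.injective_iff_surjective.1 hTinj) ⇑(h x)
  have h5 : ext (Φ c) x = h x := by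
    rw [ext_of_mem _ hx]
    exact (WithLp.ofLp_injective 2) hc
  have h6 : ext (Φ c) x = ∑ j, c j • ext (Φ (Pi.single j 1)) x := by
    simp only [ext_of_mem _ hx]
    conv_lhs => rw [pi_eq_sum_univ' c]
    rw [map_sum, ContinuousMap.coe_sum, Finset.sum_apply]
    simp only [map_smul, ContinuousMap.smul_apply]
  have h7 : inner ℂ (h x) (h x) = 0 := by
    nth_rewrite 1 [← h5]
    rw [h6, sum_inner]
    exact Finset.sum_eq_zero fun j _ => by rw [inner_smul_left, h1 j, mul_zero]
  exact inner_self_eq_zero.1 h7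

end Dense

end BVP
end

noncomputable section
namespace BVP

/-! ### Integrals against exponential kernels -/

section KernelIntegrals

/-- The integral of `h` over `[0,1]` against the kernel `exp (-d |x - t|)`. -/
def kerInt (d x : ℝ) (h : ℝ → ℝ) : ℝ := ∫ t in Icc (0 : ℝ) 1, Real.exp (-d * |x - t|) * h t

theorem kerInt_nonneg {d x : ℝ} {h : ℝ → ℝ} (h0 : ∀ t, 0 ≤ h t) : 0 ≤ kerInt d x h :=
  integral_nonneg fun t => mul_nonneg (Real.exp_pos _).le (h0 t)

theorem kerInt_mono {d x : ℝ} {h k : ℝ → ℝ} (hh : IntegrableOn h (Icc (0 : ℝ) 1))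
    (hk : IntegrableOn k (Icc (0 : ℝ) 1)) (hle : ∀ t ∈ Icc (0 : ℝ) 1, h t ≤ k t) :
    kerInt d x h ≤ kerInt d x k :=
  setIntegral_mono_on (integrableOn_exp_mul hh d x) (integrableOn_exp_mul hk d x)
    measurableSet_Icc fun t ht => mul_le_mul_of_nonneg_left (hle t ht) (Real.exp_pos _).le

theorem kerInt_add {d x : ℝ} {h k : ℝ → ℝ} (hh : IntegrableOn h (Icc (0 : ℝ) 1))
    (hk : IntegrableOn k (Icc (0 : ℝ) 1)) :
    kerInt d x (fun t => h t + k t) = kerInt d x h + kerInt d x k := by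
  rw [kerInt, kerInt, kerInt,
    ← integral_add (integrableOn_exp_mul hh d x) (integrableOn_exp_mul hk d x)]
  simp only [mul_add]

theorem kerInt_const_mul (d x c : ℝ) (h : ℝ → ℝ) :
    kerInt d x (fun t => c * h t) = c * kerInt d x h := by
  rw [kerInt, kerInt, ← integral_const_mul]
  congr 1; funext t; ring

theorem kerInt_sum {ι : Type*} (s : Finset ι) {d x : ℝ} {h : ι → ℝ → ℝ}
    (hh : ∀ i ∈ s, IntegrableOn (h i) (Icc (0 : ℝ) 1)) :
    kerInt d x (fun t => ∑ i ∈ s, h i t) = ∑ i ∈ s, kerInt d x (h i) := by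
  simp only [kerInt, Finset.mul_sum]
  exact integral_finsetSum _ fun i hi => integrableOn_exp_mul (hh i hi) d x

theorem kerInt_le_integral {d x : ℝ} (hd : 0 ≤ d) {h : ℝ → ℝ} (hh : IntegrableOn h (Icc (0 : ℝ) 1))
    (h0 : ∀ t, 0 ≤ h t) : kerInt d x h ≤ ∫ t in Icc (0 : ℝ) 1, h t := by
  refine integral_mono (integrableOn_exp_mul hh d x) hh fun t => ?_
  exact mul_le_of_le_one_left (h0 t) (Real.exp_le_one_iff.2 (by nlinarith [abs_nonneg (x - t)]))

theorem kerInt_antitone {d d' x : ℝ} (hd : d ≤ d') {h : ℝ → ℝ}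
    (hh : IntegrableOn h (Icc (0 : ℝ) 1)) (h0 : ∀ t, 0 ≤ h t) : kerInt d' x h ≤ kerInt d x h := by
  refine integral_mono (integrableOn_exp_mul hh d' x) (integrableOn_exp_mul hh d x) fun t => ?_
  refine mul_le_mul_of_nonneg_right (Real.exp_le_exp.2 ?_) (h0 t)
  nlinarith [abs_nonneg (x - t)]

/-- A weight which does not vary faster than the kernel may be taken out of the integral. -/
theorem kerInt_mul_weight_le {d x : ℝ} {N W : ℝ → ℝ} (hN : IntegrableOn N (Icc (0 : ℝ) 1))
    (hN0 : ∀ t, 0 ≤ N t) (hW : Continuous W)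
    (hWt : ∀ t ∈ Icc (0 : ℝ) 1, W t ≤ Real.exp (d * |x - t|) * W x) :
    kerInt (2 * d) x (fun t => N t * W t) ≤ W x * kerInt d x N := by
  rw [← kerInt_const_mul]
  refine setIntegral_mono_on
    (integrableOn_exp_mul (hN.mul_continuousOn hW.continuousOn isCompact_Icc) _ x)
    (integrableOn_exp_mul (hN.const_mul _) d x) measurableSet_Icc fun t ht => ?_
  calc Real.exp (-(2 * d) * |x - t|) * (N t * W t)
      ≤ Real.exp (-(2 * d) * |x - t|) * (N t * (Real.exp (d * |x - t|) * W x)) := by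
        have := hWt t ht
        have := hN0 t
        gcongr
    _ = (Real.exp (-(2 * d) * |x - t|) * Real.exp (d * |x - t|)) * (W x * N t) := by ring
    _ = Real.exp (-d * |x - t|) * (W x * N t) := by
        rw [← Real.exp_add]; congr 2; ring

/-- A Gronwall type lemma for small exponential kernels. -/
theorem le_two_mul_of_le_add_kerInt {d : ℝ} {u W N : ℝ → ℝ} (hd : 0 ≤ d) (hu : Continuous u)
    (hu0 : ∀ x, 0 ≤ u x) (hW : Continuous W) (hW0 : ∀ x, 0 ≤ W x)
    (hWt : ∀ x ∈ Icc (0 : ℝ) 1, ∀ t ∈ Icc (0 : ℝ) 1, W t ≤ Real.exp (d * |x - t|) * W x)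
    (hN : IntegrableOn N (Icc (0 : ℝ) 1)) (hN0 : ∀ t, 0 ≤ N t)
    (hκ : ∀ x, kerInt d x N ≤ 1 / 2)
    (h : ∀ x ∈ Icc (0 : ℝ) 1, u x ≤ W x + kerInt (2 * d) x (fun t => N t * u t))
    {x : ℝ} (hx : x ∈ Icc (0 : ℝ) 1) : u x ≤ 2 * W x := by
  refine le_of_forall_pos_le_add fun ε hε => ?_
  -- The summand makes the weight strictly positive, so that the maximum M of u / w exists. The
  -- hypothesis at the maximum gives M ≤ 1 + M/2.
  set w : ℝ → ℝ := fun x => W x + ε / 2 with hw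
  have hwc : Continuous w := by fun_prop
  have hw0 : ∀ x, 0 < w x := fun x => by have := hW0 x; simp only [hw]; positivity
  have hc : Continuous fun x => u x / w x := hu.div₀ hwc fun x => (hw0 x).ne'
  obtain ⟨m, hm, hmax⟩ := isCompact_Icc.exists_isMaxOn (nonempty_Icc.2 zero_le_one) hc.continuousOn
  set M := u m / w m with hM
  have hM0 : 0 ≤ M := div_nonneg (hu0 m) (hw0 m).le
  have hle : ∀ t ∈ Icc (0 : ℝ) 1, u t ≤ M * w t := fun t ht =>
    (div_le_iff₀ (hw0 t)).1 (hmax ht)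
  have h1 : kerInt (2 * d) m (fun t => N t * u t) ≤ M * (w m * (1 / 2)) := by
    calc kerInt (2 * d) m (fun t => N t * u t)
        ≤ kerInt (2 * d) m (fun t => M * (N t * w t)) := by
          refine kerInt_mono (hN.mul_continuousOn hu.continuousOn isCompact_Icc)
            ((hN.mul_continuousOn hwc.continuousOn isCompact_Icc).const_mul _) fun t ht => ?_
          nlinarith [mul_le_mul_of_nonneg_left (hle t ht) (hN0 t)]
      _ = M * kerInt (2 * d) m (fun t => N t * w t) := kerInt_const_mul _ _ _ _
      _ ≤ M * (w m * kerInt d m N) := by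
          refine mul_le_mul_of_nonneg_left (kerInt_mul_weight_le hN hN0 hwc fun t ht => ?_) hM0
          have h2 := hWt m hm t ht
          have h3 : 1 ≤ Real.exp (d * |m - t|) := Real.one_le_exp (by positivity)
          simp only [hw, mul_add]
          nlinarith
      _ ≤ M * (w m * (1 / 2)) := by
          have := hκ m
          have := hw0 m
          gcongr
  have h2 : M ≤ 2 := by
    have h3 := h m hm
    have h4 : u m = M * w m := by rw [hM, div_mul_cancel₀ _ (hw0 m).ne']
    have h5 : M * w m ≤ w m + M * (w m * (1 / 2)) := by
      rw [← h4]
      have : W m ≤ w m := by simp only [hw]; linarith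
      linarith
    have h6 : (M - 2) * w m ≤ 0 := by nlinarith
    nlinarith [hw0 m]
  calc u x ≤ M * w x := hle x hx
    _ ≤ 2 * w x := mul_le_mul_of_nonneg_right h2 (hw0 x).le
    _ = 2 * W x + ε := by simp only [hw]; ring

end KernelIntegrals

/-! ### Laplace type integrals -/

section Laplace

theorem integral_exp_neg_le {d : ℝ} (hd : 0 < d) :
    ∫ t in Icc (0 : ℝ) 1, Real.exp (-(d * t)) ≤ 1 / d := by
  rw [integral_Icc_eq_integral_Ioc, ← intervalIntegral.integral_of_le zero_le_one]
  have h : ∀ t ∈ uIcc (0 : ℝ) 1, HasDerivAt (fun t => -Real.exp (-(d * t)) / d)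
      (Real.exp (-(d * t))) t := by
    intro t _
    have h1 : HasDerivAt (fun t => -(d * t)) (-d) t := by
      simpa using (hasDerivAt_id t).const_mul (-d)
    have := h1.exp.neg.div_const d
    rwa [mul_neg, neg_neg, mul_div_cancel_right₀ _ hd.ne'] at this
  rw [intervalIntegral.integral_eq_sub_of_hasDerivAt h
    ((by fun_prop : Continuous fun t => Real.exp (-(d * t))).intervalIntegrable _ _)]
  simp only [mul_zero, neg_zero, Real.exp_zero, mul_one]
  have : 0 ≤ Real.exp (-d) / d := by positivity
  have h2 : -Real.exp (-d) / d - -1 / d = 1 / d - Real.exp (-d) / d := by ring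
  rw [h2]; linarith

theorem integrableOn_exp_neg_mul {f : ℝ → ℝ} (hf : IntegrableOn f (Icc (0 : ℝ) 1)) (d : ℝ) :
    IntegrableOn (fun t => Real.exp (-(d * t)) * f t) (Icc (0 : ℝ) 1) :=
  hf.continuousOn_mul (by fun_prop) isCompact_Icc

theorem tendsto_mul_exp_neg {d : ℝ} (hd : 0 < d) (c : ℝ) :
    Tendsto (fun r : ℝ => r * (Real.exp (-(r * d)) * c)) atTop (𝓝 0) := by
  have h1 := (Real.tendsto_pow_mul_exp_neg_atTop_nhds_zero 1).comp
    (tendsto_id.atTop_mul_const hd)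
  have h2 := h1.const_mul (c / d)
  rw [mul_zero] at h2
  refine h2.congr fun r => ?_
  simp only [Function.comp_apply, id, pow_one]
  field_simp

/-- Near 0 the function f is small while r times the integral of exp(-rdt) is at most 1/d; away from
0 the factor r exp(-rdη) defeats any integrable f. -/
theorem tendsto_laplace_zero {f : ℝ → ℝ} (hf : IntegrableOn f (Icc (0 : ℝ) 1))
    (h0 : ∀ t, 0 ≤ f t) (hc : ContinuousWithinAt f (Icc (0 : ℝ) 1) 0) (hf0 : f 0 = 0)
    {d : ℝ} (hd : 0 < d) :
    Tendsto (fun r : ℝ => r * ∫ t in Icc (0 : ℝ) 1, Real.exp (-(r * d * t)) * f t)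
      atTop (𝓝 0) := by
  rw [Metric.tendsto_nhds]
  intro ε hε
  have hev : ∀ᶠ t in 𝓝[Icc (0 : ℝ) 1] 0, f t < ε * d / 4 := by
    have : f 0 < ε * d / 4 := by rw [hf0]; positivity
    exact hc.eventually_lt_const this
  obtain ⟨η, hη, hball⟩ := Metric.mem_nhdsWithin_iff.1 hev
  set I := ∫ t in Icc (0 : ℝ) 1, f t with hI
  have hI0 : 0 ≤ I := integral_nonneg h0
  have hlim := tendsto_mul_exp_neg (mul_pos hd hη) I
  filter_upwards [hlim.eventually_lt_const (half_pos hε), eventually_gt_atTop 0] with r h1 hr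
  have hnn : 0 ≤ r * ∫ t in Icc (0 : ℝ) 1, Real.exp (-(r * d * t)) * f t :=
    mul_nonneg hr.le (integral_nonneg fun t => mul_nonneg (Real.exp_pos _).le (h0 t))
  rw [dist_zero_right, Real.norm_of_nonneg hnn]
  have hE : IntegrableOn (fun t => Real.exp (-(r * d * t))) (Icc (0 : ℝ) 1) :=
    (by fun_prop : Continuous fun t => Real.exp (-(r * d * t))).integrableOn_Icc
  have hle : ∫ t in Icc (0 : ℝ) 1, Real.exp (-(r * d * t)) * f t
      ≤ ε * d / 4 * (1 / (r * d)) + Real.exp (-(r * (d * η))) * I := by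
    calc ∫ t in Icc (0 : ℝ) 1, Real.exp (-(r * d * t)) * f t
        ≤ ∫ t in Icc (0 : ℝ) 1, (ε * d / 4 * Real.exp (-(r * d * t))
            + Real.exp (-(r * (d * η))) * f t) := by
          refine setIntegral_mono_on (integrableOn_exp_neg_mul hf _)
            ((hE.const_mul _).add (hf.const_mul _)) measurableSet_Icc fun t ht => ?_
          have hp := Real.exp_pos (-(r * d * t))
          have hp' := Real.exp_pos (-(r * (d * η)))
          by_cases htη : t < η
          · have h2 : f t < ε * d / 4 := hball ⟨by
              rw [Metric.mem_ball, dist_zero_right, Real.norm_of_nonneg ht.1]; exact htη, ht⟩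
            nlinarith [mul_nonneg hp'.le (h0 t)]
          · have h3 : Real.exp (-(r * d * t)) ≤ Real.exp (-(r * (d * η))) := by
              apply Real.exp_le_exp.2
              push Not at htη
              nlinarith [mul_le_mul_of_nonneg_left htη (mul_pos hr hd).le]
            have h4 := mul_le_mul_of_nonneg_right h3 (h0 t)
            have : 0 ≤ ε * d / 4 * Real.exp (-(r * d * t)) := by positivity
            linarith
      _ = ε * d / 4 * (∫ t in Icc (0 : ℝ) 1, Real.exp (-(r * d * t)))
            + Real.exp (-(r * (d * η))) * I := by
          rw [integral_add (hE.const_mul _) (hf.const_mul _), integral_const_mul,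
            integral_const_mul]
      _ ≤ _ := by
          have := integral_exp_neg_le (mul_pos hr hd)
          gcongr
  calc r * ∫ t in Icc (0 : ℝ) 1, Real.exp (-(r * d * t)) * f t
      ≤ r * (ε * d / 4 * (1 / (r * d)) + Real.exp (-(r * (d * η))) * I) :=
        mul_le_mul_of_nonneg_left hle hr.le
    _ = ε / 4 + r * (Real.exp (-(r * (d * η))) * I) := by field_simp
    _ < ε := by linarith

theorem exists_laplace_le {q : ℝ → ℂ} (hq : IntegrableOn q (Icc (0 : ℝ) 1))
    (hc : ContinuousWithinAt q (Icc (0 : ℝ) 1) 0) {d : ℝ} (hd : 0 < d) :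
    ∃ C, 0 ≤ C ∧ ∀ᶠ r : ℝ in atTop,
      ∫ t in Icc (0 : ℝ) 1, Real.exp (-(r * d * t)) * ‖q t‖ ≤ C / r := by
  have hq0 : IntegrableOn (fun t => ‖q t - q 0‖) (Icc (0 : ℝ) 1) :=
    (Integrable.sub hq (integrableOn_const (by simp))).norm
  have h1 := tendsto_laplace_zero hq0 (fun t => norm_nonneg _)
    ((hc.sub continuousWithinAt_const).norm) (by simp) hd
  refine ⟨1 + ‖q 0‖ / d, by positivity, ?_⟩
  filter_upwards [h1.eventually_lt_const one_pos, eventually_gt_atTop 0] with r h2 hr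
  have hE : IntegrableOn (fun t => Real.exp (-(r * d * t))) (Icc (0 : ℝ) 1) :=
    (by fun_prop : Continuous fun t => Real.exp (-(r * d * t))).integrableOn_Icc
  rw [le_div_iff₀ hr]
  have h3 : ∫ t in Icc (0 : ℝ) 1, Real.exp (-(r * d * t)) * ‖q t‖
      ≤ (∫ t in Icc (0 : ℝ) 1, Real.exp (-(r * d * t)) * ‖q t - q 0‖)
        + ‖q 0‖ * (1 / (r * d)) := by
    calc ∫ t in Icc (0 : ℝ) 1, Real.exp (-(r * d * t)) * ‖q t‖
        ≤ ∫ t in Icc (0 : ℝ) 1, (Real.exp (-(r * d * t)) * ‖q t - q 0‖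
            + ‖q 0‖ * Real.exp (-(r * d * t))) := by
          refine integral_mono (integrableOn_exp_neg_mul hq.norm _)
            ((integrableOn_exp_neg_mul hq0 _).add (hE.const_mul _)) fun t => ?_
          have h4 : ‖q t‖ ≤ ‖q t - q 0‖ + ‖q 0‖ := by
            simpa using norm_add_le (q t - q 0) (q 0)
          have := Real.exp_pos (-(r * d * t))
          show Real.exp (-(r * d * t)) * ‖q t‖ ≤ _
          nlinarith
      _ = (∫ t in Icc (0 : ℝ) 1, Real.exp (-(r * d * t)) * ‖q t - q 0‖)
            + ‖q 0‖ * ∫ t in Icc (0 : ℝ) 1, Real.exp (-(r * d * t)) := by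
          rw [integral_add (integrableOn_exp_neg_mul hq0 _) (hE.const_mul _), integral_const_mul]
      _ ≤ _ := by
          have := integral_exp_neg_le (mul_pos hr hd)
          gcongr
  calc (∫ t in Icc (0 : ℝ) 1, Real.exp (-(r * d * t)) * ‖q t‖) * r
      ≤ ((∫ t in Icc (0 : ℝ) 1, Real.exp (-(r * d * t)) * ‖q t - q 0‖)
        + ‖q 0‖ * (1 / (r * d))) * r := mul_le_mul_of_nonneg_right h3 hr.le
    _ = r * (∫ t in Icc (0 : ℝ) 1, Real.exp (-(r * d * t)) * ‖q t - q 0‖) + ‖q 0‖ / d := by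
        field_simp
    _ ≤ 1 + ‖q 0‖ / d := by linarith

theorem norm_cexp_neg_mul (r t : ℝ) (c : ℂ) :
    ‖Complex.exp (-(r * c * t))‖ = Real.exp (-(r * c.re * t)) := by
  rw [Complex.norm_exp]
  congr 1
  simp

/-- Watson's lemma to first order: q - q(0) contributes o(1/r), and the constant q(0) is integrated
explicitly. -/
theorem tendsto_laplace {q : ℝ → ℂ} (hq : IntegrableOn q (Icc (0 : ℝ) 1))
    (hc : ContinuousWithinAt q (Icc (0 : ℝ) 1) 0) {c : ℂ} (hd : 0 < c.re) :
    Tendsto (fun r : ℝ => r * ∫ t in Icc (0 : ℝ) 1, Complex.exp (-(r * c * t)) * q t)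
      atTop (𝓝 (q 0 / c)) := by
  have hc0 : c ≠ 0 := fun h => by simp [h] at hd
  have hq' : IntegrableOn (fun t => q t - q 0) (Icc (0 : ℝ) 1) :=
    Integrable.sub hq (integrableOn_const (by simp))
  have h1 := tendsto_laplace_zero hq'.norm (fun t => norm_nonneg _)
    ((hc.sub continuousWithinAt_const).norm) (by simp) hd
  have h2 : Tendsto (fun r : ℝ => r * ∫ t in Icc (0 : ℝ) 1, Complex.exp (-(r * c * t))
      * (q t - q 0)) atTop (𝓝 0) := by
    refine squeeze_zero_norm' ?_ h1
    filter_upwards [eventually_ge_atTop 0] with r hr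
    rw [norm_mul, Complex.norm_real, Real.norm_of_nonneg hr]
    refine mul_le_mul_of_nonneg_left ((norm_integral_le_integral_norm _).trans (le_of_eq ?_)) hr
    simp only [norm_mul, norm_cexp_neg_mul]
  have h3 : Tendsto (fun r : ℝ => q 0 / c - q 0 / c * Complex.exp (-(r * c))) atTop
      (𝓝 (q 0 / c)) := by
    have h4 : Tendsto (fun r : ℝ => Complex.exp (-(r * c))) atTop (𝓝 0) := by
      rw [tendsto_zero_iff_norm_tendsto_zero]
      have h5 : Tendsto (fun r : ℝ => Real.exp (-(r * c.re))) atTop (𝓝 0) :=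
        Real.tendsto_exp_neg_atTop_nhds_zero.comp (tendsto_id.atTop_mul_const hd)
      refine h5.congr fun r => ?_
      have := norm_cexp_neg_mul r 1 c
      simp only [Complex.ofReal_one, mul_one] at this
      exact this.symm
    simpa using (h4.const_mul (q 0 / c)).const_sub (q 0 / c)
  have h6 := h2.add h3
  rw [zero_add] at h6
  refine h6.congr' ?_
  filter_upwards [eventually_gt_atTop 0] with r hr
  have hr' : (r : ℂ) ≠ 0 := by exact_mod_cast hr.ne'
  have hE : Continuous fun t : ℝ => Complex.exp (-(r * c * t)) := by fun_prop
  have hi1 : IntegrableOn (fun t : ℝ => Complex.exp (-(r * c * t)) * (q t - q 0))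
      (Icc (0 : ℝ) 1) := hq'.continuousOn_mul hE.continuousOn isCompact_Icc
  have hi2 : IntegrableOn (fun t : ℝ => Complex.exp (-(r * c * t)) * q 0) (Icc (0 : ℝ) 1) :=
    (hE.mul continuous_const).integrableOn_Icc
  have h7 : ∫ t in Icc (0 : ℝ) 1, Complex.exp (-(r * c * t)) * q 0
      = (q 0 / c - q 0 / c * Complex.exp (-(r * c))) / r := by
    rw [integral_Icc_eq_integral_Ioc, ← intervalIntegral.integral_of_le zero_le_one,
      intervalIntegral.integral_mul_const]
    have h8 : ∀ t : ℝ, Complex.exp (-(r * c * t)) = Complex.exp ((-(r * c)) * t) := fun t => by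
      rw [neg_mul]
    simp only [h8]
    rw [integral_exp_mul_complex (neg_ne_zero.2 (mul_ne_zero hr' hc0))]
    simp only [Complex.ofReal_one, mul_one, Complex.ofReal_zero, mul_zero, Complex.exp_zero]
    field_simp
    ring
  have h9 : ∫ t in Icc (0 : ℝ) 1, Complex.exp (-(r * c * t)) * q t
      = (∫ t in Icc (0 : ℝ) 1, Complex.exp (-(r * c * t)) * (q t - q 0))
        + ∫ t in Icc (0 : ℝ) 1, Complex.exp (-(r * c * t)) * q 0 := by
    rw [← integral_add hi1 hi2]
    congr 1; funext t; ring
  rw [h9, h7]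
  field_simp

end Laplace

/-! ### Variation of constants -/

section Variation

/-- The starting point s is free: s = 0 suits components that decay to the right, s = 1 those that
decay to the left, so the exponentials stay bounded. -/
theorem variation_of_constants {α : ℂ} {u p : ℝ → ℂ} (hu : Continuous u)
    (hp : IntegrableOn p (Icc (0 : ℝ) 1))
    (h : ∀ x ∈ Icc (0 : ℝ) 1, u x = u 0 + ∫ t in (0 : ℝ)..x, (α * u t + p t))
    {s x : ℝ} (hs : s ∈ Icc (0 : ℝ) 1) (hx : x ∈ Icc (0 : ℝ) 1) :
    u x = Complex.exp (α * (x - s)) * u s + ∫ t in s..x, Complex.exp (α * (x - t)) * p t := by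
  have hint : IntegrableOn (fun t => α * u t + p t) (Icc (0 : ℝ) 1) :=
    Integrable.add (hu.integrableOn_Icc.const_mul α) hp
  have hexp : ContDiff ℝ 1 fun x : ℝ => Complex.exp (-α * x) := by
    have : ContDiff ℝ 1 fun x : ℝ => (x : ℂ) := Complex.ofRealCLM.contDiff
    fun_prop
  have hac := hexp.contDiffOn (s := uIcc (0 : ℝ) 1) |>.absolutelyContinuousOnInterval.smul
    (absolutelyContinuous_primitive hint (u 0))
  have hpe : IntegrableOn (fun t : ℝ => Complex.exp (-α * t) * p t) (Icc (0 : ℝ) 1) :=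
    hp.continuousOn_mul (by fun_prop) isCompact_Icc
  have hz : (0 : ℝ) ∈ Icc (0 : ℝ) 1 := by simp
  have key : ∀ x ∈ Icc (0 : ℝ) 1, Complex.exp (-α * x) * u x
      = u 0 + ∫ t in (0 : ℝ)..x, Complex.exp (-α * t) * p t := by
    intro x hx
    have h1 := eq_add_integral_of_ae_hasDerivAt hac hpe (by
      filter_upwards [ae_hasDerivAt_primitive hint (u 0), ae_restrict_mem measurableSet_Icc]
        with t h2 ht
      have h3 : HasDerivAt (fun x : ℝ => Complex.exp (-α * x)) (Complex.exp (-α * t) * -α) t := by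
        have h4 : HasDerivAt (fun x : ℝ => -α * (x : ℂ)) (-α) t := by
          simpa using (Complex.ofRealCLM.hasDerivAt (x := t)).const_mul (-α)
        exact h4.cexp
      have h5 := h3.smul h2
      rw [← h t ht] at h5
      convert h5 using 1
      simp only [smul_eq_mul]
      ring) hx
    simp only [Pi.smul_apply', smul_eq_mul, ← h x hx] at h1
    simpa using h1
  have h1 := key x hx
  have h2 := key s hs
  have h3 : ∫ t in s..x, Complex.exp (α * (x - t)) * p t
      = Complex.exp (α * x) * ∫ t in s..x, Complex.exp (-α * t) * p t := by
    rw [← intervalIntegral.integral_const_mul]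
    congr 1; funext t
    rw [← mul_assoc, ← Complex.exp_add]
    congr 2; ring
  rw [h3, ← intervalIntegral.integral_interval_sub_left (intervalIntegrable_of_Icc hpe hz hx)
    (intervalIntegrable_of_Icc hpe hz hs), ← sub_eq_of_eq_add' h1, ← sub_eq_of_eq_add' h2]
  have h4 : Complex.exp (α * x) * Complex.exp (-α * x) = 1 := by
    rw [← Complex.exp_add]; simp
  have h5 : Complex.exp (α * x) * Complex.exp (-α * s) = Complex.exp (α * (x - s)) := by
    rw [← Complex.exp_add]; congr 1; ring
  linear_combination (-u x) * h4 + u s * h5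

theorem norm_integral_exp_le_kerInt {α : ℂ} {p : ℝ → ℂ} (hp : IntegrableOn p (Icc (0 : ℝ) 1))
    {d s x y : ℝ} (hs : s ∈ Icc (0 : ℝ) 1) (hx : x ∈ Icc (0 : ℝ) 1) (hsx : s ≤ x)
    (hα : ∀ t ∈ Icc s x, (α * (y - t)).re ≤ -d * |y - t|) :
    ‖∫ t in s..x, Complex.exp (α * (y - t)) * p t‖ ≤ kerInt d y (fun t => ‖p t‖) := by
  have hi := integrableOn_exp_mul hp.norm d y
  have h1 : ‖∫ t in s..x, Complex.exp (α * (y - t)) * p t‖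
      ≤ ∫ t in s..x, Real.exp (-d * |y - t|) * ‖p t‖ := by
    refine intervalIntegral.norm_integral_le_of_norm_le hsx ?_ (intervalIntegrable_of_Icc hi hs hx)
    refine Eventually.of_forall fun t ht => ?_
    rw [norm_mul, Complex.norm_exp]
    exact mul_le_mul_of_nonneg_right (Real.exp_le_exp.2 (hα t ⟨ht.1.le, ht.2⟩)) (norm_nonneg _)
  refine h1.trans ?_
  rw [intervalIntegral.integral_of_le hsx]
  exact setIntegral_mono_set hi (Eventually.of_forall fun t => by positivity)
    (LE.le.eventuallyLE fun t ht => ⟨hs.1.trans ht.1.le, ht.2.trans hx.2⟩)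

end Variation

end BVP
end

noncomputable section
namespace BVP

/-! ### First order systems with a large parameter -/

section RaySol

variable {n : ℕ}

/-- The right-hand side `V y + f` of a first order system. -/
def sysRhs (V : ℝ → Matrix (Fin n) (Fin n) ℂ) (y f : Fin n → ℝ → ℂ) (j : Fin n) (t : ℝ) : ℂ :=
  ∑ k, V t j k * y k t + f j t

/-- `y` is a solution on `[0,1]` of the system `y' = r diag(a) y + V y + f`. -/
structure RaySol (a : Fin n → ℂ) (V : ℝ → Matrix (Fin n) (Fin n) ℂ) (r : ℝ)
    (y f : Fin n → ℝ → ℂ) : Prop where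
  continuous : ∀ j, Continuous (y j)
  integrable : ∀ j, IntegrableOn (f j) (Icc (0 : ℝ) 1)
  eq : ∀ j, ∀ x ∈ Icc (0 : ℝ) 1,
    y j x = y j 0 + ∫ t in (0 : ℝ)..x, (r * a j * y j t + sysRhs V y f j t)

/-- The value of the `j`th component at the end point from which it decays. -/
def endVal (a : Fin n → ℂ) (y : Fin n → ℝ → ℂ) (j : Fin n) : ℂ :=
  if (a j).re < 0 then y j 0 else y j 1

/-- The sum of the `L¹` norms of the components. -/
def sumL1 (f : Fin n → ℝ → ℂ) : ℝ := ∑ j, ∫ t in Icc (0 : ℝ) 1, ‖f j t‖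

theorem sumL1_nonneg (f : Fin n → ℝ → ℂ) : 0 ≤ sumL1 f :=
  Finset.sum_nonneg fun _ _ => integral_nonneg fun _ => norm_nonneg _

/-- The weight `A₁ exp (-d x) + A₂ exp (-d (1 - x)) + B`. -/
def weight (d A₁ A₂ B x : ℝ) : ℝ :=
  A₁ * Real.exp (-(d * x)) + A₂ * Real.exp (-(d * (1 - x))) + B

theorem continuous_weight (d A₁ A₂ B : ℝ) : Continuous (weight d A₁ A₂ B) := by
  unfold weight; fun_prop

theorem weight_nonneg {d A₁ A₂ B : ℝ} (h1 : 0 ≤ A₁) (h2 : 0 ≤ A₂) (h3 : 0 ≤ B) (x : ℝ) :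
    0 ≤ weight d A₁ A₂ B x := by
  unfold weight; positivity

theorem weight_le {d A₁ A₂ B : ℝ} (hd : 0 ≤ d) (h1 : 0 ≤ A₁) (h2 : 0 ≤ A₂) (h3 : 0 ≤ B) (x t : ℝ) :
    weight d A₁ A₂ B t ≤ Real.exp (d * |x - t|) * weight d A₁ A₂ B x := by
  have e1 : Real.exp (-(d * t)) ≤ Real.exp (d * |x - t|) * Real.exp (-(d * x)) := by
    rw [← Real.exp_add]
    exact Real.exp_le_exp.2 (by nlinarith [le_abs_self (x - t)])
  have e2 : Real.exp (-(d * (1 - t))) ≤ Real.exp (d * |x - t|) * Real.exp (-(d * (1 - x))) := by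
    rw [← Real.exp_add]
    exact Real.exp_le_exp.2 (by nlinarith [neg_abs_le (x - t)])
  have e3 : 1 ≤ Real.exp (d * |x - t|) := Real.one_le_exp (by positivity)
  unfold weight
  nlinarith [mul_le_mul_of_nonneg_left e1 h1, mul_le_mul_of_nonneg_left e2 h2,
    mul_le_mul_of_nonneg_left e3 h3]

theorem kerInt_mul_weight {d A₁ A₂ B : ℝ} (hd : 0 ≤ d) (h1 : 0 ≤ A₁) (h2 : 0 ≤ A₂) (h3 : 0 ≤ B)
    {N : ℝ → ℝ} (hN : IntegrableOn N (Icc (0 : ℝ) 1)) (hN0 : ∀ t, 0 ≤ N t) (x : ℝ) :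
    kerInt (2 * d) x (fun t => N t * weight d A₁ A₂ B t) ≤ weight d A₁ A₂ B x * kerInt d x N :=
  kerInt_mul_weight_le hN hN0 (continuous_weight _ _ _ _) fun t _ => weight_le hd h1 h2 h3 x t

theorem kerInt_zero_eq (d : ℝ) (h : ℝ → ℝ) :
    kerInt d 0 h = ∫ t in Icc (0 : ℝ) 1, Real.exp (-(d * t)) * h t := by
  refine setIntegral_congr_fun measurableSet_Icc fun t ht => ?_
  simp only [zero_sub, abs_neg, abs_of_nonneg ht.1, neg_mul]

variable {a : Fin n → ℂ} {V : ℝ → Matrix (Fin n) (Fin n) ℂ} {r : ℝ} {y f : Fin n → ℝ → ℂ}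

theorem RaySol.integrable_sysRhs (h : RaySol a V r y f)
    (hV : ∀ j k, IntegrableOn (fun t => V t j k) (Icc (0 : ℝ) 1)) (j : Fin n) :
    IntegrableOn (sysRhs V y f j) (Icc (0 : ℝ) 1) :=
  (integrable_finsetSum _ fun k _ => (hV j k).mul_continuousOn (h.continuous k).continuousOn
    isCompact_Icc).add (h.integrable j)

theorem RaySol.eq_exp (h : RaySol a V r y f)
    (hV : ∀ j k, IntegrableOn (fun t => V t j k) (Icc (0 : ℝ) 1)) (j : Fin n)
    {s x : ℝ} (hs : s ∈ Icc (0 : ℝ) 1) (hx : x ∈ Icc (0 : ℝ) 1) :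
    y j x = Complex.exp (r * a j * (x - s)) * y j s
      + ∫ t in s..x, Complex.exp (r * a j * (x - t)) * sysRhs V y f j t :=
  variation_of_constants (h.continuous j) (h.integrable_sysRhs hV j) (h.eq j) hs hx

theorem re_mul_sub (r : ℝ) (α : ℂ) (x t : ℝ) : (r * α * (x - t) : ℂ).re = r * α.re * (x - t) := by
  rw [← Complex.ofReal_sub, Complex.re_mul_ofReal, Complex.re_ofReal_mul]

/-- The gap |Re a_j| ≥ 2δ gives a kernel of rate 2rδ. Half of this rate is later spent on moving
weights of rate rδ out of the integral, the other half on making the coefficient integral small. -/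
theorem RaySol.integral_neg_le (h : RaySol a V r y f)
    (hV : ∀ j k, IntegrableOn (fun t => V t j k) (Icc (0 : ℝ) 1)) {δ : ℝ} (hr : 0 ≤ r)
    {j : Fin n} (hj : (a j).re ≤ -(2 * δ)) {x : ℝ} (hx : x ∈ Icc (0 : ℝ) 1) :
    ‖∫ t in (0 : ℝ)..x, Complex.exp (r * a j * (x - t)) * sysRhs V y f j t‖
      ≤ kerInt (2 * (r * δ)) x (fun t => ‖sysRhs V y f j t‖) := by
  refine norm_integral_exp_le_kerInt (h.integrable_sysRhs hV j) (by simp) hx hx.1 fun t ht => ?_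
  rw [re_mul_sub, abs_of_nonneg (sub_nonneg.2 ht.2)]
  nlinarith [mul_le_mul_of_nonneg_left hj (mul_nonneg hr (sub_nonneg.2 ht.2))]

theorem RaySol.norm_le_neg (h : RaySol a V r y f)
    (hV : ∀ j k, IntegrableOn (fun t => V t j k) (Icc (0 : ℝ) 1)) {δ : ℝ} (hr : 0 ≤ r)
    {j : Fin n} (hj : (a j).re ≤ -(2 * δ)) {x : ℝ} (hx : x ∈ Icc (0 : ℝ) 1) :
    ‖y j x‖ ≤ Real.exp (-(2 * (r * δ) * x)) * ‖y j 0‖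
      + kerInt (2 * (r * δ)) x (fun t => ‖sysRhs V y f j t‖) := by
  have h1 := h.eq_exp hV j (by simp : (0 : ℝ) ∈ Icc (0 : ℝ) 1) hx
  rw [h1]
  refine (norm_add_le _ _).trans (add_le_add ?_ (h.integral_neg_le hV hr hj hx))
  rw [norm_mul, Complex.norm_exp, re_mul_sub]
  refine mul_le_mul_of_nonneg_right (Real.exp_le_exp.2 ?_) (norm_nonneg _)
  nlinarith [mul_le_mul_of_nonneg_left hj (mul_nonneg hr hx.1)]

theorem RaySol.norm_le_pos (h : RaySol a V r y f)
    (hV : ∀ j k, IntegrableOn (fun t => V t j k) (Icc (0 : ℝ) 1)) {δ : ℝ} (hr : 0 ≤ r)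
    {j : Fin n} (hj : 2 * δ ≤ (a j).re) {x : ℝ} (hx : x ∈ Icc (0 : ℝ) 1) :
    ‖y j x‖ ≤ Real.exp (-(2 * (r * δ) * (1 - x))) * ‖y j 1‖
      + kerInt (2 * (r * δ)) x (fun t => ‖sysRhs V y f j t‖) := by
  have h1 := h.eq_exp hV j (by simp : (1 : ℝ) ∈ Icc (0 : ℝ) 1) hx
  rw [h1]
  refine (norm_add_le _ _).trans (add_le_add ?_ ?_)
  · rw [norm_mul, Complex.norm_exp, re_mul_sub]
    refine mul_le_mul_of_nonneg_right (Real.exp_le_exp.2 ?_) (norm_nonneg _)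
    nlinarith [mul_le_mul_of_nonneg_left hj (mul_nonneg hr (sub_nonneg.2 hx.2))]
  · rw [intervalIntegral.integral_symm, norm_neg]
    refine norm_integral_exp_le_kerInt (h.integrable_sysRhs hV j) hx (by simp) hx.2 fun t ht => ?_
    rw [re_mul_sub, abs_of_nonpos (sub_nonpos.2 ht.1)]
    nlinarith [mul_le_mul_of_nonneg_left hj (mul_nonneg hr (sub_nonneg.2 ht.1))]

theorem sum_norm_sysRhs_le (V : ℝ → Matrix (Fin n) (Fin n) ℂ) (y f : Fin n → ℝ → ℂ) (t : ℝ) :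
    ∑ j, ‖sysRhs V y f j t‖ ≤ matNorm (V t) * ∑ k, ‖y k t‖ + ∑ j, ‖f j t‖ := by
  rw [matNorm, Finset.sum_mul, ← Finset.sum_add_distrib]
  refine Finset.sum_le_sum fun j _ => (norm_add_le _ _).trans (add_le_add ?_ le_rfl)
  rw [Finset.sum_mul]
  refine (norm_sum_le _ _).trans (Finset.sum_le_sum fun k _ => ?_)
  rw [norm_mul]
  exact mul_le_mul_of_nonneg_left (Finset.single_le_sum (f := fun k => ‖y k t‖)
    (fun _ _ => norm_nonneg _) (Finset.mem_univ k)) (norm_nonneg _)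

theorem RaySol.integrable_sum_norm (h : RaySol a V r y f) :
    IntegrableOn (fun t => ∑ j, ‖f j t‖) (Icc (0 : ℝ) 1) :=
  integrable_finsetSum _ fun j _ => (h.integrable j).norm

theorem RaySol.kerInt_sum_norm_le (h : RaySol a V r y f) {d : ℝ} (hd : 0 ≤ d) (x : ℝ) :
    kerInt d x (fun t => ∑ j, ‖f j t‖) ≤ sumL1 f := by
  refine (kerInt_le_integral hd h.integrable_sum_norm fun t => by positivity).trans (le_of_eq ?_)
  exact integral_finsetSum _ fun j _ => (h.integrable j).norm

theorem RaySol.sum_kerInt_sysRhs_le (h : RaySol a V r y f)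
    (hV : ∀ j k, IntegrableOn (fun t => V t j k) (Icc (0 : ℝ) 1)) {d : ℝ} (hd : 0 ≤ d) (x : ℝ) :
    ∑ j, kerInt d x (fun t => ‖sysRhs V y f j t‖)
      ≤ kerInt d x (fun t => matNorm (V t) * ∑ k, ‖y k t‖) + sumL1 f := by
  have hc : Continuous fun t => ∑ k, ‖y k t‖ :=
    continuous_finsetSum _ fun k _ => (h.continuous k).norm
  have i1 : IntegrableOn (fun t => matNorm (V t) * ∑ k, ‖y k t‖) (Icc (0 : ℝ) 1) :=
    (integrable_matNorm hV).mul_continuousOn hc.continuousOn isCompact_Icc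
  rw [← kerInt_sum _ fun j _ => (h.integrable_sysRhs hV j).norm]
  refine (kerInt_mono (integrable_finsetSum _ fun j _ => (h.integrable_sysRhs hV j).norm)
    (i1.add h.integrable_sum_norm) fun t _ => sum_norm_sysRhs_le V y f t).trans ?_
  exact (kerInt_add i1 h.integrable_sum_norm).le.trans
    (add_le_add le_rfl (h.kerInt_sum_norm_le hd x))

theorem re_neg_or_pos {δ : ℝ} {α : ℂ} (h : 2 * δ ≤ |α.re|) :
    (α.re < 0 ∧ α.re ≤ -(2 * δ)) ∨ (¬ α.re < 0 ∧ 2 * δ ≤ α.re) := by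
  rcases lt_or_ge α.re 0 with h1 | h1
  · rw [abs_of_neg h1] at h; exact Or.inl ⟨h1, by linarith⟩
  · rw [abs_of_nonneg h1] at h; exact Or.inr ⟨not_lt.2 h1, h⟩

theorem exp_double_le {d x : ℝ} (hd : 0 ≤ d) (hx : 0 ≤ x) :
    Real.exp (-(2 * d * x)) ≤ Real.exp (-(d * x)) :=
  Real.exp_le_exp.2 (by nlinarith [mul_nonneg hd hx])

/-- The crude a priori bound: solving each component from the end where it is largest gives an
inequality to which the Gronwall type lemma with small kernel applies. Components of either kind may
be excited from either end, so both boundary layers carry the full sum of end values. -/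
theorem RaySol.sum_norm_le (h : RaySol a V r y f)
    (hV : ∀ j k, IntegrableOn (fun t => V t j k) (Icc (0 : ℝ) 1)) {δ : ℝ} (hδ : 0 < δ)
    (hr : 0 ≤ r) (ha : ∀ j, 2 * δ ≤ |(a j).re|)
    (hκ : ∀ x, kerInt (r * δ) x (fun t => matNorm (V t)) ≤ 1 / 2)
    {x : ℝ} (hx : x ∈ Icc (0 : ℝ) 1) :
    ∑ j, ‖y j x‖ ≤ 2 * weight (r * δ) (∑ j, ‖endVal a y j‖) (∑ j, ‖endVal a y j‖) (sumL1 f) x := by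
  have hd : 0 ≤ r * δ := by positivity
  set A := ∑ j, ‖endVal a y j‖ with hA
  have hA0 : 0 ≤ A := by positivity
  have hG0 := sumL1_nonneg f
  refine le_two_mul_of_le_add_kerInt hd (u := fun x => ∑ j, ‖y j x‖)
    (continuous_finsetSum _ fun k _ => (h.continuous k).norm) (fun x => by positivity)
    (continuous_weight _ _ _ _) (weight_nonneg hA0 hA0 hG0)
    (fun x _ t _ => weight_le hd hA0 hA0 hG0 x t) (integrable_matNorm hV)
    (fun t => matNorm_nonneg _) hκ (fun x hx => ?_) hx
  have h1 : ∀ j, ‖y j x‖ ≤ ‖endVal a y j‖ * (Real.exp (-(r * δ * x))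
      + Real.exp (-(r * δ * (1 - x)))) + kerInt (2 * (r * δ)) x (fun t => ‖sysRhs V y f j t‖) := by
    intro j
    have p1 := Real.exp_pos (-(r * δ * x))
    have p2 := Real.exp_pos (-(r * δ * (1 - x)))
    rcases re_neg_or_pos (ha j) with ⟨h2, h3⟩ | ⟨h2, h3⟩
    · rw [endVal, if_pos h2]
      have h4 := mul_le_mul_of_nonneg_right (exp_double_le hd hx.1) (norm_nonneg (y j 0))
      nlinarith [h.norm_le_neg hV hr h3 hx, mul_nonneg p2.le (norm_nonneg (y j 0))]
    · rw [endVal, if_neg h2]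
      have h4 := mul_le_mul_of_nonneg_right (exp_double_le hd (sub_nonneg.2 hx.2))
        (norm_nonneg (y j 1))
      nlinarith [h.norm_le_pos hV hr h3 hx, mul_nonneg p1.le (norm_nonneg (y j 1))]
  calc ∑ j, ‖y j x‖ ≤ ∑ j, (‖endVal a y j‖ * (Real.exp (-(r * δ * x))
      + Real.exp (-(r * δ * (1 - x)))) + kerInt (2 * (r * δ)) x (fun t => ‖sysRhs V y f j t‖)) :=
        Finset.sum_le_sum fun j _ => h1 j
    _ = A * (Real.exp (-(r * δ * x)) + Real.exp (-(r * δ * (1 - x))))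
        + ∑ j, kerInt (2 * (r * δ)) x (fun t => ‖sysRhs V y f j t‖) := by
        rw [Finset.sum_add_distrib, ← Finset.sum_mul]
    _ ≤ A * (Real.exp (-(r * δ * x)) + Real.exp (-(r * δ * (1 - x))))
        + (kerInt (2 * (r * δ)) x (fun t => matNorm (V t) * ∑ k, ‖y k t‖) + sumL1 f) := by
        have := h.sum_kerInt_sysRhs_le hV (by positivity : 0 ≤ 2 * (r * δ)) x
        gcongr
    _ = _ := by unfold weight; ring

/-- The part of the matrix which maps the components decaying from `0` to those decaying
from `1`. -/
def offPart (a : Fin n → ℂ) (M : Matrix (Fin n) (Fin n) ℂ) : Matrix (Fin n) (Fin n) ℂ :=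
  Matrix.of fun k l => if 0 < (a k).re ∧ (a l).re < 0 then M k l else 0

theorem matNorm_offPart_le (a : Fin n → ℂ) (M : Matrix (Fin n) (Fin n) ℂ) :
    matNorm (offPart a M) ≤ matNorm M := by
  refine Finset.sum_le_sum fun j _ => Finset.sum_le_sum fun k _ => ?_
  simp only [offPart, Matrix.of_apply]
  split_ifs
  · exact le_rfl
  · simp

theorem integrable_offPart (a : Fin n → ℂ)
    (hV : ∀ j k, IntegrableOn (fun t => V t j k) (Icc (0 : ℝ) 1)) (j k : Fin n) :
    IntegrableOn (fun t => offPart a (V t) j k) (Icc (0 : ℝ) 1) := by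
  simp only [offPart, Matrix.of_apply]
  split_ifs
  · exact hV j k
  · exact integrableOn_zero

/-- The sum of the absolute values of the components decaying from `1`. -/
def sumPos (a : Fin n → ℂ) (y : Fin n → ℝ → ℂ) (t : ℝ) : ℝ :=
  ∑ k, if 0 < (a k).re then ‖y k t‖ else 0

theorem sumPos_nonneg (a : Fin n → ℂ) (y : Fin n → ℝ → ℂ) (t : ℝ) : 0 ≤ sumPos a y t :=
  Finset.sum_nonneg fun k _ => by split_ifs <;> positivity

theorem RaySol.continuous_sumPos (h : RaySol a V r y f) : Continuous (sumPos a y) := by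
  refine continuous_finsetSum _ fun k _ => ?_
  split_ifs
  · exact (h.continuous k).norm
  · exact continuous_const

/-- The right-hand side of the components decaying from `1`, when the other components are
split as `y l = w l + (y l - w l)`. -/
theorem sum_pos_norm_sub_le (ha : ∀ j, (a j).re ≠ 0) (V : ℝ → Matrix (Fin n) (Fin n) ℂ)
    (y f w : Fin n → ℝ → ℂ) (t : ℝ) {ρ : ℝ} (hρ : ∀ l, (a l).re < 0 → ‖y l t - w l t‖ ≤ ρ)
    (hρ0 : 0 ≤ ρ) :
    ∑ k, (if 0 < (a k).re then
      ‖sysRhs V y f k t - ∑ l, (if (a l).re < 0 then V t k l * w l t else 0)‖ else 0)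
      ≤ matNorm (V t) * sumPos a y t + matNorm (offPart a (V t)) * ρ + ∑ j, ‖f j t‖ := by
  simp only [matNorm, Finset.sum_mul]
  rw [← Finset.sum_add_distrib, ← Finset.sum_add_distrib]
  refine Finset.sum_le_sum fun k _ => ?_
  by_cases hk : 0 < (a k).re
  swap
  · rw [if_neg hk]
    have := sumPos_nonneg a y t
    positivity
  rw [if_pos hk, sysRhs, add_sub_right_comm, ← Finset.sum_sub_distrib]
  refine (norm_add_le _ _).trans (add_le_add ?_ le_rfl)
  rw [← Finset.sum_add_distrib]
  refine (norm_sum_le _ _).trans (Finset.sum_le_sum fun l _ => ?_)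
  rcases lt_or_gt_of_ne (ha l) with hl | hl
  · rw [if_pos hl, ← mul_sub, norm_mul]
    have h1 : ‖offPart a (V t) k l‖ = ‖V t k l‖ := by
      simp [offPart, hk, hl]
    rw [h1]
    have h2 := mul_le_mul_of_nonneg_left (hρ l hl) (norm_nonneg (V t k l))
    have h3 := mul_nonneg (norm_nonneg (V t k l)) (sumPos_nonneg a y t)
    linarith
  · rw [if_neg hl.le.not_gt, sub_zero, norm_mul]
    have h1 : ‖y l t‖ ≤ sumPos a y t := by
      have h2 := Finset.single_le_sum (f := fun l => if 0 < (a l).re then ‖y l t‖ else 0)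
        (fun k _ => by split_ifs <;> positivity) (Finset.mem_univ l)
      simp only [if_pos hl] at h2
      exact h2
    have h2 := mul_le_mul_of_nonneg_left h1 (norm_nonneg (V t k l))
    have h3 := mul_nonneg (norm_nonneg (offPart a (V t) k l)) hρ0
    linarith

end RaySol

end BVP
end

noncomputable section
namespace BVP

/-! ### Asymptotics of the boundary values -/

section Asymptotics

variable {n : ℕ} {a : Fin n → ℂ} {V : ℝ → Matrix (Fin n) (Fin n) ℂ} {r : ℝ}
  {y f : Fin n → ℝ → ℂ}

/-- The boundary layer of the weight at 0 is integrated directly against N, with the kernel bounded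
by 1, and thus profits from the smallness η of the Laplace integral of N. The other terms are taken
out of the integral as usual. -/
theorem kerInt_mul_weight_le_add {d A G η : ℝ} (hd : 0 ≤ d) (hA : 0 ≤ A) (hG : 0 ≤ G)
    {N : ℝ → ℝ} (hN : IntegrableOn N (Icc (0 : ℝ) 1)) (hN0 : ∀ t, 0 ≤ N t)
    (hη : kerInt d 0 N ≤ η) (x : ℝ) :
    kerInt (2 * d) x (fun t => N t * weight d A A G t)
      ≤ A * η + weight d 0 A G x * kerInt d x N := by
  have hE : Continuous fun t => Real.exp (-(d * t)) := by fun_prop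
  have i1 : IntegrableOn (fun t => N t * Real.exp (-(d * t))) (Icc (0 : ℝ) 1) :=
    hN.mul_continuousOn hE.continuousOn isCompact_Icc
  have i2 : IntegrableOn (fun t => N t * weight d 0 A G t) (Icc (0 : ℝ) 1) :=
    hN.mul_continuousOn (continuous_weight _ _ _ _).continuousOn isCompact_Icc
  have h1 : (fun t => N t * weight d A A G t)
      = fun t => A * (N t * Real.exp (-(d * t))) + N t * weight d 0 A G t := by
    funext t; unfold weight; ring
  have h2 : kerInt (2 * d) x (fun t => N t * Real.exp (-(d * t))) ≤ η := by
    refine (kerInt_le_integral (by positivity) i1 fun t =>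
      mul_nonneg (hN0 t) (Real.exp_pos _).le).trans ?_
    rw [kerInt_zero_eq] at hη
    refine le_of_eq_of_le ?_ hη
    congr 1; funext t; ring
  rw [h1, kerInt_add (i1.const_mul A) i2, kerInt_const_mul]
  exact add_le_add (mul_le_mul_of_nonneg_left h2 hA)
    (kerInt_mul_weight hd le_rfl hA hG hN hN0 x)

theorem RaySol.kerInt_sum_pos_le (h : RaySol a V r y f)
    (hV : ∀ j k, IntegrableOn (fun t => V t j k) (Icc (0 : ℝ) 1)) {d x : ℝ} (hd : 0 ≤ d)
    {ρ : ℝ → ℝ} (hρ : Continuous ρ) {F : ℝ → ℝ} (hF : IntegrableOn F (Icc (0 : ℝ) 1))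
    (hle : ∀ t ∈ Icc (0 : ℝ) 1,
      F t ≤ matNorm (V t) * sumPos a y t + matNorm (offPart a (V t)) * ρ t + ∑ j, ‖f j t‖) :
    kerInt d x F ≤ kerInt d x (fun t => matNorm (V t) * sumPos a y t)
      + kerInt d x (fun t => matNorm (offPart a (V t)) * ρ t) + sumL1 f := by
  have i1 : IntegrableOn (fun t => matNorm (V t) * sumPos a y t) (Icc (0 : ℝ) 1) :=
    (integrable_matNorm hV).mul_continuousOn h.continuous_sumPos.continuousOn isCompact_Icc
  have i2 : IntegrableOn (fun t => matNorm (offPart a (V t)) * ρ t) (Icc (0 : ℝ) 1) :=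
    (integrable_matNorm (integrable_offPart a hV)).mul_continuousOn hρ.continuousOn isCompact_Icc
  refine (kerInt_mono hF ((i1.add i2).add h.integrable_sum_norm) hle).trans ?_
  refine (kerInt_add (i1.add i2) h.integrable_sum_norm).le.trans
    (add_le_add ?_ (h.kerInt_sum_norm_le hd x))
  exact (kerInt_add i1 i2).le

theorem norm_endVal_le_sum (a : Fin n → ℂ) (y : Fin n → ℝ → ℂ) (j : Fin n) :
    ‖endVal a y j‖ ≤ ∑ j, ‖endVal a y j‖ :=
  Finset.single_le_sum (f := fun j => ‖endVal a y j‖) (fun _ _ => norm_nonneg _)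
    (Finset.mem_univ j)

/-- Refines the crude bound for the components decaying from 1: near 0 they are driven by the other
group only through `offPart`, so their boundary layer at 0 disappears in favour of a term of size η.
-/
theorem RaySol.sumPos_le (h : RaySol a V r y f)
    (hV : ∀ j k, IntegrableOn (fun t => V t j k) (Icc (0 : ℝ) 1)) {δ : ℝ} (hδ : 0 < δ)
    (hr : 0 ≤ r) (ha : ∀ j, 2 * δ ≤ |(a j).re|)
    (hκ : ∀ x, kerInt (r * δ) x (fun t => matNorm (V t)) ≤ 1 / 2) {η : ℝ} (hη0 : 0 ≤ η)
    (hη : kerInt (r * δ) 0 (fun t => matNorm (offPart a (V t))) ≤ η)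
    {x : ℝ} (hx : x ∈ Icc (0 : ℝ) 1) :
    sumPos a y x ≤ 2 * weight (r * δ) 0 (2 * ∑ j, ‖endVal a y j‖)
      (2 * sumL1 f + 2 * (∑ j, ‖endVal a y j‖) * η) x := by
  have hd : 0 ≤ r * δ := by positivity
  set A := ∑ j, ‖endVal a y j‖ with hA
  have hA0 : 0 ≤ A := by positivity
  have hG0 := sumL1_nonneg f
  have hne : ∀ j, (a j).re ≠ 0 := fun j h0 => by
    have := ha j; rw [h0, abs_zero] at this; linarith
  have hO := integrable_matNorm (integrable_offPart a hV)
  have hB0 : 0 ≤ 2 * sumL1 f + 2 * A * η := by positivity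
  refine le_two_mul_of_le_add_kerInt hd h.continuous_sumPos (sumPos_nonneg a y)
    (continuous_weight _ _ _ _) (weight_nonneg le_rfl (by positivity) hB0)
    (fun x _ t _ => weight_le hd le_rfl (by positivity) hB0 x t) (integrable_matNorm hV)
    (fun t => matNorm_nonneg _) hκ (fun x hx => ?_) hx
  set S : ℝ → ℝ := fun t => ∑ k, if 0 < (a k).re then ‖sysRhs V y f k t‖ else 0 with hS
  have hSi : ∀ k, IntegrableOn (fun t => if 0 < (a k).re then ‖sysRhs V y f k t‖ else 0)
      (Icc (0 : ℝ) 1) := fun k => by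
    split_ifs
    · exact (h.integrable_sysRhs hV k).norm
    · exact integrableOn_zero
  have hSint : IntegrableOn S (Icc (0 : ℝ) 1) := integrable_finsetSum _ fun k _ => hSi k
  have h1 : sumPos a y x ≤ A * Real.exp (-(r * δ * (1 - x))) + kerInt (2 * (r * δ)) x S := by
    rw [hS, kerInt_sum _ fun k _ => hSi k, hA, Finset.sum_mul, ← Finset.sum_add_distrib]
    refine Finset.sum_le_sum fun k _ => ?_
    by_cases hk : 0 < (a k).re
    · simp only [if_pos hk]
      have hk' : 2 * δ ≤ (a k).re := by have := ha k; rwa [abs_of_pos hk] at this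
      rw [endVal, if_neg hk.le.not_gt]
      have h4 := mul_le_mul_of_nonneg_right (exp_double_le hd (sub_nonneg.2 hx.2))
        (norm_nonneg (y k 1))
      linarith [h.norm_le_pos hV hr hk' hx]
    · simp only [if_neg hk]
      have : kerInt (2 * (r * δ)) x (fun _ => (0 : ℝ)) = 0 := by simp [kerInt]
      rw [this]
      positivity
  have h2 : kerInt (2 * (r * δ)) x S ≤ kerInt (2 * (r * δ)) x (fun t => matNorm (V t) * sumPos a y t)
      + kerInt (2 * (r * δ)) x (fun t => matNorm (offPart a (V t)) *
        (2 * weight (r * δ) A A (sumL1 f) t)) + sumL1 f := by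
    refine h.kerInt_sum_pos_le hV (by positivity) ((continuous_weight _ _ _ _).const_mul 2) hSint
      fun t ht => ?_
    have h3 := sum_pos_norm_sub_le hne V y f (fun _ _ => 0) t
      (ρ := 2 * weight (r * δ) A A (sumL1 f) t) (fun l _ => by
        rw [sub_zero]
        refine le_trans ?_ (h.sum_norm_le hV hδ hr ha hκ ht)
        exact Finset.single_le_sum (f := fun l => ‖y l t‖) (fun _ _ => norm_nonneg _)
          (Finset.mem_univ l)) (by have := weight_nonneg (d := r * δ) hA0 hA0 hG0 t; positivity)
    simpa using h3
  have h3 : kerInt (2 * (r * δ)) x (fun t => matNorm (offPart a (V t)) *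
      (2 * weight (r * δ) A A (sumL1 f) t)) ≤ 2 * (A * η + weight (r * δ) 0 A (sumL1 f) x / 2) := by
    have h4 : (fun t => matNorm (offPart a (V t)) * (2 * weight (r * δ) A A (sumL1 f) t))
        = fun t => 2 * (matNorm (offPart a (V t)) * weight (r * δ) A A (sumL1 f) t) := by
      funext t; ring
    rw [h4, kerInt_const_mul]
    have h5 := kerInt_mul_weight_le_add hd hA0 hG0 hO (fun t => matNorm_nonneg _) hη x
    have h6 : kerInt (r * δ) x (fun t => matNorm (offPart a (V t))) ≤ 1 / 2 :=
      (kerInt_mono hO (integrable_matNorm hV) fun t _ => matNorm_offPart_le _ _).trans (hκ x)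
    have h7 := mul_le_mul_of_nonneg_left h6 (weight_nonneg (d := r * δ) le_rfl hA0 hG0 x)
    linarith
  have h8 : weight (r * δ) 0 (2 * A) (2 * sumL1 f + 2 * A * η) x
      = A * Real.exp (-(r * δ * (1 - x))) + 2 * (A * η + weight (r * δ) 0 A (sumL1 f) x / 2)
        + sumL1 f := by
    unfold weight; ring
  rw [h8]
  linarith

/-- Components decaying from 0 are free exponentials up to a relative error κ; this follows by
inserting the crude bound into the variation of constants formula once. -/
theorem RaySol.norm_sub_exp_le (h : RaySol a V r y f)
    (hV : ∀ j k, IntegrableOn (fun t => V t j k) (Icc (0 : ℝ) 1)) {δ : ℝ} (hδ : 0 < δ)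
    (hr : 0 ≤ r) (ha : ∀ j, 2 * δ ≤ |(a j).re|) {κ : ℝ} (hκ2 : κ ≤ 1 / 2)
    (hκ : ∀ x, kerInt (r * δ) x (fun t => matNorm (V t)) ≤ κ)
    {l : Fin n} (hl : (a l).re < 0) {t : ℝ} (ht : t ∈ Icc (0 : ℝ) 1) :
    ‖y l t - Complex.exp (r * a l * t) * y l 0‖
      ≤ 2 * κ * weight (r * δ) (∑ j, ‖endVal a y j‖) (∑ j, ‖endVal a y j‖) (sumL1 f) t
        + sumL1 f := by
  have hd : 0 ≤ r * δ := by positivity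
  set A := ∑ j, ‖endVal a y j‖ with hA
  have hA0 : 0 ≤ A := by positivity
  have hG0 := sumL1_nonneg f
  have hl' : (a l).re ≤ -(2 * δ) := by have := ha l; rw [abs_of_neg hl] at this; linarith
  have hN := integrable_matNorm hV
  have hc : Continuous fun t => ∑ k, ‖y k t‖ :=
    continuous_finsetSum _ fun k _ => (h.continuous k).norm
  have h1 := h.eq_exp hV l (by simp : (0 : ℝ) ∈ Icc (0 : ℝ) 1) ht
  rw [Complex.ofReal_zero, sub_zero] at h1
  rw [sub_eq_of_eq_add' h1]
  refine (h.integral_neg_le hV hr hl' ht).trans ?_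
  refine (Finset.single_le_sum
    (f := fun l => kerInt (2 * (r * δ)) t (fun t => ‖sysRhs V y f l t‖))
    (fun _ _ => kerInt_nonneg fun _ => norm_nonneg _) (Finset.mem_univ l)).trans ?_
  refine (h.sum_kerInt_sysRhs_le hV (by positivity) t).trans (add_le_add ?_ le_rfl)
  calc kerInt (2 * (r * δ)) t (fun t => matNorm (V t) * ∑ k, ‖y k t‖)
      ≤ kerInt (2 * (r * δ)) t (fun t => 2 * (matNorm (V t) * weight (r * δ) A A (sumL1 f) t)) := by
        refine kerInt_mono (hN.mul_continuousOn hc.continuousOn isCompact_Icc)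
          ((hN.mul_continuousOn (continuous_weight _ _ _ _).continuousOn isCompact_Icc).const_mul 2)
          fun s hs => ?_
        have h2 := h.sum_norm_le hV hδ hr ha (fun x => (hκ x).trans hκ2) hs
        have h3 := mul_le_mul_of_nonneg_left h2 (matNorm_nonneg (V s))
        linarith
    _ ≤ 2 * (weight (r * δ) A A (sumL1 f) t * κ) := by
        rw [kerInt_const_mul]
        have h2 := kerInt_mul_weight hd hA0 hA0 hG0 hN (fun t => matNorm_nonneg _) t
        have h3 := mul_le_mul_of_nonneg_left (hκ t) (weight_nonneg (d := r * δ) hA0 hA0 hG0 t)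
        linarith
    _ = _ := by ring

/-- Variation of constants from 1 to 0, with the decaying components replaced by free exponentials,
leaves Laplace integrals of the coefficients. In the error, every nonexponential contribution of the
end values carries two small factors: κ from the general smallness of the kernel and η from the
Laplace integral of `offPart`. As η will be O(1/r) and κ arbitrarily small, the error is o(1/r). -/
theorem RaySol.norm_add_integral_le (h : RaySol a V r y f)
    (hV : ∀ j k, IntegrableOn (fun t => V t j k) (Icc (0 : ℝ) 1)) {δ : ℝ} (hδ : 0 < δ)
    (hr : 0 ≤ r) (ha : ∀ j, 2 * δ ≤ |(a j).re|) {κ : ℝ} (hκ0 : 0 ≤ κ) (hκ2 : κ ≤ 1 / 2)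
    (hκ : ∀ x, kerInt (r * δ) x (fun t => matNorm (V t)) ≤ κ) {η : ℝ} (hη0 : 0 ≤ η)
    (hη : kerInt (r * δ) 0 (fun t => matNorm (offPart a (V t))) ≤ η)
    {k : Fin n} (hk : 0 < (a k).re) :
    ‖y k 0 + ∑ l, (if (a l).re < 0 then
      (∫ t in Icc (0 : ℝ) 1, Complex.exp (-(r * (a k - a l) * t)) * V t k l) * y l 0 else 0)‖
      ≤ (6 * κ * η + 4 * Real.exp (-(r * δ))) * (∑ j, ‖endVal a y j‖) + 4 * sumL1 f := by
  have hd : 0 ≤ r * δ := by positivity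
  have hne : ∀ j, (a j).re ≠ 0 := fun j h0 => by
    have := ha j; rw [h0, abs_zero] at this; linarith
  have hN := integrable_matNorm hV
  have hO := integrable_matNorm (integrable_offPart a hV)
  have hκ' : ∀ x, kerInt (r * δ) x (fun t => matNorm (V t)) ≤ 1 / 2 := fun x => (hκ x).trans hκ2
  have hk' : 2 * δ ≤ (a k).re := by have := ha k; rwa [abs_of_pos hk] at this
  set w : Fin n → ℝ → ℂ := fun l t => Complex.exp (r * a l * t) * y l 0 with hw
  have hwc : ∀ l, Continuous (w l) := fun l => by simp only [hw]; fun_prop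
  set M : ℝ → ℂ := fun t => ∑ l, (if (a l).re < 0 then V t k l * w l t else 0) with hM
  have hMi : ∀ l, IntegrableOn (fun t => if (a l).re < 0 then V t k l * w l t else 0)
      (Icc (0 : ℝ) 1) := fun l => by
    split_ifs
    · exact (hV k l).mul_continuousOn (hwc l).continuousOn isCompact_Icc
    · exact integrableOn_zero
  have hMint : IntegrableOn M (Icc (0 : ℝ) 1) := integrable_finsetSum _ fun l _ => hMi l
  have hEint : IntegrableOn (fun t => sysRhs V y f k t - M t) (Icc (0 : ℝ) 1) :=
    (h.integrable_sysRhs hV k).sub hMint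
  have hec : Continuous fun t : ℝ => Complex.exp (r * a k * ((0 : ℝ) - t)) := by fun_prop
  -- The two exponentials combine to one with rate a_k - a_l, whose real part is positive.
  have hmain : ∫ t in (0 : ℝ)..1, Complex.exp (r * a k * ((0 : ℝ) - t)) * M t
      = ∑ l, (if (a l).re < 0 then
        (∫ t in Icc (0 : ℝ) 1, Complex.exp (-(r * (a k - a l) * t)) * V t k l) * y l 0 else 0) := by
    rw [intervalIntegral.integral_of_le zero_le_one, ← integral_Icc_eq_integral_Ioc]
    simp only [hM, Finset.mul_sum]
    rw [integral_finsetSum _ fun l _ => (hMi l).continuousOn_mul hec.continuousOn isCompact_Icc]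
    refine Finset.sum_congr rfl fun l _ => ?_
    split_ifs
    · rw [← integral_mul_const]
      congr 1; funext t
      simp only [hw]
      rw [mul_left_comm, ← mul_assoc (Complex.exp _) (Complex.exp _), ← Complex.exp_add]
      have : (r * a k * ((0 : ℝ) - t) + r * a l * t : ℂ) = -(r * (a k - a l) * t) := by
        push_cast; ring
      rw [this]; ring
    · simp
  have hEi : IntervalIntegrable (fun t : ℝ => Complex.exp (r * a k * ((0 : ℝ) - t)) *
      (sysRhs V y f k t - M t)) volume 0 1 :=
    intervalIntegrable_of_Icc (hEint.continuousOn_mul hec.continuousOn isCompact_Icc)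
      (by simp) (by simp)
  have hMi' : IntervalIntegrable (fun t : ℝ => Complex.exp (r * a k * ((0 : ℝ) - t)) * M t)
      volume 0 1 :=
    intervalIntegrable_of_Icc (hMint.continuousOn_mul hec.continuousOn isCompact_Icc)
      (by simp) (by simp)
  have hid : y k 0 + ∫ t in (0 : ℝ)..1, Complex.exp (r * a k * ((0 : ℝ) - t)) * M t
      = Complex.exp (r * a k * ((0 : ℝ) - (1 : ℝ))) * y k 1
        - ∫ t in (0 : ℝ)..1, Complex.exp (r * a k * ((0 : ℝ) - t)) * (sysRhs V y f k t - M t) := by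
    have h1 := h.eq_exp hV k (by simp : (1 : ℝ) ∈ Icc (0 : ℝ) 1) (by simp : (0 : ℝ) ∈ Icc (0 : ℝ) 1)
    have h2 : ∫ t in (1 : ℝ)..0, Complex.exp (r * a k * ((0 : ℝ) - t)) * sysRhs V y f k t
        = -((∫ t in (0 : ℝ)..1, Complex.exp (r * a k * ((0 : ℝ) - t)) * (sysRhs V y f k t - M t))
          + ∫ t in (0 : ℝ)..1, Complex.exp (r * a k * ((0 : ℝ) - t)) * M t) := by
      rw [intervalIntegral.integral_symm, ← intervalIntegral.integral_add hEi hMi']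
      congr 2; funext t; ring
    rw [h2] at h1
    linear_combination h1
  rw [← hmain, hid]
  set A := ∑ j, ‖endVal a y j‖ with hA
  set G := sumL1 f with hG
  have hA0 : 0 ≤ A := by positivity
  have hG0 : 0 ≤ G := sumL1_nonneg f
  set q := Real.exp (-(r * δ)) with hq
  have hq0 : 0 < q := Real.exp_pos _
  have hb1 : ‖Complex.exp (r * a k * ((0 : ℝ) - (1 : ℝ))) * y k 1‖ ≤ q * A := by
    rw [norm_mul, Complex.norm_exp, re_mul_sub]
    have h1 : ‖y k 1‖ ≤ A := by
      have := norm_endVal_le_sum a y k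
      rwa [endVal, if_neg hk.le.not_gt] at this
    refine mul_le_mul (Real.exp_le_exp.2 ?_) h1 (norm_nonneg _) hq0.le
    nlinarith [mul_le_mul_of_nonneg_left hk' hr]
  set ρ : ℝ → ℝ := fun t => 2 * κ * weight (r * δ) A A G t + G with hρ
  have hρc : Continuous ρ := by
    have := continuous_weight (r * δ) A A G
    simp only [hρ]; fun_prop
  have hb2 := norm_integral_exp_le_kerInt hEint (d := 2 * (r * δ)) (α := r * a k) (y := 0)
    (by simp : (0 : ℝ) ∈ Icc (0 : ℝ) 1) (by simp : (1 : ℝ) ∈ Icc (0 : ℝ) 1) zero_le_one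
    (fun t ht => by
      rw [re_mul_sub, abs_of_nonpos (by linarith [ht.1])]
      nlinarith [mul_le_mul_of_nonneg_left hk' (mul_nonneg hr ht.1)])
  have hb3 := h.kerInt_sum_pos_le hV (x := 0) (by positivity : 0 ≤ 2 * (r * δ)) hρc hEint.norm
    (fun t ht => by
      refine le_trans ?_ (sum_pos_norm_sub_le hne V y f w t (ρ := ρ t)
        (fun l hl => h.norm_sub_exp_le hV hδ hr ha hκ2 hκ hl ht)
        (by have := weight_nonneg (d := r * δ) hA0 hA0 hG0 t; positivity))
      refine le_trans ?_ (Finset.single_le_sum (f := fun k => if 0 < (a k).re then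
        ‖sysRhs V y f k t - ∑ l, (if (a l).re < 0 then V t k l * w l t else 0)‖ else 0)
        (fun k _ => by split_ifs <;> positivity) (Finset.mem_univ k))
      simp only [if_pos hk, hM, le_refl])
  have hW0 : ∀ B, weight (r * δ) 0 A B 0 = A * q + B := fun B => by
    simp [weight, hq]
  -- At the point 0 the refined weight has no boundary layer of size A: only A·exp(-rδ), Aη and the
  -- contribution of f remain, all multiplied by κ.
  have hb4 : kerInt (2 * (r * δ)) 0 (fun t => matNorm (V t) * sumPos a y t)
      ≤ 2 * ((2 * A * q + (2 * G + 2 * A * η)) * κ) := by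
    have hB0 : 0 ≤ 2 * G + 2 * A * η := by positivity
    have h1 : kerInt (2 * (r * δ)) 0 (fun t => matNorm (V t) * sumPos a y t)
        ≤ kerInt (2 * (r * δ)) 0 (fun t => 2 * (matNorm (V t) *
          weight (r * δ) 0 (2 * A) (2 * G + 2 * A * η) t)) := by
      refine kerInt_mono (hN.mul_continuousOn h.continuous_sumPos.continuousOn isCompact_Icc)
        ((hN.mul_continuousOn (continuous_weight _ _ _ _).continuousOn isCompact_Icc).const_mul 2)
        fun t ht => ?_
      have := mul_le_mul_of_nonneg_left (h.sumPos_le hV hδ hr ha hκ' hη0 hη ht)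
        (matNorm_nonneg (V t))
      linarith
    rw [kerInt_const_mul] at h1
    have h2 := kerInt_mul_weight hd le_rfl (by positivity : 0 ≤ 2 * A) hB0 hN
      (fun t => matNorm_nonneg _) 0
    have h3 : weight (r * δ) 0 (2 * A) (2 * G + 2 * A * η) 0
        = 2 * A * q + (2 * G + 2 * A * η) := by simp [weight, hq]
    rw [h3] at h2
    have h4 := mul_le_mul_of_nonneg_left (hκ 0)
      (by positivity : 0 ≤ 2 * A * q + (2 * G + 2 * A * η))
    linarith
  have hb5 : kerInt (2 * (r * δ)) 0 (fun t => matNorm (offPart a (V t)) * ρ t)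
      ≤ 2 * κ * (A * η + (A * q + G) * (1 / 2)) + G * (1 / 2) := by
    have h1 : (fun t => matNorm (offPart a (V t)) * ρ t) = fun t =>
        2 * κ * (matNorm (offPart a (V t)) * weight (r * δ) A A G t)
          + G * matNorm (offPart a (V t)) := by
      funext t; simp only [hρ]; ring
    have i1 : IntegrableOn (fun t => 2 * κ * (matNorm (offPart a (V t)) *
        weight (r * δ) A A G t)) (Icc (0 : ℝ) 1) :=
      (hO.mul_continuousOn (continuous_weight _ _ _ _).continuousOn isCompact_Icc).const_mul _
    rw [h1, kerInt_add i1 (hO.const_mul G), kerInt_const_mul, kerInt_const_mul]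
    have h6 : kerInt (r * δ) 0 (fun t => matNorm (offPart a (V t))) ≤ 1 / 2 :=
      (kerInt_mono hO hN fun t _ => matNorm_offPart_le _ _).trans (hκ' 0)
    have h7 := kerInt_mul_weight_le_add hd hA0 hG0 hO (fun t => matNorm_nonneg _) hη 0
    rw [hW0] at h7
    have h8 : kerInt (2 * (r * δ)) 0 (fun t => matNorm (offPart a (V t))) ≤ 1 / 2 :=
      (kerInt_antitone (by linarith) hO fun t => matNorm_nonneg _).trans h6
    have h9 := mul_le_mul_of_nonneg_left h6 (by positivity : 0 ≤ A * q + G)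
    have h10 : kerInt (2 * (r * δ)) 0 (fun t => matNorm (offPart a (V t)) *
        weight (r * δ) A A G t) ≤ A * η + (A * q + G) * (1 / 2) := by linarith
    have h11 := mul_le_mul_of_nonneg_left h10 (by positivity : 0 ≤ 2 * κ)
    have h12 := mul_le_mul_of_nonneg_left h8 hG0
    linarith
  have e1 : κ * (A * q) ≤ 1 / 2 * (A * q) := mul_le_mul_of_nonneg_right hκ2 (by positivity)
  have e2 : κ * G ≤ 1 / 2 * G := mul_le_mul_of_nonneg_right hκ2 hG0
  have e3 : 0 ≤ A * q := by positivity
  refine (norm_sub_le _ _).trans ?_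
  nlinarith [hb1, hb2, hb3, hb4, hb5]

/-- Continuity at 0 of just the entries linking the two groups gives the rate 1/r; for merely
integrable entries the integral would only tend to zero. -/
theorem exists_kerInt_offPart_le (hV : ∀ j k, IntegrableOn (fun t => V t j k) (Icc (0 : ℝ) 1))
    {δ : ℝ} (hδ : 0 < δ) (hV0 : ∀ k l, 0 < (a k).re → (a l).re < 0 →
      ContinuousWithinAt (fun t => V t k l) (Icc (0 : ℝ) 1) 0) :
    ∃ C, 0 ≤ C ∧ ∀ᶠ r : ℝ in atTop,
      kerInt (r * δ) 0 (fun t => matNorm (offPart a (V t))) ≤ C / r := by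
  have hc : ∀ k l, ContinuousWithinAt (fun t => offPart a (V t) k l) (Icc (0 : ℝ) 1) 0 := by
    intro k l
    simp only [offPart, Matrix.of_apply]
    split_ifs with h
    · exact hV0 k l h.1 h.2
    · exact continuousWithinAt_const
  choose c hc0 hc1 using fun k l => exists_laplace_le (integrable_offPart a hV k l) (hc k l) hδ
  refine ⟨∑ k, ∑ l, c k l, Finset.sum_nonneg fun k _ => Finset.sum_nonneg fun l _ => hc0 k l, ?_⟩
  filter_upwards [eventually_all.2 fun k => eventually_all.2 fun l => hc1 k l] with r hr
  simp only [matNorm]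
  rw [kerInt_sum _ fun k _ => integrable_finsetSum _ fun l _ => (integrable_offPart a hV k l).norm,
    Finset.sum_div]
  refine Finset.sum_le_sum fun k _ => ?_
  rw [kerInt_sum _ fun l _ => (integrable_offPart a hV k l).norm, Finset.sum_div]
  refine Finset.sum_le_sum fun l _ => ?_
  rw [kerInt_zero_eq]
  exact hr k l

/-- The asymptotic formula for the values at `0` of the components which decay from `1`. -/
theorem eventually_norm_add_le (hV : ∀ j k, IntegrableOn (fun t => V t j k) (Icc (0 : ℝ) 1))
    {δ : ℝ} (hδ : 0 < δ) (ha : ∀ j, 2 * δ ≤ |(a j).re|)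
    (hV0 : ∀ k l, 0 < (a k).re → (a l).re < 0 →
      ContinuousWithinAt (fun t => V t k l) (Icc (0 : ℝ) 1) 0) {ε : ℝ} (hε : 0 < ε) :
    ∀ᶠ r : ℝ in atTop, ∀ y f, RaySol a V r y f → ∀ k, 0 < (a k).re →
      ‖y k 0 + (r : ℂ)⁻¹ * ∑ l, (if (a l).re < 0 then V 0 k l / (a k - a l) * y l 0 else 0)‖
        ≤ ε / r * (∑ j, ‖endVal a y j‖) + 4 * sumL1 f := by
  obtain ⟨C, hC, hη⟩ := exists_kerInt_offPart_le hV hδ hV0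
  -- With η = C/r this makes 6κη at most ε/(4r). The term 4 exp(-rδ) takes another ε/(4r), and
  -- replacing the Laplace integrals by their limits the remaining ε/(2r).
  set κ := min (1 / 2) (ε / (24 * (C + 1))) with hκdef
  have hκ0 : 0 < κ := lt_min (by norm_num) (by positivity)
  have hκ1 : 6 * κ * C ≤ ε / 4 := by
    have h1 : κ ≤ ε / (24 * (C + 1)) := min_le_right _ _
    rw [le_div_iff₀ (by positivity)] at h1
    nlinarith
  obtain ⟨K₀, _, hκ⟩ := exists_kernel_integral_le (integrable_matNorm hV)
    (fun t => matNorm_nonneg _) hκ0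
  have hlap : ∀ᶠ r : ℝ in atTop, ∀ k l, 0 < (a k).re → (a l).re < 0 →
      ‖r * (∫ t in Icc (0 : ℝ) 1, Complex.exp (-(r * (a k - a l) * t)) * V t k l)
        - V 0 k l / (a k - a l)‖ ≤ ε / 2 := by
    refine eventually_all.2 fun k => eventually_all.2 fun l => ?_
    by_cases hkl : 0 < (a k).re ∧ (a l).re < 0
    · have hre : 0 < (a k - a l).re := by rw [Complex.sub_re]; linarith [hkl.1, hkl.2]
      have h1 := tendsto_laplace (hV k l) (hV0 k l hkl.1 hkl.2) hre
      filter_upwards [Metric.tendsto_nhds.1 h1 _ (half_pos hε)] with r hr _ _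
      rw [dist_eq_norm] at hr
      exact hr.le
    · exact Eventually.of_forall fun r h1 h2 => absurd ⟨h1, h2⟩ hkl
  filter_upwards [hη, hlap, eventually_gt_atTop 0, eventually_ge_atTop (K₀ / δ),
    (tendsto_mul_exp_neg hδ 4).eventually_lt_const (by positivity : 0 < ε / 4)]
    with r h1 h2 hr h3 h4 y f h k hk
  have hκr : ∀ x, kerInt (r * δ) x (fun t => matNorm (V t)) ≤ κ :=
    hκ _ ((div_le_iff₀ hδ).1 h3)
  have h5 := h.norm_add_integral_le hV hδ hr.le ha hκ0.le (min_le_left _ _) hκr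
    (by positivity) h1 hk
  set A := ∑ j, ‖endVal a y j‖ with hA
  have hA0 : 0 ≤ A := by positivity
  have hr' : (r : ℂ) ≠ 0 := by exact_mod_cast hr.ne'
  have h6 : (6 * κ * (C / r) + 4 * Real.exp (-(r * δ))) ≤ ε / 2 / r := by
    rw [le_div_iff₀ hr, add_mul]
    have : 6 * κ * (C / r) * r = 6 * κ * C := by field_simp
    rw [this]
    linarith
  have h7 : ‖(r : ℂ)⁻¹ * (∑ l, (if (a l).re < 0 then V 0 k l / (a k - a l) * y l 0 else 0))
      - ∑ l, (if (a l).re < 0 then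
      (∫ t in Icc (0 : ℝ) 1, Complex.exp (-(r * (a k - a l) * t)) * V t k l) * y l 0 else 0)‖
      ≤ ε / 2 / r * A := by
    rw [Finset.mul_sum, ← Finset.sum_sub_distrib, hA, Finset.mul_sum]
    refine (norm_sum_le _ _).trans (Finset.sum_le_sum fun l _ => ?_)
    by_cases hl : (a l).re < 0
    · rw [if_pos hl, if_pos hl, endVal, if_pos hl]
      have h8 := h2 k l hk hl
      set J := ∫ t in Icc (0 : ℝ) 1, Complex.exp (-(r * (a k - a l) * t)) * V t k l
      have h9 : (r : ℂ)⁻¹ * (V 0 k l / (a k - a l) * y l 0) - J * y l 0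
          = -((r : ℂ)⁻¹ * (r * J - V 0 k l / (a k - a l)) * y l 0) := by
        field_simp; ring
      rw [h9, norm_neg, norm_mul, norm_mul, norm_inv, Complex.norm_real,
        Real.norm_of_nonneg hr.le]
      refine mul_le_mul_of_nonneg_right ?_ (norm_nonneg _)
      rw [div_eq_inv_mul (ε / 2) r]
      exact mul_le_mul_of_nonneg_left h8 (by positivity)
    · rw [if_neg hl, if_neg hl]
      simp only [mul_zero, sub_zero, norm_zero]
      positivity
  have h10 := mul_le_mul_of_nonneg_right h6 hA0
  have h11 : ε / r * A = ε / 2 / r * A + ε / 2 / r * A := by ring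
  have h12 := norm_add_le (y k 0 + ∑ l, (if (a l).re < 0 then
      (∫ t in Icc (0 : ℝ) 1, Complex.exp (-(r * (a k - a l) * t)) * V t k l) * y l 0 else 0))
    ((r : ℂ)⁻¹ * (∑ l, (if (a l).re < 0 then V 0 k l / (a k - a l) * y l 0 else 0))
      - ∑ l, (if (a l).re < 0 then
      (∫ t in Icc (0 : ℝ) 1, Complex.exp (-(r * (a k - a l) * t)) * V t k l) * y l 0 else 0))
  rw [add_add_sub_cancel] at h12
  linarith

end Asymptotics

end BVP
end

noncomputable section
namespace BVP

/-! ### Reflection of the interval -/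

section Reflection

variable {n : ℕ} {a : Fin n → ℂ} {V : ℝ → Matrix (Fin n) (Fin n) ℂ} {r : ℝ}
  {y f : Fin n → ℝ → ℂ}

theorem integrableOn_reflect {F : Type*} [NormedAddCommGroup F] {h : ℝ → F}
    (hh : IntegrableOn h (Icc (0 : ℝ) 1)) : IntegrableOn (fun t => h (1 - t)) (Icc (0 : ℝ) 1) := by
  rw [← intervalIntegrable_iff_integrableOn_Icc_of_le zero_le_one] at hh ⊢
  simpa using (hh.comp_sub_left 1).symm

theorem integral_reflect (h : ℝ → ℝ) :
    ∫ t in Icc (0 : ℝ) 1, h (1 - t) = ∫ t in Icc (0 : ℝ) 1, h t := by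
  rw [integral_Icc_eq_integral_Ioc, integral_Icc_eq_integral_Ioc,
    ← intervalIntegral.integral_of_le zero_le_one, ← intervalIntegral.integral_of_le zero_le_one,
    intervalIntegral.integral_comp_sub_left]
  simp

theorem reflect_mem {x : ℝ} (hx : x ∈ Icc (0 : ℝ) 1) : 1 - x ∈ Icc (0 : ℝ) 1 :=
  ⟨by linarith [hx.2], by linarith [hx.1]⟩

/-- The substitution t ↦ 1 - t changes the sign of a, V and f and exchanges the two groups of
components, so the asymptotics at 1 follow from those at 0. -/
theorem RaySol.reflect (h : RaySol a V r y f)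
    (hV : ∀ j k, IntegrableOn (fun t => V t j k) (Icc (0 : ℝ) 1)) :
    RaySol (fun j => -a j) (fun t => -V (1 - t)) r (fun j t => y j (1 - t))
      (fun j t => -f j (1 - t)) where
  continuous j := (h.continuous j).comp (by fun_prop)
  integrable j := (integrableOn_reflect (h.integrable j)).neg
  eq j x hx := by
    set F : ℝ → ℂ := fun t => r * a j * y j t + sysRhs V y f j t with hF
    have hFi : IntegrableOn F (Icc (0 : ℝ) 1) :=
      ((h.continuous j).integrableOn_Icc.const_mul (r * a j)).add (h.integrable_sysRhs hV j)
    have h1 := h.eq j 1 (by simp)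
    have h2 := h.eq j (1 - x) (reflect_mem hx)
    have h3 : ∫ t in (0 : ℝ)..x, (r * -a j * y j (1 - t) + sysRhs (fun t => -V (1 - t))
        (fun j t => y j (1 - t)) (fun j t => -f j (1 - t)) j t) = -∫ t in (1 - x)..1, F t := by
      have h4 := intervalIntegral.integral_comp_sub_left F (a := 0) (b := x) 1
      rw [sub_zero] at h4
      rw [← h4, ← intervalIntegral.integral_neg]
      congr 1; funext t
      simp only [hF, sysRhs, Matrix.neg_apply, neg_mul, Finset.sum_neg_distrib]
      ring
    have hz : (0 : ℝ) ∈ Icc (0 : ℝ) 1 := by simp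
    have ho : (1 : ℝ) ∈ Icc (0 : ℝ) 1 := by simp
    have h5 := intervalIntegral.integral_add_adjacent_intervals
      (intervalIntegrable_of_Icc hFi hz (reflect_mem hx))
      (intervalIntegrable_of_Icc hFi (reflect_mem hx) ho)
    rw [h3, sub_zero, h1, h2, ← h5]
    ring

theorem endVal_reflect (ha : ∀ j, (a j).re ≠ 0) (y : Fin n → ℝ → ℂ) (j : Fin n) :
    endVal (fun j => -a j) (fun j t => y j (1 - t)) j = endVal a y j := by
  simp only [endVal, Complex.neg_re, sub_zero, sub_self]
  rcases lt_or_gt_of_ne (ha j) with h | h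
  · rw [if_neg (by linarith), if_pos h]
  · rw [if_pos (by linarith), if_neg (by linarith)]

theorem sumL1_reflect (f : Fin n → ℝ → ℂ) : sumL1 (fun j t => -f j (1 - t)) = sumL1 f := by
  refine Finset.sum_congr rfl fun j _ => ?_
  simp only [norm_neg]
  exact integral_reflect fun t => ‖f j t‖

/-- The value of the `j`th component at the end point to which it decays. -/
def farVal (a : Fin n → ℂ) (y : Fin n → ℝ → ℂ) (j : Fin n) : ℂ :=
  if (a j).re < 0 then y j 1 else y j 0

/-- The coefficients of the first order coupling between the components. -/
def coupling (a : Fin n → ℂ) (V : ℝ → Matrix (Fin n) (Fin n) ℂ) : Matrix (Fin n) (Fin n) ℂ :=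
  Matrix.of fun j l =>
    if 0 < (a j).re ∧ (a l).re < 0 then V 0 j l / (a j - a l)
    else if (a j).re < 0 ∧ 0 < (a l).re then V 1 j l / (a j - a l) else 0

/-- The asymptotics at 0 for the original and for the reflected system. Under reflection both V and
a_j - a_l change sign, so the quotients keep the same form. -/
theorem eventually_norm_farVal_le (hV : ∀ j k, IntegrableOn (fun t => V t j k) (Icc (0 : ℝ) 1))
    {δ : ℝ} (hδ : 0 < δ) (ha : ∀ j, 2 * δ ≤ |(a j).re|)
    (hV0 : ∀ k l, 0 < (a k).re → (a l).re < 0 →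
      ContinuousWithinAt (fun t => V t k l) (Icc (0 : ℝ) 1) 0)
    (hV1 : ∀ k l, (a k).re < 0 → 0 < (a l).re →
      ContinuousWithinAt (fun t => V t k l) (Icc (0 : ℝ) 1) 1) {ε : ℝ} (hε : 0 < ε) :
    ∀ᶠ r : ℝ in atTop, ∀ y f, RaySol a V r y f → ∀ j,
      ‖farVal a y j + (r : ℂ)⁻¹ * (coupling a V *ᵥ endVal a y) j‖
        ≤ ε / r * (∑ j, ‖endVal a y j‖) + 4 * sumL1 f := by
  have hne : ∀ j, (a j).re ≠ 0 := fun j h0 => by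
    have := ha j; rw [h0, abs_zero] at this; linarith
  have hV' : ∀ j k, IntegrableOn (fun t => (-V (1 - t)) j k) (Icc (0 : ℝ) 1) := fun j k =>
    (integrableOn_reflect (hV j k)).neg
  have hc : ∀ k l, 0 < (-a k).re → (-a l).re < 0 →
      ContinuousWithinAt (fun t => (-V (1 - t)) k l) (Icc (0 : ℝ) 1) 0 := by
    intro k l hk hl
    rw [Complex.neg_re] at hk hl
    have h1 := hV1 k l (by linarith) (by linarith)
    have h2 : ContinuousWithinAt (fun t : ℝ => 1 - t) (Icc (0 : ℝ) 1) 0 := by fun_prop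
    have h3 : ContinuousWithinAt (fun t => V t k l) (Icc (0 : ℝ) 1) ((fun t : ℝ => 1 - t) 0) := by
      simpa using h1
    exact (h3.comp h2 fun t ht => reflect_mem ht).neg
  filter_upwards [eventually_norm_add_le hV hδ ha hV0 hε,
    eventually_norm_add_le hV' hδ (a := fun j => -a j) (by simpa using ha) hc hε]
    with r h1 h2 y f h j
  rcases lt_or_gt_of_ne (hne j) with hj | hj
  · have h3 := h2 _ _ (h.reflect hV) j (by rw [Complex.neg_re]; linarith)
    rw [sumL1_reflect] at h3
    simp only [endVal_reflect hne] at h3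
    rw [farVal, if_pos hj]
    have hs : (coupling a V *ᵥ endVal a y) j = ∑ l, (if (-a l).re < 0 then
        (-V (1 - 0)) j l / (-a j - -a l) * y l (1 - 0) else 0) := by
      rw [Matrix.mulVec, dotProduct]
      refine Finset.sum_congr rfl fun l _ => ?_
      simp only [coupling, Matrix.of_apply, endVal, Complex.neg_re, sub_zero, Matrix.neg_apply]
      rcases lt_or_gt_of_ne (hne l) with hl | hl
      · simp only [hj, hl, hj.not_gt, hl.not_gt, and_false, false_and, if_false,
          neg_lt_zero, zero_mul]
      · have hq : -V 1 j l / (-a j - -a l) = V 1 j l / (a j - a l) := by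
          rw [← neg_div_neg_eq]; congr 1 <;> ring
        simp only [hj, hl, hj.not_gt, hl.not_gt, and_self, if_true, if_false, neg_lt_zero, hq]
    rw [hs]
    simpa only [sub_zero] using h3
  · have h3 := h1 _ _ h j hj
    rw [farVal, if_neg (by linarith)]
    have hs : (coupling a V *ᵥ endVal a y) j
        = ∑ l, (if (a l).re < 0 then V 0 j l / (a j - a l) * y l 0 else 0) := by
      rw [Matrix.mulVec, dotProduct]
      refine Finset.sum_congr rfl fun l _ => ?_
      simp only [coupling, Matrix.of_apply, endVal]
      rcases lt_or_gt_of_ne (hne l) with hl | hl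
      · simp only [hj, hl, and_self, if_true]
      · simp only [hj, hl, hj.not_gt, hl.not_gt, and_false, false_and, if_false, zero_mul]
    rw [hs]
    exact h3

end Reflection

/-! ### Perturbed determinants -/

section Determinant

variable {n : ℕ}

/-- The product rule in the Leibniz expansion, with the terms collected according to the
differentiated column. -/
theorem hasDerivAt_det_add_smul (T S : Matrix (Fin n) (Fin n) ℂ) :
    HasDerivAt (fun s : ℂ => (T + s • S).det) (∑ l, (T.updateCol l fun i => S i l).det) 0 := by
  have h1 : ∀ (σ : Equiv.Perm (Fin n)), HasDerivAt
      (fun s : ℂ => ((Equiv.Perm.sign σ : ℤ) : ℂ) * ∏ i, (T + s • S) (σ i) i)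
      (((Equiv.Perm.sign σ : ℤ) : ℂ) * ∑ l, (∏ i ∈ Finset.univ.erase l, T (σ i) i) • S (σ l) l)
      0 := by
    intro σ
    refine HasDerivAt.const_mul _ ?_
    have h2 := HasDerivAt.fun_finsetProd (u := Finset.univ)
      (f := fun i (s : ℂ) => (T + s • S) (σ i) i) (f' := fun i => S (σ i) i) (x := 0)
      (fun i _ => by
        simp only [Matrix.add_apply, Matrix.smul_apply, smul_eq_mul]
        simpa using ((hasDerivAt_id (0 : ℂ)).mul_const (S (σ i) i)).const_add (T (σ i) i))
    simpa using h2
  have h3 := HasDerivAt.fun_sum (u := Finset.univ) fun σ _ => h1 σ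
  have h4 : (fun s : ℂ => (T + s • S).det) = fun s => ∑ σ : Equiv.Perm (Fin n),
      ((Equiv.Perm.sign σ : ℤ) : ℂ) * ∏ i, (T + s • S) (σ i) i :=
    funext fun s => Matrix.det_apply' _
  rw [h4]
  refine h3.congr_deriv (Eq.symm ?_)
  rw [Finset.sum_congr rfl fun l _ => Matrix.det_apply' (T.updateCol l fun i => S i l),
    Finset.sum_comm]
  refine Finset.sum_congr rfl fun σ _ => ?_
  rw [Finset.mul_sum]
  refine Finset.sum_congr rfl fun l _ => ?_
  rw [← Finset.prod_erase_mul _ _ (Finset.mem_univ l), Matrix.updateCol_self, smul_eq_mul]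
  congr 2
  refine Finset.prod_congr rfl fun i hi => ?_
  rw [Matrix.updateCol_ne (Finset.ne_of_mem_erase hi)]

/-- In s = 1/r the determinant has either a nonzero value or a nonzero derivative at 0. -/
theorem exists_le_norm_det (T S : Matrix (Fin n) (Fin n) ℂ)
    (h : T.det ≠ 0 ∨ ∑ l, (T.updateCol l fun i => S i l).det ≠ 0) :
    ∃ c, 0 < c ∧ ∀ᶠ r : ℝ in atTop, c / r ≤ ‖(T + (r : ℂ)⁻¹ • S).det‖ := by
  set F : ℂ → ℂ := fun s => (T + s • S).det with hF
  have hd := hasDerivAt_det_add_smul T S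
  set D := ∑ l, (T.updateCol l fun i => S i l).det with hD
  have hF0 : F 0 = T.det := by simp [hF]
  have hlim : Tendsto (fun r : ℝ => (r : ℂ)⁻¹) atTop (𝓝 0) := by
    have := (Complex.continuous_ofReal.tendsto 0).comp tendsto_inv_atTop_zero
    simpa [Function.comp_def] using this
  by_cases hT : T.det = 0
  · have hD0 : D ≠ 0 := h.resolve_left (not_not.2 hT)
    have hlim' : Tendsto (fun r : ℝ => (r : ℂ)⁻¹) atTop (𝓝[≠] 0) := by
      refine tendsto_nhdsWithin_iff.2 ⟨hlim, ?_⟩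
      filter_upwards [eventually_gt_atTop 0] with r hr
      exact inv_ne_zero (by exact_mod_cast hr.ne')
    have h1 := ((hasDerivAt_iff_tendsto_slope.1 hd).comp hlim').norm
    refine ⟨‖D‖ / 2, by positivity, ?_⟩
    filter_upwards [h1.eventually_const_lt (half_lt_self (norm_pos_iff.2 hD0)),
      eventually_gt_atTop 0] with r h2 hr
    simp only [Function.comp_apply, slope_def_field, sub_zero] at h2
    change ‖D‖ / 2 < ‖(F _ - F 0) / _‖ at h2
    rw [hF0, hT, sub_zero, norm_div, norm_inv, Complex.norm_real, Real.norm_of_nonneg hr.le,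
      div_inv_eq_mul] at h2
    rw [div_le_iff₀ hr]
    exact h2.le
  · have h1 := (hd.continuousAt.tendsto.comp hlim).norm
    change Tendsto _ _ (𝓝 ‖F 0‖) at h1
    rw [hF0] at h1
    refine ⟨‖T.det‖ / 2, by have := norm_pos_iff.2 hT; positivity, ?_⟩
    filter_upwards [h1.eventually_const_lt (half_lt_self (norm_pos_iff.2 hT)),
      eventually_ge_atTop 1] with r h2 hr
    refine le_trans ?_ h2.le
    exact div_le_self (by positivity) hr

theorem sum_norm_mulVec_le (M : Matrix (Fin n) (Fin n) ℂ) (v : Fin n → ℂ) :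
    ∑ i, ‖(M *ᵥ v) i‖ ≤ matNorm M * ∑ k, ‖v k‖ := by
  rw [matNorm, Finset.sum_mul]
  refine Finset.sum_le_sum fun i _ => ?_
  rw [Finset.sum_mul]
  change ‖∑ k, M i k * v k‖ ≤ _
  refine (norm_sum_le _ _).trans (Finset.sum_le_sum fun k _ => ?_)
  rw [norm_mul]
  exact mul_le_mul_of_nonneg_left (Finset.single_le_sum (f := fun k => ‖v k‖)
    (fun _ _ => norm_nonneg _) (Finset.mem_univ k)) (norm_nonneg _)

/-- If the determinant of `T + S / r` is at least of the order `1 / r`, then the solutions of linear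
systems with this matrix are at most of the order `r`. -/
theorem exists_sum_norm_le (T S : Matrix (Fin n) (Fin n) ℂ)
    (h : T.det ≠ 0 ∨ ∑ l, (T.updateCol l fun i => S i l).det ≠ 0) :
    ∃ K, 0 ≤ K ∧ ∀ᶠ r : ℝ in atTop, ∀ v : Fin n → ℂ,
      ∑ i, ‖v i‖ ≤ K * r * ∑ i, ‖((T + (r : ℂ)⁻¹ • S) *ᵥ v) i‖ := by
  obtain ⟨c, hc, hdet⟩ := exists_le_norm_det T S h
  have hlim : Tendsto (fun r : ℝ => (r : ℂ)⁻¹) atTop (𝓝 0) := by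
    have := (Complex.continuous_ofReal.tendsto 0).comp tendsto_inv_atTop_zero
    simpa [Function.comp_def] using this
  have hcont : Continuous fun s : ℂ => matNorm (T + s • S).adjugate := by
    have h1 : Continuous fun s : ℂ => (T + s • S).adjugate :=
      (continuous_const.add (continuous_id.smul continuous_const)).matrix_adjugate
    refine continuous_finsetSum _ fun i _ => continuous_finsetSum _ fun j _ => ?_
    exact (h1.matrix_elem i j).norm
  have hadj := (hcont.tendsto 0).comp hlim
  set B := matNorm (T + (0 : ℂ) • S).adjugate + 1 with hB
  have hB0 : 0 < B := by have := matNorm_nonneg (T + (0 : ℂ) • S).adjugate; positivity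
  refine ⟨B / c, by positivity, ?_⟩
  filter_upwards [hdet, hadj.eventually_lt_const (lt_add_one _), eventually_gt_atTop 0]
    with r h1 h2 hr v
  set M := T + (r : ℂ)⁻¹ • S with hM
  have h3 : M.adjugate *ᵥ (M *ᵥ v) = M.det • v := by
    rw [Matrix.mulVec_mulVec, Matrix.adjugate_mul, Matrix.smul_mulVec, Matrix.one_mulVec]
  have h4 := sum_norm_mulVec_le M.adjugate (M *ᵥ v)
  rw [h3] at h4
  simp only [Pi.smul_apply, norm_smul, ← Finset.mul_sum] at h4
  have h5 : matNorm M.adjugate ≤ B := le_of_lt h2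
  set A := ∑ i, ‖v i‖ with hA
  set G := ∑ i, ‖(M *ᵥ v) i‖ with hG
  have hA0 : 0 ≤ A := by positivity
  have hG0 : 0 ≤ G := by positivity
  have h6 : c / r * A ≤ B * G :=
    (mul_le_mul_of_nonneg_right h1 hA0).trans (h4.trans (mul_le_mul_of_nonneg_right h5 hG0))
  calc A = (c / r * A) * (r / c) := by field_simp
    _ ≤ (B * G) * (r / c) := mul_le_mul_of_nonneg_right h6 (by positivity)
    _ = B / c * r * G := by ring

end Determinant

end BVP
end

noncomputable section
namespace BVP

/-! ### The estimate on rays -/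

section Ray

variable {n : ℕ}

/-- The matrix of the boundary conditions at the end points to which the components decay. -/
def farMatrix (a : Fin n → ℂ) (C D : Matrix (Fin n) (Fin n) ℂ) : Matrix (Fin n) (Fin n) ℂ :=
  Matrix.of fun i k => if (a k).re < 0 then D i k else C i k

/-- The columns of C and D are regrouped by the end from which the component decays; this is how the
matrix T_{izB} enters. -/
theorem boundary_eq (a : Fin n → ℂ) (C D : Matrix (Fin n) (Fin n) ℂ) (y : Fin n → ℝ → ℂ) :
    C *ᵥ (fun j => y j 0) + D *ᵥ (fun j => y j 1)
      = TMatrix a C D *ᵥ endVal a y + farMatrix a C D *ᵥ farVal a y := by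
  ext i
  simp only [Pi.add_apply, Matrix.mulVec, dotProduct, ← Finset.sum_add_distrib]
  refine Finset.sum_congr rfl fun j _ => ?_
  simp only [TMatrix, farMatrix, endVal, farVal, Matrix.of_apply]
  split_ifs
  · rfl
  · rw [add_comm]

theorem det_updateCol_neg_mul (T X Y : Matrix (Fin n) (Fin n) ℂ) (l : Fin n) :
    (T.updateCol l fun i => (-(X * Y)) i l).det
      = ∑ j, -Y j l * (T.updateCol l fun i => X i j).det := by
  have h1 : (fun i => (-(X * Y)) i l) = ∑ j, (-Y j l) • fun i => X i j := by
    ext i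
    simp only [Matrix.neg_apply, Matrix.mul_apply, Finset.sum_apply, Pi.smul_apply, smul_eq_mul,
      ← Finset.sum_neg_distrib]
    exact Finset.sum_congr rfl fun j _ => by ring
  rw [h1]
  have h2 : ∀ v : Fin n → ℂ, (T.updateCol l v).det = T.cramer v l := fun v =>
    (Matrix.cramer_apply T v l).symm
  simp only [h2, map_sum, map_smul, Finset.sum_apply, Pi.smul_apply, smul_eq_mul]

/-- Identifies the derivative of the perturbed determinant as ω₁(z)/z. Here a_j - a_l = i(b_j -
b_l)z while the entries of V are -i b_j q_{jl}, so the factors i cancel and one factor z is left.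
The terms at 0 come from the columns of C, those at 1 from the columns of D. -/
theorem omega1_eq {b : Fin n → ℂ} (Q : ℝ → Matrix (Fin n) (Fin n) ℂ)
    (C D : Matrix (Fin n) (Fin n) ℂ) {z : ℂ} (hz : Admissible b z) :
    omega1 b Q C D z = z * ∑ l, ((TizB b C D z).updateCol l fun i =>
      (-(farMatrix (fun j => Complex.I * b j * z) C D *
        coupling (fun j => Complex.I * b j * z) (potMat b Q))) i l).det := by
  set a : Fin n → ℂ := fun j => Complex.I * b j * z with ha
  set T := TizB b C D z with hT
  simp only [det_updateCol_neg_mul]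
  set X : Fin n → Fin n → ℂ := fun j k => if (a j).re < 0 ∧ 0 < (a k).re then
    ((T.updateCol j fun i => C i k).det * b k * Q 0 k j) / (b k - b j) else 0 with hX
  set Y : Fin n → Fin n → ℂ := fun j k => if (a j).re < 0 ∧ 0 < (a k).re then
    -((T.updateCol k fun i => D i j).det * b j * Q 1 j k) / (b k - b j) else 0 with hY
  have h1 : omega1 b Q C D z = ∑ j, ∑ k, (X j k + Y j k) := by
    refine Finset.sum_congr rfl fun j _ => Finset.sum_congr rfl fun k _ => ?_
    simp only [hX, hY, ha, hT]
    split_ifs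
    · ring
    · rw [add_zero]
  have h2 : ∀ l j, z * (-coupling a (potMat b Q) j l *
      (T.updateCol l fun i => farMatrix a C D i j).det) = X l j + Y j l := by
    intro l j
    have hz0 : z ≠ 0 := by
      rintro rfl
      exact hz l (by simp)
    have hI := Complex.I_ne_zero
    have hdiff : ∀ p q : Fin n, (a p).re < 0 → 0 < (a q).re → b p - b q ≠ 0 := by
      intro p q hp hq h
      have : a p = a q := by simp only [ha, sub_eq_zero.1 h]
      rw [this] at hp
      exact lt_asymm hp hq
    have hsub : ∀ p q : Fin n, a p - a q = Complex.I * (b p - b q) * z := fun p q => by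
      simp only [ha]; ring
    simp only [coupling, hX, hY, Matrix.of_apply, potMat, hsub]
    rcases lt_or_gt_of_ne (hz l) with hl | hl <;> rcases lt_or_gt_of_ne (hz j) with hj | hj
    · have hl' : (a l).re < 0 := hl
      have hj' : (a j).re < 0 := hj
      simp [hl'.not_gt, hj'.not_gt]
    · have hl' : (a l).re < 0 := hl
      have hj' : 0 < (a j).re := hj
      have hfar : (fun i => farMatrix a C D i j) = fun i => C i j := by
        funext i; simp [farMatrix, hj'.not_gt]
      have h3 : b j - b l ≠ 0 := sub_ne_zero.2 (sub_ne_zero.1 (hdiff l j hl' hj')).symm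
      simp only [hl', hj', hl'.not_gt, hj'.not_gt, and_self, if_true, if_false, hfar]
      field_simp
      ring
    · have hl' : 0 < (a l).re := hl
      have hj' : (a j).re < 0 := hj
      have hfar : (fun i => farMatrix a C D i j) = fun i => D i j := by
        funext i; simp [farMatrix, hj']
      have h3 : b j - b l ≠ 0 := hdiff j l hj' hl'
      have h4 : b l - b j ≠ 0 := sub_ne_zero.2 (sub_ne_zero.1 h3).symm
      have h5 : b j - b l = -(b l - b j) := by ring
      simp only [hl', hj', hl'.not_gt, hj'.not_gt, and_self, if_true, if_false, hfar]
      rw [h5]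
      field_simp
      ring
    · have hl' : 0 < (a l).re := hl
      have hj' : 0 < (a j).re := hj
      simp [hl'.not_gt, hj'.not_gt]
  rw [h1]
  simp only [Finset.mul_sum, h2, Finset.sum_add_distrib]
  congr 1
  exact Finset.sum_comm

/-- Substituting the asymptotics of the far values into the boundary condition gives a linear system
with matrix T + S/r for the end values, up to an error o(1/r) times these values plus a multiple of
the size of f. The inverse is O(r), so the first error can be absorbed. -/
theorem exists_sum_endVal_le {a : Fin n → ℂ} {V : ℝ → Matrix (Fin n) (Fin n) ℂ}
    (hV : ∀ j k, IntegrableOn (fun t => V t j k) (Icc (0 : ℝ) 1))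
    {δ : ℝ} (hδ : 0 < δ) (ha : ∀ j, 2 * δ ≤ |(a j).re|)
    (hV0 : ∀ k l, 0 < (a k).re → (a l).re < 0 →
      ContinuousWithinAt (fun t => V t k l) (Icc (0 : ℝ) 1) 0)
    (hV1 : ∀ k l, (a k).re < 0 → 0 < (a l).re →
      ContinuousWithinAt (fun t => V t k l) (Icc (0 : ℝ) 1) 1)
    (C D : Matrix (Fin n) (Fin n) ℂ)
    (hdet : (TMatrix a C D).det ≠ 0 ∨ ∑ l, ((TMatrix a C D).updateCol l fun i =>
      (-(farMatrix a C D * coupling a V)) i l).det ≠ 0) :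
    ∃ K, 0 ≤ K ∧ ∀ᶠ r : ℝ in atTop, ∀ y f, RaySol a V r y f →
      C *ᵥ (fun j => y j 0) + D *ᵥ (fun j => y j 1) = 0 →
      ∑ j, ‖endVal a y j‖ ≤ K * r * sumL1 f := by
  set T := TMatrix a C D with hT
  set X := farMatrix a C D with hX
  set m := coupling a V with hm
  obtain ⟨K, hK, hsolve⟩ := exists_sum_norm_le T (-(X * m)) hdet
  set L := K * matNorm X * n with hL
  have hX0 := matNorm_nonneg X
  have hL0 : 0 ≤ L := by positivity
  -- The asymptotic error, amplified by L·r, is then at most half of A and moves to the left-hand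
  -- side.
  have hε : 0 < 1 / (2 * (L + 1)) := by positivity
  refine ⟨8 * L, by positivity, ?_⟩
  filter_upwards [hsolve, eventually_norm_farVal_le hV hδ ha hV0 hV1 hε, eventually_gt_atTop 0]
    with r h1 h2 hr y f h hbd
  set A := ∑ j, ‖endVal a y j‖ with hA
  set G := sumL1 f with hG
  have hA0 : 0 ≤ A := by positivity
  have hG0 : 0 ≤ G := sumL1_nonneg f
  set err : Fin n → ℂ := fun j => farVal a y j + (r : ℂ)⁻¹ * (m *ᵥ endVal a y) j with herr
  have h3 : (T + (r : ℂ)⁻¹ • -(X * m)) *ᵥ endVal a y = -(X *ᵥ err) := by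
    have h4 : err = farVal a y + (r : ℂ)⁻¹ • (m *ᵥ endVal a y) := rfl
    rw [boundary_eq a] at hbd
    rw [h4, Matrix.add_mulVec, Matrix.smul_mulVec, Matrix.neg_mulVec, Matrix.mulVec_add,
      Matrix.mulVec_smul, Matrix.mulVec_mulVec, eq_neg_of_add_eq_zero_left hbd]
    module
  have h4 : ∑ i, ‖((T + (r : ℂ)⁻¹ • -(X * m)) *ᵥ endVal a y) i‖
      ≤ matNorm X * (n * (1 / (2 * (L + 1)) / r * A + 4 * G)) := by
    rw [h3]
    simp only [Pi.neg_apply, norm_neg]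
    refine (sum_norm_mulVec_le X err).trans (mul_le_mul_of_nonneg_left ?_ hX0)
    refine (Finset.sum_le_sum fun j _ => h2 y f h j).trans (le_of_eq ?_)
    rw [Finset.sum_const, Finset.card_univ, Fintype.card_fin, nsmul_eq_mul]
  have h5 : A ≤ L * r * (1 / (2 * (L + 1)) / r * A + 4 * G) := by
    refine (h1 _).trans ((mul_le_mul_of_nonneg_left h4 (by positivity)).trans (le_of_eq ?_))
    rw [hL]; ring
  have h6 : L * r * (1 / (2 * (L + 1)) / r * A + 4 * G)
      = L / (2 * (L + 1)) * A + 4 * L * r * G := by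
    field_simp
  have h7 : L / (2 * (L + 1)) ≤ 1 / 2 := by
    rw [div_le_iff₀ (by positivity)]; linarith
  have h8 := mul_le_mul_of_nonneg_right h7 hA0
  rw [h6] at h5
  linarith

theorem raySol_of_eq {b : Fin n → ℂ} (hb : ∀ j, b j ≠ 0) {Q : ℝ → Matrix (Fin n) (Fin n) ℂ}
    (hQ : ∀ j k, IntegrableOn (fun x => Q x j k) (Icc (0 : ℝ) 1))
    (C D : Matrix (Fin n) (Fin n) ℂ) {z : ℂ} {r : ℝ} {y : Path n} {g : L2 n}
    (h : y = (bvpModel hb hQ C D).cst ((bvpModel hb hQ C D).init y) + (bvpModel hb hQ C D).pot y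
      + (r * z : ℂ) • (bvpModel hb hQ C D).prim ((bvpModel hb hQ C D).emb y)
      + (bvpModel hb hQ C D).prim g) :
    RaySol (fun j => Complex.I * b j * z) (potMat b Q) r (fun j x => ext y x j)
      (fun j x => Complex.I * b j * g x j) where
  continuous j := (EuclideanSpace.proj (𝕜 := ℂ) j).continuous.comp (continuous_ext y)
  integrable j := (coord_integrable (integrableOn_L2 g) j).const_mul _
  eq j x hx := by
    set G : L2 n := (r * z : ℂ) • embL n y + g with hG
    have h1 : y = cstL n (evalL n 0 y) + volterra (potMat b Q) (integrable_potMat hQ) y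
        + primL (diagI b) G := by
      rw [hG, map_add, map_smul, ← add_assoc]
      exact h
    rw [ext_equation hQ] at h1
    have hi : IntegrableOn (fun t => mv (potMat b Q t) (ext y t) + mv (diagI b) (G t))
        (Icc (0 : ℝ) 1) :=
      (integrable_mv (integrable_potMat hQ) (continuous_ext y).continuousOn).add
        (integrable_const_mv _ (integrableOn_L2 G))
    have h2 := (EuclideanSpace.proj (𝕜 := ℂ) j).intervalIntegral_comp_comm
      (intervalIntegrable_of_Icc hi (by simp : (0 : ℝ) ∈ Icc (0 : ℝ) 1) hx)
    have h3 := congrArg (fun v : EuclideanSpace ℂ (Fin n) => v j) (h1 x hx)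
    simp only [PiLp.add_apply] at h3
    rw [h3]
    congr 1
    refine h2.symm.trans (intervalIntegral_congr_Icc ?_ hx)
    filter_upwards [Lp.coeFn_add ((r * z : ℂ) • embL n y) g, Lp.coeFn_smul (r * z : ℂ) (embL n y),
      embL_coeFn y] with t e1 e2 e3
    change (mv (potMat b Q t) (ext y t) + mv (diagI b) (G t)) j = _
    rw [PiLp.add_apply, mv_diagI_apply, hG, e1, Pi.add_apply, e2,
      Pi.smul_apply, e3, mv_apply, sysRhs]
    simp only [PiLp.add_apply, PiLp.smul_apply, smul_eq_mul]
    ring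

theorem sumL1_le (b : Fin n → ℂ) (g : L2 n) :
    sumL1 (fun j x => Complex.I * b j * g x j) ≤ (∑ j, ‖b j‖) * ‖g‖ := by
  rw [sumL1, Finset.sum_mul]
  refine Finset.sum_le_sum fun j _ => ?_
  simp only [norm_mul, Complex.norm_I, one_mul]
  rw [integral_const_mul]
  refine mul_le_mul_of_nonneg_left (le_trans ?_ (setIntegral_norm_le g)) (norm_nonneg _)
  exact integral_mono (coord_integrable (integrableOn_L2 g) j).norm (integrableOn_L2 g).norm
    fun t => PiLp.norm_apply_le (g t) j

theorem exists_pos_le_abs_re {a : Fin n → ℂ} (ha : ∀ j, (a j).re ≠ 0) :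
    ∃ δ : ℝ, 0 < δ ∧ ∀ j, 2 * δ ≤ |(a j).re| := by
  have h : ∀ᶠ δ : ℝ in 𝓝[>] 0, ∀ j, 2 * δ ≤ |(a j).re| := by
    refine eventually_all.2 fun j => nhdsWithin_le_nhds ?_
    have h1 : Tendsto (fun δ : ℝ => 2 * δ) (𝓝 0) (𝓝 (2 * 0)) :=
      (continuous_const.mul continuous_id).tendsto 0
    rw [mul_zero] at h1
    exact (h1.eventually_lt_const (abs_pos.2 (ha j))).mono fun _ h => h.le
  obtain ⟨δ, h1, h2⟩ := (h.and self_mem_nhdsWithin).exists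
  exact ⟨δ, h2, h1⟩

/-- Admissibility separates the real parts of the a_j from zero, and the condition on ω₀, ω₁ says
that the determinant does not vanish to second order in 1/r. Entries linking components of opposite
sign have b_j ≠ b_k, so they are continuous at the ends. -/
theorem rayBound_bvpModel {b : Fin n → ℂ} (hb : ∀ j, b j ≠ 0)
    {C D : Matrix (Fin n) (Fin n) ℂ} {Q : ℝ → Matrix (Fin n) (Fin n) ℂ}
    (hQ : ∀ j k, IntegrableOn (fun x => Q x j k) (Icc (0 : ℝ) 1))
    (hQ0 : ∀ j k, b j ≠ b k → ContinuousWithinAt (fun x => Q x j k) (Icc (0 : ℝ) 1) 0)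
    (hQ1 : ∀ j k, b j ≠ b k → ContinuousWithinAt (fun x => Q x j k) (Icc (0 : ℝ) 1) 1)
    {z : ℂ} (hz : Admissible b z) (hω : ‖omega0 b C D z‖ + ‖omega1 b Q C D z‖ ≠ 0) :
    (bvpModel hb hQ C D).RayBound z := by
  set a : Fin n → ℂ := fun j => Complex.I * b j * z with ha
  obtain ⟨δ, hδ, haδ⟩ := exists_pos_le_abs_re (a := a) hz
  have hV := integrable_potMat (b := b) hQ
  have hbne : ∀ p q, (a p).re < 0 → 0 < (a q).re → b p ≠ b q := by
    intro p q hp hq h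
    have : a p = a q := by simp only [ha, h]
    rw [this] at hp
    exact lt_asymm hp hq
  have hV0 : ∀ k l, 0 < (a k).re → (a l).re < 0 →
      ContinuousWithinAt (fun t => potMat b Q t k l) (Icc (0 : ℝ) 1) 0 := fun k l hk hl =>
    continuousWithinAt_const.mul (hQ0 k l (hbne l k hl hk).symm)
  have hV1 : ∀ k l, (a k).re < 0 → 0 < (a l).re →
      ContinuousWithinAt (fun t => potMat b Q t k l) (Icc (0 : ℝ) 1) 1 := fun k l hk hl =>
    continuousWithinAt_const.mul (hQ1 k l (hbne k l hk hl))
  have hdet : (TMatrix a C D).det ≠ 0 ∨ ∑ l, ((TMatrix a C D).updateCol l fun i =>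
      (-(farMatrix a C D * coupling a (potMat b Q))) i l).det ≠ 0 := by
    by_contra! hcon
    apply hω
    have h1 : omega0 b C D z = 0 := hcon.1
    have h2 : omega1 b Q C D z = 0 := by
      rw [omega1_eq Q C D hz]
      exact mul_eq_zero_of_right _ hcon.2
    rw [h1, h2]; simp
  obtain ⟨K, hK, hmain⟩ := exists_sum_endVal_le hV hδ haδ hV0 hV1 C D hdet
  obtain ⟨K₀, _, hκ⟩ := exists_kernel_integral_le (integrable_matNorm hV)
    (fun t => matNorm_nonneg _) (by norm_num : (0 : ℝ) < 1 / 2)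
  obtain ⟨r₀, hr₀⟩ := eventually_atTop.1 ((hmain.and (eventually_ge_atTop (1 : ℝ))).and
    (eventually_ge_atTop (K₀ / δ)))
  -- The crude bound is 2(2A + G), where A ≤ KrG by the estimate of the end values and G ≤ rG
  -- because r ≥ 1; the sum of the ‖b j‖ compares G with ‖g‖.
  refine ⟨(4 * K + 2) * ∑ j, ‖b j‖, r₀, fun r hr y g hbd hy => ?_⟩
  obtain ⟨⟨h1, h2⟩, h3⟩ := hr₀ r hr
  have hsol := raySol_of_eq hb hQ C D hy
  have h4 := h1 _ _ hsol (by
    have h5 : ext y 0 = y 0 := ext_of_mem y (by simp)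
    have h6 : ext y 1 = y 1 := ext_of_mem y (by simp)
    rw [h5, h6]
    exact hbd)
  have hr0 : 0 ≤ r := zero_le_one.trans h2
  have hG := sumL1_le b g
  have hG0 := sumL1_nonneg fun j x => Complex.I * b j * g x j
  set G := sumL1 fun j x => Complex.I * b j * g x j
  have hB : 0 ≤ ∑ j, ‖b j‖ := by positivity
  have hfin : (4 * K + 2) * r * G ≤ (4 * K + 2) * (∑ j, ‖b j‖) * r * ‖g‖ := by
    calc (4 * K + 2) * r * G ≤ (4 * K + 2) * r * ((∑ j, ‖b j‖) * ‖g‖) :=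
          mul_le_mul_of_nonneg_left hG (by positivity)
      _ = _ := by ring
  refine le_trans ?_ hfin
  rw [ContinuousMap.norm_le _ (by positivity)]
  intro x
  have h5 := hsol.sum_norm_le hV hδ hr0 haδ (hκ _ ((div_le_iff₀ hδ).1 h3)) x.2
  have h6 : ‖y x‖ ≤ ∑ j, ‖ext y x j‖ := by
    rw [← ext_of_mem y x.2]
    exact norm_le_sum _
  refine h6.trans (h5.trans ?_)
  set A := ∑ j, ‖endVal a (fun j x => ext y x j) j‖
  have hA0 : 0 ≤ A := by positivity
  have hd : 0 ≤ r * δ := by positivity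
  have e1 : Real.exp (-(r * δ * x)) ≤ 1 := Real.exp_le_one_iff.2 (by nlinarith [x.2.1])
  have e2 : Real.exp (-(r * δ * (1 - x))) ≤ 1 := Real.exp_le_one_iff.2 (by nlinarith [x.2.2])
  have h7 : weight (r * δ) A A G x ≤ 2 * A + G := by
    unfold weight
    nlinarith
  nlinarith [mul_le_mul_of_nonneg_right h2 hG0]

end Ray

end BVP
end

/-! ### The completeness and minimality theorem -/

theorem mainTheorem1 {n : ℕ} (b : Fin n → ℂ) (hb : ∀ j, b j ≠ 0)
    (C D : Matrix (Fin n) (Fin n) ℂ) (hCD : (Matrix.fromCols C D).rank = n)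
    (Q : ℝ → Matrix (Fin n) (Fin n) ℂ)
    (hQ : ∀ j k, IntegrableOn (fun x => Q x j k) (Icc (0 : ℝ) 1))
    (hQ0 : ∀ j k, b j ≠ b k → ContinuousWithinAt (fun x => Q x j k) (Icc (0 : ℝ) 1) 0)
    (hQ1 : ∀ j k, b j ≠ b k → ContinuousWithinAt (fun x => Q x j k) (Icc (0 : ℝ) 1) 1)
    (z : Fin 3 → ℂ) (hz : ∀ m, BVP.Admissible b (z m))
    (hz0 : (0 : ℂ) ∈ interior (convexHull ℝ (range z)))
    (hω : ∀ m, ‖BVP.omega0 b C D (z m)‖ + ‖BVP.omega1 b Q C D (z m)‖ ≠ 0)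
    {ι : Type*} (ev : ι → ℂ) (e : ι → BVP.L2 n)
    (he : BVP.IsRootSystem (BVP.bvpOperator b Q C D) ev e) :
    BVP.IsCompleteSystem e ∧ BVP.IsMinimalSystem e := by
  have hray : ∀ m, (BVP.bvpModel hb hQ C D).RayBound (z m) := fun m =>
    BVP.rayBound_bvpModel hb hQ hQ0 hQ1 (hz m) (hω m)
  refine ⟨(BVP.bvpModel hb hQ C D).isCompleteSystem (BVP.isExpType_sol_bvpModel hb hQ C D) hz0
    hray (BVP.dense_domain hb hQ C D) he, ?_⟩
  -- The bound on a single ray already shows that the characteristic determinant is not identically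
  -- zero, which is all that minimality needs.
  obtain ⟨r₀, h⟩ := (hray 0).charDet_ne_zero
  exact (BVP.bvpModel hb hQ C D).isMinimalSystem ⟨_, h r₀ le_rfl⟩ he
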